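/- **Setting.** Let $V=\{0,\dots,n-1\}$ with $n\ge 2$, let $w:V\to\mathbb R_{\ge 1}$ be vertex weights and $W=\max_v w(v)$. A simple undirected graph $G=(V,E)$ is initially edgeless and changes by insertions and deletions of single edges. For $\emptyset\ne S\subseteq V$ the density is $\rho_G(S)=|E(S)|/\sum_{v\in S}w(v)$, where $E(S)$ is the set of edges with both endpoints in $S$. $\mathrm{OPT}_{LP}(G)$ is the maximum of $\sum_{uv\in E}\min(x_u,x_v)$ over all $x\in\mathbb R^V_{\ge0}$ with $\sum_v w(v)x_v\le 1$. An (integral) orientation of $G$ directs each edge in exactly one direction; the load (weighted in-degree) of $v$ is its in-degree divided by $w(v)$. **Model.** Programs run on a real RAM: exact real arithmetic ($+,-,\times,\div$) and comparisons, integer words smaller than a bound $B$ with $+,-,\times$, integer division and remainder, and comparisons, arrays of words and of reals indexed by words, conversion of words to reals but no rounding of reals to words; each operation costs one step. A data structure consists of four fixed programs (preprocessing, insertion, deletion, query). The preprocessing gets $n,w,\varepsilon,T$ with all other memory zero. **Theorem.** There are a data structure and absolute constants $\varepsilon_0,C_0,C>0$ and $\kappa\in\mathbb N$ such that the following holds for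 all $n\ge2$, all $w:V\to\mathbb R_{\ge1}$, all $0<\varepsilon<\varepsilon_0$, all $T\ge C_0\log(nW)/\varepsilon^2$ and all $B\ge(n\log T\log(nW)/\varepsilon)^\kappa$. Put $$\sigma=\log\!\big(\log T\cdot\log(nW)/\varepsilon\big)=\log\log T+\log\log(nW)+\log(1/\varepsilon),\qquad A=\frac{\log T\,\log(nW)}{\varepsilon^2}\,\sigma .$$ The preprocessing takes at most $C(n+A)$ steps. After it and any sequence of edge insertions, edge deletions and queries, with $G$ the current graph: 1. (Orientation, explicit.) The memory holds an orientation of $G$ as an $n\times n$ matrix, and if $\mathrm{OPT}_{LP}(G)\le T$ then every load is at most $(1+\varepsilon)\mathrm{OPT}_{LP}(G)+C\log(nW)/\varepsilon$. 2. (Subgraph, implicit.) A query lists the vertices of some $S\subseteq V$ without repetition in at most $C(1+|S|)$ steps, and if $\mathrm{OPT}_{LP}(G)\le T$ then $S\neq\emptyset$ and $\rho_G(S)\ge(1-\varepsilon)\mathrm{OPT}_{LP}(G)-C\log(nW)/\varepsilon$. 3. (Amortized time.) The updates performed so far took at most $C\cdot A$ steps per update on average, that is, $m$ updates took at most $m\,C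 A$ steps in total. 4. (Worst-case time.) The next insertion (of a non-edge $uv$, $u\ne v$) or deletion (of an edge) halts within $C\,\dfrac{\log T\,\log^2(nW)}{\varepsilon^4}\,\sigma$ steps. -/

import Mathlib

/-! ## Vertex-weighted densest subgraph -/

namespace VWDSG

variable {n : ℕ}

/-- `ρ_G(S) = |E(S)| / w(S)`, where `E(S)` is the set of edges with both endpoints in `S`. -/
noncomputable def density (G : SimpleGraph (Fin n)) (w : Fin n → ℝ) (S : Finset (Fin n)) : ℝ :=
  ({e ∈ G.edgeSet | ∀ v ∈ e, v ∈ S}.ncard : ℝ) / ∑ v ∈ S, w v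

open Classical in
/-- The objective `∑_{uv ∈ E} min (x_u, x_v)` of the linear program. -/
noncomputable def lpObjective (G : SimpleGraph (Fin n)) (x : Fin n → ℝ) : ℝ :=
  ∑ e ∈ G.edgeFinset, (e.map x).inf

/-- The optimum of the linear program: maximize `∑_{uv ∈ E} min (x_u, x_v)` over all `x ≥ 0`
with `∑_v w(v) x_v ≤ 1`. -/
noncomputable def optLP (G : SimpleGraph (Fin n)) (w : Fin n → ℝ) : ℝ :=
  sSup {r | ∃ x : Fin n → ℝ, (∀ v, 0 ≤ x v) ∧ ∑ v, w v * x v ≤ 1 ∧ r = lpObjective G x}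

/-- `arc` (with `arc u v` read as "`u → v`") is an integral orientation of `G`: all arcs come from
edges, and each edge is directed in exactly one of its two directions. -/
def IsOrientation (G : SimpleGraph (Fin n)) (arc : Fin n → Fin n → Prop) : Prop :=
  (∀ u v, arc u v → G.Adj u v) ∧ ∀ u v, G.Adj u v → Xor (arc u v) (arc v u)

/-- The load (weighted in-degree) of `v`: its in-degree divided by its weight. -/
noncomputable def load (w : Fin n → ℝ) (arc : Fin n → Fin n → Prop) (v : Fin n) : ℝ :=
  ({u | arc u v}.ncard : ℝ) / w v

end VWDSG

/-! ## The real RAM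

A random access machine with integer words and with real numbers. Words are natural numbers below
a bound `B`, so the word length is `log₂ B`; arithmetic on words and exact field arithmetic and
comparisons on reals have unit cost. Words can be converted to reals, but there is no conversion
from reals to words (no floor function). A program is a fixed finite text and hence mentions only
finitely many registers and arrays, whatever the input is. -/

namespace RealRAM

/-- Word expressions. `var x` is register `x`, and `read a e` is the entry with index `e` of the
word array `a`. -/
inductive IExp where
  | const (c : ℕ)
  | var (x : ℕ)
  | read (a : ℕ) (e : IExp)
  | add (e f : IExp)
  | sub (e f : IExp)
  | mul (e f : IExp)
  | div (e f : IExp)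
  | mod (e f : IExp)

/-- Real expressions; `ofInt` converts a word to a real number. -/
inductive RExp where
  | ofInt (e : IExp)
  | var (x : ℕ)
  | read (a : ℕ) (e : IExp)
  | add (e f : RExp)
  | sub (e f : RExp)
  | mul (e f : RExp)
  | div (e f : RExp)

/-- Tests. -/
inductive Test where
  | ieq (e f : IExp)
  | ilt (e f : IExp)
  | req (e f : RExp)
  | rlt (e f : RExp)
  | not (b : Test)
  | and (b c : Test)

/-- Programs: assignments to registers and array entries, sequencing, branching and loops. -/
inductive Program where
  | skip
  | iset (x : ℕ) (e : IExp)
  | rset (x : ℕ) (e : RExp)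
  | iwrite (a : ℕ) (i e : IExp)
  | rwrite (a : ℕ) (i : IExp) (e : RExp)
  | seq (p q : Program)
  | branch (b : Test) (p q : Program)
  | loop (b : Test) (p : Program)

/-- Contents of the word registers, real registers, word arrays and real arrays. -/
structure State where
  ireg : ℕ → ℕ
  rreg : ℕ → ℝ
  imem : ℕ → ℕ → ℕ
  rmem : ℕ → ℕ → ℝ

/-- Value of a word expression; sums and products are reduced modulo `B`, and subtraction is
truncated at `0`. -/
def IExp.eval (B : ℕ) (s : State) : IExp → ℕ
  | const c => c % B
  | var x => s.ireg x
  | read a e => s.imem a (e.eval B s)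
  | add e f => (e.eval B s + f.eval B s) % B
  | sub e f => e.eval B s - f.eval B s
  | mul e f => (e.eval B s * f.eval B s) % B
  | div e f => e.eval B s / f.eval B s
  | mod e f => e.eval B s % f.eval B s

/-- Cost of evaluating a word expression: one step per node. -/
def IExp.cost : IExp → ℕ
  | const _ => 1
  | var _ => 1
  | read _ e => e.cost + 1
  | add e f => e.cost + f.cost + 1
  | sub e f => e.cost + f.cost + 1
  | mul e f => e.cost + f.cost + 1
  | div e f => e.cost + f.cost + 1
  | mod e f => e.cost + f.cost + 1

/-- Value of a real expression. -/
noncomputable def RExp.eval (B : ℕ) (s : State) : RExp → ℝ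
  | ofInt e => (e.eval B s : ℝ)
  | var x => s.rreg x
  | read a e => s.rmem a (e.eval B s)
  | add e f => e.eval B s + f.eval B s
  | sub e f => e.eval B s - f.eval B s
  | mul e f => e.eval B s * f.eval B s
  | div e f => e.eval B s / f.eval B s

/-- Cost of evaluating a real expression: one step per node. -/
def RExp.cost : RExp → ℕ
  | ofInt e => e.cost + 1
  | var _ => 1
  | read _ e => e.cost + 1
  | add e f => e.cost + f.cost + 1
  | sub e f => e.cost + f.cost + 1
  | mul e f => e.cost + f.cost + 1
  | div e f => e.cost + f.cost + 1

/-- Truth of a test. -/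
def Test.Holds (B : ℕ) (s : State) : Test → Prop
  | ieq e f => e.eval B s = f.eval B s
  | ilt e f => e.eval B s < f.eval B s
  | req e f => e.eval B s = f.eval B s
  | rlt e f => e.eval B s < f.eval B s
  | not b => ¬ b.Holds B s
  | and b c => b.Holds B s ∧ c.Holds B s

/-- Cost of a test: one step per node. -/
def Test.cost : Test → ℕ
  | ieq e f => e.cost + f.cost + 1
  | ilt e f => e.cost + f.cost + 1
  | req e f => e.cost + f.cost + 1
  | rlt e f => e.cost + f.cost + 1
  | not b => b.cost + 1
  | and b c => b.cost + c.cost + 1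

/-- Store the word `k` in register `x`. -/
def State.setI (s : State) (x k : ℕ) : State :=
  { s with ireg := Function.update s.ireg x k }

/-- Store the real number `r` in real register `x`. -/
def State.setR (s : State) (x : ℕ) (r : ℝ) : State :=
  { s with rreg := Function.update s.rreg x r }

/-- Store the word `k` in entry `i` of the word array `a`. -/
def State.writeI (s : State) (a i k : ℕ) : State :=
  { s with imem := Function.update s.imem a (Function.update (s.imem a) i k) }

/-- Store the real number `r` in entry `i` of the real array `a`. -/
def State.writeR (s : State) (a i : ℕ) (r : ℝ) : State :=
  { s with rmem := Function.update s.rmem a (Function.update (s.rmem a) i r) }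

/-- `Exec B p s t s'`: with word bound `B`, program `p` started in state `s` halts in state `s'`
after exactly `t` steps. -/
inductive Exec (B : ℕ) : Program → State → ℕ → State → Prop where
  | skip (s : State) : Exec B .skip s 1 s
  | iset (x : ℕ) (e : IExp) (s : State) :
      Exec B (.iset x e) s (e.cost + 1) (s.setI x (e.eval B s))
  | rset (x : ℕ) (e : RExp) (s : State) :
      Exec B (.rset x e) s (e.cost + 1) (s.setR x (e.eval B s))
  | iwrite (a : ℕ) (i e : IExp) (s : State) :
      Exec B (.iwrite a i e) s (i.cost + e.cost + 1) (s.writeI a (i.eval B s) (e.eval B s))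
  | rwrite (a : ℕ) (i : IExp) (e : RExp) (s : State) :
      Exec B (.rwrite a i e) s (i.cost + e.cost + 1) (s.writeR a (i.eval B s) (e.eval B s))
  | seq {p q : Program} {s s' s'' : State} {t t' : ℕ} :
      Exec B p s t s' → Exec B q s' t' s'' → Exec B (.seq p q) s (t + t') s''
  | branchTrue {b : Test} {p q : Program} {s s' : State} {t : ℕ} :
      b.Holds B s → Exec B p s t s' → Exec B (.branch b p q) s (b.cost + t + 1) s'
  | branchFalse {b : Test} {p q : Program} {s s' : State} {t : ℕ} :
      ¬ b.Holds B s → Exec B q s t s' → Exec B (.branch b p q) s (b.cost + t + 1) s'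
  | loopStep {b : Test} {p : Program} {s s' s'' : State} {t t' : ℕ} :
      b.Holds B s → Exec B p s t s' → Exec B (.loop b p) s' t' s'' →
      Exec B (.loop b p) s (b.cost + t + t' + 1) s''
  | loopEnd {b : Test} {p : Program} {s : State} :
      ¬ b.Holds B s → Exec B (.loop b p) s (b.cost + 1) s

end RealRAM

/-! ## Dynamic data structures on the real RAM -/

namespace VWDSG

open RealRAM

/-- A dynamic graph data structure: one program for the preprocessing of the edgeless weighted
graph, one for each kind of update, and one that lists the vertices of the current subgraph. -/
structure DataStructure where
  init : Program
  insert : Program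
  delete : Program
  query : Program

/-- Input of the preprocessing: `n` is in word register `0`, `ε` and `T` are in the real registers
`0` and `1`, the weights are in real array `0`, and everything else is `0`. -/
noncomputable def inputState {n : ℕ} (w : Fin n → ℝ) (ε T : ℝ) : State where
  ireg x := if x = 0 then n else 0
  rreg x := if x = 0 then ε else if x = 1 then T else 0
  imem _ _ := 0
  rmem a i := if h : a = 0 ∧ i < n then w ⟨i, h.2⟩ else 0

/-- The endpoints `u, v` of the edge to be inserted or deleted are passed in the word registers
`1` and `2`. -/
def withArgs {n : ℕ} (s : State) (u v : Fin n) : State :=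
  (s.setI 1 u).setI 2 v

/-- The orientation is stored explicitly, as a matrix in word array `0`: `u → v` if and only if
entry `u * n + v` is `1`. -/
def storedArc {n : ℕ} (s : State) (u v : Fin n) : Prop :=
  s.imem 0 (u * n + v) = 1

/-- `s` contains a list of the vertices of `S`, without repetition, in word array `1`, and its
length in word register `3`. -/
def ListsVertices {n : ℕ} (s : State) (S : Finset (Fin n)) : Prop :=
  s.ireg 3 = S.card ∧ ∀ v : Fin n, v ∈ S ↔ ∃ i < S.card, s.imem 1 i = v

/-- `Reach D B s₀ m τ G s`: starting in state `s₀` with the edgeless graph, some sequence of edge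
insertions, edge deletions and queries leads to the graph `G` and the state `s`; `m` is the number
of updates (insertions and deletions) in the sequence, and `τ` is the total number of steps spent
on the updates. -/
inductive Reach {n : ℕ} (D : DataStructure) (B : ℕ) (s₀ : State) :
    ℕ → ℕ → SimpleGraph (Fin n) → State → Prop where
  | start : Reach D B s₀ 0 0 ⊥ s₀
  | insert {m τ t : ℕ} {G : SimpleGraph (Fin n)} {s s' : State} {u v : Fin n} :
      Reach D B s₀ m τ G s → u ≠ v → ¬ G.Adj u v → Exec B D.insert (withArgs s u v) t s' →
      Reach D B s₀ (m + 1) (τ + t) (G ⊔ SimpleGraph.edge u v) s'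
  | delete {m τ t : ℕ} {G : SimpleGraph (Fin n)} {s s' : State} {u v : Fin n} :
      Reach D B s₀ m τ G s → G.Adj u v → Exec B D.delete (withArgs s u v) t s' →
      Reach D B s₀ (m + 1) (τ + t) (G.deleteEdges {s(u, v)}) s'
  | query {m τ t : ℕ} {G : SimpleGraph (Fin n)} {s s' : State} :
      Reach D B s₀ m τ G s → Exec B D.query s t s' →
      Reach D B s₀ m τ G s'

/-- `log T · log(nW) / ε²`, times the factor `log(log T · log(nW) / ε)`, which is
`log log T + log log (nW) + log (1/ε)`. -/
noncomputable def amortizedRate (n : ℕ) (W ε T : ℝ) : ℝ :=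
  Real.log T * Real.log (n * W) / ε ^ 2 * Real.log (Real.log T * Real.log (n * W) / ε)

/-- `log T · log²(nW) / ε⁴`, times the same factor. -/
noncomputable def worstCaseRate (n : ℕ) (W ε T : ℝ) : ℝ :=
  Real.log T * Real.log (n * W) ^ 2 / ε ^ 4 * Real.log (Real.log T * Real.log (n * W) / ε)

end VWDSG

/-! Every vertex carries a level and every arc into `v` a label, which is the level of `v` or one
more. Levels measure load: the threshold `theta k i` grows per level by the factor `1 + 2/k` plus 2,
with `k` of order `log(nW)/ε²`. A vertex of level `f` has load at least `theta k (f - 1)` if `f ≥ 1`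
and at most `theta k (f + 1)` if `f` is below the maximal level `L` (`Valid.le_deg`,
`Valid.deg_le`). The label of an arc `u → v` is at most the level of `u` plus 2, so arcs climb at
most two levels.

Quality. Let `M` be the highest occupied level and `S_i` the set of vertices of level at least `i`.
Descend from `M` to the first `i` with `w(S_i) ≤ (1 + ε/4) w(S_{i+2})`, or to 0. Since weights of
nonempty sets lie between 1 and `nW`, this takes `O(log(nW)/ε)` levels. All arcs into `S_{i+2}`
start in `S_i`, so `S_i` spans at least `theta k (i + 1) * w(S_{i+2})` edges (`Valid.density_ge`),
and `theta k (i + 1)` is at most about `ρ(S_i)`. Climbing back to `M + 1` costs a factor `1 + ε/4`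
and an additive `O(log(nW)/ε)` (`Valid.theta_top_le`). As `theta k (M + 1)` bounds all loads,
maximal loads bound the LP optimum, and the optimum bounds every density, all these numbers agree up
to the claimed error (`Valid.quality`).

Updates. Changing a level concerns all in-arcs of a vertex, so the work is spread out: at each
vertex that it visits, an update moves at most `k` labels. `Band` bounds the number of labels still
to be moved by about `k` times the distance of the degree to the threshold at which the level
changes; once no label is left to move, the level changes in constant time. If during an insertion
the arc `z → y` to be relabelled has a tail that is too low, the new arc takes its place, and the
edge `yz` is inserted again with head `z`, at least two levels lower. After a deletion the missing
arc is passed upwards along out-arcs whose label exceeds the tail's level by 2, until its head may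
safely fall. These chains have length at most `L`, which is of order `k log T`. Hence an insertion
takes `O(Lk)` steps and a deletion `O(L + k)`.

Amortization. The potential is the sum of `L - label` over all arcs. Relabellings during insertions
are paid by its decrease; an insertion adds at most `L` to it, a deletion at most `2L + k`
(`reach_invariant`). Lists in arrays with back pointers make every elementary operation constant
time, so the factor `σ` is needed only as a number at least 1. -/

namespace RealRAM

/-! ### Total correctness with exact running times. -/

/-- `WP B p s Q`: program `p` started in `s` halts after some number `t` of steps in a state `s'`
with `Q t s'`. -/
def WP (B : ℕ) (p : Program) (s : State) (Q : ℕ → State → Prop) : Prop :=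
  ∃ t s', Exec B p s t s' ∧ Q t s'

section WP

variable {B : ℕ} {p q : Program} {s : State} {Q R : ℕ → State → Prop}

theorem WP.mono (h : WP B p s Q) (hQ : ∀ t s', Q t s' → R t s') : WP B p s R := by
  obtain ⟨t, s', he, hq⟩ := h
  exact ⟨t, s', he, hQ _ _ hq⟩

theorem wp_skip : WP B .skip s Q ↔ Q 1 s := by
  constructor
  · rintro ⟨t, s', h, hq⟩; cases h; exact hq
  · exact fun h => ⟨_, _, .skip s, h⟩

theorem wp_iset {x : ℕ} {e : IExp} :
    WP B (.iset x e) s Q ↔ Q (e.cost + 1) (s.setI x (e.eval B s)) := by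
  constructor
  · rintro ⟨t, s', h, hq⟩; cases h; exact hq
  · exact fun h => ⟨_, _, .iset x e s, h⟩

theorem wp_rset {x : ℕ} {e : RExp} :
    WP B (.rset x e) s Q ↔ Q (e.cost + 1) (s.setR x (e.eval B s)) := by
  constructor
  · rintro ⟨t, s', h, hq⟩; cases h; exact hq
  · exact fun h => ⟨_, _, .rset x e s, h⟩

theorem wp_iwrite {a : ℕ} {i e : IExp} :
    WP B (.iwrite a i e) s Q ↔
      Q (i.cost + e.cost + 1) (s.writeI a (i.eval B s) (e.eval B s)) := by
  constructor
  · rintro ⟨t, s', h, hq⟩; cases h; exact hq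
  · exact fun h => ⟨_, _, .iwrite a i e s, h⟩

theorem wp_rwrite {a : ℕ} {i : IExp} {e : RExp} :
    WP B (.rwrite a i e) s Q ↔
      Q (i.cost + e.cost + 1) (s.writeR a (i.eval B s) (e.eval B s)) := by
  constructor
  · rintro ⟨t, s', h, hq⟩; cases h; exact hq
  · exact fun h => ⟨_, _, .rwrite a i e s, h⟩

theorem wp_seq :
    WP B (.seq p q) s Q ↔ WP B p s fun t s' => WP B q s' fun t' s'' => Q (t + t') s'' := by
  constructor
  · rintro ⟨t, s', h, hq⟩
    cases h with
    | seq h₁ h₂ => exact ⟨_, _, h₁, _, _, h₂, hq⟩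
  · rintro ⟨t, s', h₁, t', s'', h₂, hq⟩
    exact ⟨_, _, .seq h₁ h₂, hq⟩

theorem wp_branch {b : Test} :
    WP B (.branch b p q) s Q ↔
      (b.Holds B s ∧ WP B p s fun t s' => Q (b.cost + t + 1) s') ∨
        (¬ b.Holds B s ∧ WP B q s fun t s' => Q (b.cost + t + 1) s') := by
  constructor
  · rintro ⟨t, s', h, hq⟩
    cases h with
    | branchTrue hb h => exact .inl ⟨hb, _, _, h, hq⟩
    | branchFalse hb h => exact .inr ⟨hb, _, _, h, hq⟩
  · rintro (⟨hb, t, s', h, hq⟩ | ⟨hb, t, s', h, hq⟩)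
    · exact ⟨_, _, .branchTrue hb h, hq⟩
    · exact ⟨_, _, .branchFalse hb h, hq⟩

theorem wp_branch_true {b : Test} (hb : b.Holds B s)
    (h : WP B p s fun t s' => Q (b.cost + t + 1) s') : WP B (.branch b p q) s Q :=
  wp_branch.2 (.inl ⟨hb, h⟩)

theorem wp_branch_false {b : Test} (hb : ¬ b.Holds B s)
    (h : WP B q s fun t s' => Q (b.cost + t + 1) s') : WP B (.branch b p q) s Q :=
  wp_branch.2 (.inr ⟨hb, h⟩)

theorem wp_loop_step {b : Test} (hb : b.Holds B s)
    (h : WP B p s fun t s' => WP B (.loop b p) s' fun t' s'' => Q (b.cost + t + t' + 1) s'') :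
    WP B (.loop b p) s Q := by
  obtain ⟨t, s', h₁, t', s'', h₂, hq⟩ := h
  exact ⟨_, _, .loopStep hb h₁ h₂, hq⟩

theorem wp_loop_end {b : Test} (hb : ¬ b.Holds B s) (h : Q (b.cost + 1) s) :
    WP B (.loop b p) s Q :=
  ⟨_, _, .loopEnd hb, h⟩

end WP

/-- `WP` provides some execution, while `Reach` contains arbitrary ones; determinism identifies the
two (`WP.of_exec`). -/
theorem Exec.deterministic {B : ℕ} {p : Program} {s s₁ : State} {t₁ : ℕ}
    (h₁ : Exec B p s t₁ s₁) :
    ∀ {t₂ : ℕ} {s₂ : State}, Exec B p s t₂ s₂ → t₁ = t₂ ∧ s₁ = s₂ := by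
  induction h₁ with
  | skip s => intro _ _ h; cases h; exact ⟨rfl, rfl⟩
  | iset x e s => intro _ _ h; cases h; exact ⟨rfl, rfl⟩
  | rset x e s => intro _ _ h; cases h; exact ⟨rfl, rfl⟩
  | iwrite a i e s => intro _ _ h; cases h; exact ⟨rfl, rfl⟩
  | rwrite a i e s => intro _ _ h; cases h; exact ⟨rfl, rfl⟩
  | seq _ _ ih ih' =>
    intro _ _ h
    cases h with
    | seq h h' =>
      obtain ⟨rfl, rfl⟩ := ih h
      obtain ⟨rfl, rfl⟩ := ih' h'
      exact ⟨rfl, rfl⟩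
  | branchTrue hb _ ih =>
    intro _ _ h
    cases h with
    | branchTrue _ h => obtain ⟨rfl, rfl⟩ := ih h; exact ⟨rfl, rfl⟩
    | branchFalse hb' _ => exact absurd hb hb'
  | branchFalse hb _ ih =>
    intro _ _ h
    cases h with
    | branchTrue hb' _ => exact absurd hb' hb
    | branchFalse _ h => obtain ⟨rfl, rfl⟩ := ih h; exact ⟨rfl, rfl⟩
  | loopStep hb _ _ ih ih' =>
    intro _ _ h
    cases h with
    | loopStep _ h h' =>
      obtain ⟨rfl, rfl⟩ := ih h
      obtain ⟨rfl, rfl⟩ := ih' h'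
      exact ⟨rfl, rfl⟩
    | loopEnd hb' => exact absurd hb hb'
  | loopEnd hb =>
    intro _ _ h
    cases h with
    | loopStep hb' _ _ => exact absurd hb' hb
    | loopEnd _ => exact ⟨rfl, rfl⟩

theorem WP.of_exec {B : ℕ} {p : Program} {s s' : State} {t : ℕ} {Q : ℕ → State → Prop}
    (h : WP B p s Q) (he : Exec B p s t s') : Q t s' := by
  obtain ⟨t₁, s₁, h₁, hq⟩ := h
  obtain ⟨rfl, rfl⟩ := h₁.deterministic he
  exact hq

section Frame

variable (s : State) (x k y a i : ℕ) (r : ℝ)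

@[simp] theorem setI_ireg : (s.setI x k).ireg y = if y = x then k else s.ireg y := by
  simp [State.setI, Function.update_apply]
@[simp] theorem setI_rreg : (s.setI x k).rreg = s.rreg := rfl
@[simp] theorem setI_imem : (s.setI x k).imem = s.imem := rfl
@[simp] theorem setI_rmem : (s.setI x k).rmem = s.rmem := rfl
@[simp] theorem setR_rreg : (s.setR x r).rreg y = if y = x then r else s.rreg y := by
  simp [State.setR, Function.update_apply]
@[simp] theorem setR_ireg : (s.setR x r).ireg = s.ireg := rfl
@[simp] theorem setR_imem : (s.setR x r).imem = s.imem := rfl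
@[simp] theorem setR_rmem : (s.setR x r).rmem = s.rmem := rfl
@[simp] theorem writeI_imem : (s.writeI a i k).imem y =
    if y = a then Function.update (s.imem a) i k else s.imem y := by
  by_cases h : y = a
  · subst h; simp [State.writeI]
  · simp [State.writeI, h]
@[simp] theorem writeI_ireg : (s.writeI a i k).ireg = s.ireg := rfl
@[simp] theorem writeI_rreg : (s.writeI a i k).rreg = s.rreg := rfl
@[simp] theorem writeI_rmem : (s.writeI a i k).rmem = s.rmem := rfl
@[simp] theorem writeR_rmem : (s.writeR a i r).rmem y =
    if y = a then Function.update (s.rmem a) i r else s.rmem y := by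
  by_cases h : y = a
  · subst h; simp [State.writeR]
  · simp [State.writeR, h]
@[simp] theorem writeR_ireg : (s.writeR a i r).ireg = s.ireg := rfl
@[simp] theorem writeR_rreg : (s.writeR a i r).rreg = s.rreg := rfl
@[simp] theorem writeR_imem : (s.writeR a i r).imem = s.imem := rfl

end Frame

attribute [simp] IExp.eval IExp.cost RExp.eval RExp.cost Test.Holds Test.cost
attribute [simp] wp_skip wp_iset wp_rset wp_iwrite wp_rwrite wp_seq

/-! ### Buckets -/

/-- The arrays `cnt`, `elem`, `pos` store a partition of items (with codes `code i`) into lists,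
where item `i` is in the list with key `κ i`, if any. -/
structure Bucketed {ι : Type} (N : ℕ) (code : ι → ℕ) (cnt elem pos : ℕ → ℕ)
    (κ : ι → Option ℕ) : Prop where
  -- The list with key `c` occupies the start of the block of `N` entries of `elem` that begins at
  -- `c * N`, and `pos` is the offset of an item in its block.
  mem : ∀ i c, κ i = some c → pos (code i) < cnt c ∧ elem (c * N + pos (code i)) = code i
  -- Excludes stale entries below the counter, so that `cnt c` is the exact size of the list and no
  -- block overflows if there are at most `N` items.
  get : ∀ c r, r < cnt c → ∃ i, κ i = some c ∧ elem (c * N + r) = code i ∧ pos (code i) = r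

namespace Bucketed

variable {ι : Type} [Fintype ι] {N : ℕ} {code : ι → ℕ} {cnt elem pos : ℕ → ℕ}
  {κ : ι → Option ℕ}

theorem cnt_eq (h : Bucketed N code cnt elem pos κ) (hc : Function.Injective code) (c : ℕ) :
    cnt c = (Finset.univ.filter fun i => κ i = some c).card := by
  symm
  rw [← Finset.card_range (cnt c)]
  refine Finset.card_bij (fun i _ => pos (code i)) ?_ ?_ ?_
  · intro i hi
    simp only [Finset.mem_filter, Finset.mem_univ, true_and] at hi
    simpa using (h.mem i c hi).1
  · intro i hi j hj hij
    simp only [Finset.mem_filter, Finset.mem_univ, true_and] at hi hj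
    apply hc
    rw [← (h.mem i c hi).2, ← (h.mem j c hj).2, hij]
  · intro r hr
    obtain ⟨i, hi, -, hr'⟩ := h.get c r (by simpa using hr)
    exact ⟨i, by simpa using hi, hr'⟩

theorem cnt_le (h : Bucketed N code cnt elem pos κ) (hc : Function.Injective code)
    (hN : Fintype.card ι ≤ N) (c : ℕ) : cnt c ≤ N := by
  rw [h.cnt_eq hc]
  exact (Finset.card_le_univ _).trans hN

theorem cnt_lt (h : Bucketed N code cnt elem pos κ) (hc : Function.Injective code)
    (hN : Fintype.card ι ≤ N) {i : ι} (hi : κ i = none) (c : ℕ) : cnt c < N := by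
  rw [h.cnt_eq hc]
  refine lt_of_lt_of_le (Finset.card_lt_univ_of_notMem (x := i) ?_) hN
  simp [hi]

theorem index_inj {N c r c' r' : ℕ} (hr : r < N) (hr' : r' < N)
    (h : c * N + r = c' * N + r') : c = c' ∧ r = r' := by
  have h1 : (c * N + r) / N = c := by
    rw [mul_comm, Nat.mul_add_div (by omega), Nat.div_eq_of_lt hr, add_zero]
  have h2 : (c' * N + r') / N = c' := by
    rw [mul_comm, Nat.mul_add_div (by omega), Nat.div_eq_of_lt hr', add_zero]
  have h3 : c = c' := by rw [← h1, ← h2, h]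
  subst h3
  exact ⟨rfl, by omega⟩

/-- The new item is in no list yet, so each list has fewer than `N` items and the appended entry
stays inside its block. -/
theorem insert [DecidableEq ι] (h : Bucketed N code cnt elem pos κ) (hc : Function.Injective code)
    (hN : Fintype.card ι ≤ N) {i : ι} (hi : κ i = none) (c : ℕ) :
    Bucketed N code (Function.update cnt c (cnt c + 1))
      (Function.update elem (c * N + cnt c) (code i)) (Function.update pos (code i) (cnt c))
      (Function.update κ i (some c)) := by
  have hlt := h.cnt_lt hc hN hi
  constructor
  · intro j c' hj
    by_cases hji : j = i
    · subst hji
      simp only [Function.update_self, Option.some.injEq] at hj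
      subst hj
      simp
    · rw [Function.update_of_ne hji] at hj
      obtain ⟨h1, h2⟩ := h.mem j c' hj
      rw [Function.update_of_ne (fun e => hji (hc e))]
      refine ⟨?_, ?_⟩
      · by_cases e : c' = c
        · subst e; simp; omega
        · rwa [Function.update_of_ne e]
      · rw [Function.update_of_ne, h2]
        intro e
        obtain ⟨rfl, e2⟩ := index_inj (h1.trans (hlt _)) (hlt _) e
        omega
  · intro c' r hr
    by_cases e : c' = c ∧ r = cnt c
    · obtain ⟨rfl, rfl⟩ := e
      exact ⟨i, by simp⟩
    · have hr' : r < cnt c' := by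
        by_cases e' : c' = c
        · subst e'
          simp only [Function.update_self] at hr
          simp only [true_and] at e
          omega
        · rwa [Function.update_of_ne e'] at hr
      obtain ⟨j, h1, h2, h3⟩ := h.get c' r hr'
      have hji : j ≠ i := by rintro rfl; simp [hi] at h1
      refine ⟨j, ?_, ?_, ?_⟩
      · rwa [Function.update_of_ne hji]
      · rw [Function.update_of_ne, h2]
        intro e''
        obtain ⟨rfl, e2⟩ := index_inj (hr'.trans (hlt _)) (hlt _) e''
        omega
      · rwa [Function.update_of_ne (fun e => hji (hc e))]

/-- The last entry `l` of the list is moved into the gap. This is harmless if `l` is the removed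
item itself, since nothing is required of the position of an item in no list. -/
theorem remove [DecidableEq ι] (h : Bucketed N code cnt elem pos κ) (hc : Function.Injective code)
    (hN : Fintype.card ι ≤ N) {i : ι} {c : ℕ} (hi : κ i = some c) :
    Bucketed N code (Function.update cnt c (cnt c - 1))
      (Function.update elem (c * N + pos (code i)) (elem (c * N + (cnt c - 1))))
      (Function.update pos (elem (c * N + (cnt c - 1))) (pos (code i)))
      (Function.update κ i none) := by
  have hle := h.cnt_le hc hN
  obtain ⟨hp, he⟩ := h.mem i c hi
  obtain ⟨l, hl, hel, hpl⟩ := h.get c (cnt c - 1) (by omega)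
  rw [hel]
  constructor
  · intro j c' hj
    have hji : j ≠ i := by rintro rfl; simp at hj
    rw [Function.update_of_ne hji] at hj
    obtain ⟨h1, h2⟩ := h.mem j c' hj
    by_cases hjl : j = l
    · subst hjl
      obtain rfl : c = c' := by simpa [hl] using hj
      have : pos (code j) ≠ pos (code i) := by
        intro e; apply hji; apply hc; rw [← h2, e, he]
      simp only [Function.update_self, and_true]
      omega
    · rw [Function.update_of_ne (fun e => hjl (hc e))]
      refine ⟨?_, ?_⟩
      · by_cases e : c' = c
        · subst e
          have : pos (code j) ≠ pos (code l) := by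
            intro e; apply hjl; apply hc
            rw [← h2, e]
            exact (h.mem l _ hl).2
          simp only [Function.update_self]
          omega
        · rwa [Function.update_of_ne e]
      · rw [Function.update_of_ne, h2]
        intro e
        obtain ⟨rfl, e2⟩ := index_inj (h1.trans_le (hle _)) (hp.trans_le (hle _)) e
        apply hji; apply hc; rw [← h2, e2, he]
  · intro c' r hr
    have hr' : r < cnt c' := by
      by_cases e : c' = c
      · subst e; simp only [Function.update_self] at hr; omega
      · rwa [Function.update_of_ne e] at hr
    by_cases e : c' = c ∧ r = pos (code i)
    · obtain ⟨rfl, rfl⟩ := e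
      refine ⟨l, ?_, by simp, by simp⟩
      rw [Function.update_of_ne]
      · exact hl
      · rintro rfl
        simp only [Function.update_self] at hr
        omega
    · obtain ⟨j, h1, h2, h3⟩ := h.get c' r hr'
      have hji : j ≠ i := by
        rintro rfl
        apply e
        obtain rfl : c = c' := by simpa [hi] using h1
        exact ⟨rfl, h3.symm⟩
      have hjl : j ≠ l := by
        rintro rfl
        obtain rfl : c = c' := by simpa [hl] using h1
        simp only [Function.update_self] at hr
        omega
      refine ⟨j, ?_, ?_, ?_⟩
      · rwa [Function.update_of_ne hji]
      · rw [Function.update_of_ne, h2]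
        intro e'
        obtain ⟨rfl, e2⟩ := index_inj (hr'.trans_le (hle _)) (hp.trans_le (hle _)) e'
        exact e ⟨rfl, e2⟩
      · rwa [Function.update_of_ne (fun e => hjl (hc e))]

end Bucketed

/-- Append the item in register `10` to the list whose key is in register `11`. -/
def bucketInsert (a : ℕ) : Program :=
  .seq (.iwrite (a + 1) (.add (.mul (.var 11) (.var 7)) (.read a (.var 11))) (.var 10)) <|
  .seq (.iwrite (a + 2) (.var 10) (.read a (.var 11))) <|
  .iwrite a (.var 11) (.add (.read a (.var 11)) (.const 1))

/-- Remove the item in register `10` from the list whose key is in register `11`. -/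
def bucketRemove (a : ℕ) : Program :=
  .seq (.iwrite a (.var 11) (.sub (.read a (.var 11)) (.const 1))) <|
  .seq (.iset 12 (.read (a + 1) (.add (.mul (.var 11) (.var 7)) (.read a (.var 11))))) <|
  .seq (.iwrite (a + 1) (.add (.mul (.var 11) (.var 7)) (.read (a + 2) (.var 10))) (.var 12)) <|
  .iwrite (a + 2) (.var 12) (.read (a + 2) (.var 10))

theorem wp_bucketInsert {ι : Type} [Fintype ι] [DecidableEq ι] {B a N : ℕ} {code : ι → ℕ}
    {κ : ι → Option ℕ} {s : State} {i : ι} {c : ℕ}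
    (h : Bucketed N code (s.imem a) (s.imem (a + 1)) (s.imem (a + 2)) κ)
    (hc : Function.Injective code) (hN : Fintype.card ι ≤ N) (hi : κ i = none)
    (h7 : s.ireg 7 = N) (h10 : s.ireg 10 = code i) (h11 : s.ireg 11 = c)
    (hB : c * N + N < B) :
    WP B (bucketInsert a) s fun t s' => t ≤ 19 ∧
      Bucketed N code (s'.imem a) (s'.imem (a + 1)) (s'.imem (a + 2))
        (Function.update κ i (some c)) ∧
      s'.ireg = s.ireg ∧ s'.rreg = s.rreg ∧ s'.rmem = s.rmem ∧
      ∀ b, b ≠ a → b ≠ a + 1 → b ≠ a + 2 → s'.imem b = s.imem b := by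
  have hlt := h.cnt_lt hc hN hi c
  have e1 : 1 % B = 1 := Nat.mod_eq_of_lt (by omega)
  have e2 : (c * N) % B = c * N := Nat.mod_eq_of_lt (by omega)
  have e3 : (c * N + s.imem a c) % B = c * N + s.imem a c := Nat.mod_eq_of_lt (by omega)
  have e4 : (s.imem a c + 1) % B = s.imem a c + 1 := Nat.mod_eq_of_lt (by omega)
  simp only [bucketInsert, wp_seq, wp_iwrite, IExp.eval, IExp.cost, writeI_ireg, writeI_rreg,
    writeI_rmem, writeI_imem, h7, h10, h11, e2, e3, e1]
  have := h.insert hc hN hi c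
  refine ⟨by omega, ?_, trivial, trivial, trivial, ?_⟩
  · simpa [e4] using this
  · intro b h1 h2 h3
    simp [h1, h2, h3]

theorem wp_bucketRemove {ι : Type} [Fintype ι] [DecidableEq ι] {B a N : ℕ} {code : ι → ℕ}
    {κ : ι → Option ℕ} {s : State} {i : ι} {c : ℕ}
    (h : Bucketed N code (s.imem a) (s.imem (a + 1)) (s.imem (a + 2)) κ)
    (hc : Function.Injective code) (hN : Fintype.card ι ≤ N) (hi : κ i = some c)
    (h7 : s.ireg 7 = N) (h10 : s.ireg 10 = code i) (h11 : s.ireg 11 = c)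
    (hB : c * N + N < B) :
    WP B (bucketRemove a) s fun t s' => t ≤ 26 ∧
      Bucketed N code (s'.imem a) (s'.imem (a + 1)) (s'.imem (a + 2))
        (Function.update κ i none) ∧
      (∀ r, r ≠ 12 → s'.ireg r = s.ireg r) ∧ s'.rreg = s.rreg ∧ s'.rmem = s.rmem ∧
      ∀ b, b ≠ a → b ≠ a + 1 → b ≠ a + 2 → s'.imem b = s.imem b := by
  have hle := h.cnt_le hc hN c
  obtain ⟨hp, -⟩ := h.mem i c hi
  have hN0 : 0 < N := by omega
  have e1 : 1 % B = 1 := Nat.mod_eq_of_lt (by omega)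
  have e3 : (c * N + (s.imem a c - 1)) % B = c * N + (s.imem a c - 1) :=
    Nat.mod_eq_of_lt (by omega)
  have e4 : (c * N + s.imem (a + 2) (code i)) % B = c * N + s.imem (a + 2) (code i) :=
    Nat.mod_eq_of_lt (by omega)
  have := h.remove hc hN hi
  simp [bucketRemove, wp_seq, wp_iwrite, wp_iset, IExp.eval, IExp.cost, writeI_ireg, writeI_rreg,
    writeI_rmem, writeI_imem, setI_ireg, setI_imem, setI_rreg, setI_rmem,
    h7, h10, h11, e1, e3, e4, this]
  refine ⟨fun r h h' => absurd h' h, fun b h1 h2 h3 => ?_⟩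
  simp [h1, h2, h3]

end RealRAM
-- Labelled orientations and their representation in memory.
namespace VWDSG

open RealRAM

/-- An abstract configuration: a partial labelling of the pairs `(u, v)`, defined on the arcs
`u → v`, and a level for every vertex. -/
structure Conf (n : ℕ) where
  lab : Fin n × Fin n → Option ℕ
  lev : Fin n → ℕ

/-- Position of the entry `(u, v)` in an `n × n` matrix. -/
def pairCode {n : ℕ} (p : Fin n × Fin n) : ℕ := p.1 * n + p.2

theorem pairCode_lt {n : ℕ} (p : Fin n × Fin n) : pairCode p < n * n := by
  obtain ⟨u, v⟩ := p
  have h1 := u.isLt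
  have h2 := v.isLt
  simp only [pairCode]
  calc (u : ℕ) * n + v < u * n + n := by omega
    _ = (u + 1) * n := by ring
    _ ≤ n * n := Nat.mul_le_mul_right _ h1

theorem pairCode_div {n : ℕ} (p : Fin n × Fin n) : pairCode p / n = p.1 := by
  have h2 := p.2.isLt
  simp only [pairCode]
  rw [mul_comm, Nat.mul_add_div (by omega), Nat.div_eq_of_lt h2, add_zero]

theorem pairCode_mod {n : ℕ} (p : Fin n × Fin n) : pairCode p % n = p.2 := by
  have h2 := p.2.isLt
  simp only [pairCode]
  rw [mul_comm, Nat.mul_add_mod, Nat.mod_eq_of_lt h2]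

theorem pairCode_injective {n : ℕ} : Function.Injective (pairCode (n := n)) := by
  intro p q h
  refine Prod.ext (Fin.ext ?_) (Fin.ext ?_)
  · rw [← pairCode_div, h, pairCode_div]
  · rw [← pairCode_mod, h, pairCode_mod]

/-- The thresholds `θ_i` on the loads. -/
noncomputable def theta (k : ℕ) : ℕ → ℝ
  | 0 => 0
  -- The gap, times a weight at least 1, is wide enough for relabelling all in-arcs at `k` per
  -- update before the degree crosses it (`near_up`, `near_down`).
  | i + 1 => theta k i * (1 + 2 / k) + 2

namespace Conf

variable {n : ℕ} (A : Conf n) (L : ℕ)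

/-- The number of arcs into `v`. -/
def deg (v : Fin n) : ℕ := (Finset.univ.filter fun u => (A.lab (u, v)).isSome).card

/-- The number of arcs into `v` with label `j`. -/
def num (v : Fin n) (j : ℕ) : ℕ := (Finset.univ.filter fun u => A.lab (u, v) = some j).card

/-- Add the arc `x → y` with label `j`. -/
def add (x y : Fin n) (j : ℕ) : Conf n := { A with lab := Function.update A.lab (x, y) (some j) }

/-- Remove the arc `x → y`. -/
def remove (x y : Fin n) : Conf n := { A with lab := Function.update A.lab (x, y) none }

/-- Change the level of `y` to `j`. -/
def setLev (y : Fin n) (j : ℕ) : Conf n := { A with lev := Function.update A.lev y j }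

/-- Key of an arc in the lists of arcs with common head and label. -/
def inKey (p : Fin n × Fin n) : Option ℕ := (A.lab p).map (p.2 * (L + 3) + ·)

/-- Key of an arc in the lists of arcs with common tail and label. -/
def outKey (p : Fin n × Fin n) : Option ℕ := (A.lab p).map (p.1 * (L + 3) + ·)

variable {A}

@[simp] theorem add_lev (x y : Fin n) (j : ℕ) : (A.add x y j).lev = A.lev := rfl
@[simp] theorem remove_lev (x y : Fin n) : (A.remove x y).lev = A.lev := rfl
@[simp] theorem setLev_lab (y : Fin n) (j : ℕ) : (A.setLev y j).lab = A.lab := rfl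
@[simp] theorem setLev_deg (y : Fin n) (j : ℕ) : (A.setLev y j).deg = A.deg := rfl
@[simp] theorem setLev_num (y : Fin n) (j : ℕ) : (A.setLev y j).num = A.num := rfl
@[simp] theorem setLev_inKey (y : Fin n) (j : ℕ) : (A.setLev y j).inKey L = A.inKey L := rfl
@[simp] theorem setLev_outKey (y : Fin n) (j : ℕ) : (A.setLev y j).outKey L = A.outKey L := rfl
@[simp] theorem setLev_lev (y : Fin n) (j : ℕ) :
    (A.setLev y j).lev = Function.update A.lev y j := rfl

theorem add_inKey (x y : Fin n) (j : ℕ) :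
    (A.add x y j).inKey L = Function.update (A.inKey L) (x, y) (some (y * (L + 3) + j)) := by
  ext1 p
  by_cases h : p = (x, y)
  · subst h; simp [inKey, add]
  · simp [inKey, add, h]

theorem add_outKey (x y : Fin n) (j : ℕ) :
    (A.add x y j).outKey L = Function.update (A.outKey L) (x, y) (some (x * (L + 3) + j)) := by
  ext1 p
  by_cases h : p = (x, y)
  · subst h; simp [outKey, add]
  · simp [outKey, add, h]

theorem remove_inKey (x y : Fin n) :
    (A.remove x y).inKey L = Function.update (A.inKey L) (x, y) none := by
  ext1 p
  by_cases h : p = (x, y)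
  · subst h; simp [inKey, remove]
  · simp [inKey, remove, h]

theorem remove_outKey (x y : Fin n) :
    (A.remove x y).outKey L = Function.update (A.outKey L) (x, y) none := by
  ext1 p
  by_cases h : p = (x, y)
  · subst h; simp [outKey, remove]
  · simp [outKey, remove, h]

theorem deg_add {x y : Fin n} (h : A.lab (x, y) = none) (j : ℕ) (v : Fin n) :
    (A.add x y j).deg v = A.deg v + if v = y then 1 else 0 := by
  unfold deg add
  split_ifs with hv
  · subst hv
    rw [← Finset.card_insert_of_notMem (a := x)]
    · congr 1; ext u; by_cases hu : u = x <;> simp [hu]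
    · simp [h]
  · rw [add_zero]; congr 1; ext u; simp [hv]

theorem num_add {x y : Fin n} (h : A.lab (x, y) = none) (j : ℕ) (v : Fin n) (i : ℕ) :
    (A.add x y j).num v i = A.num v i + if v = y ∧ i = j then 1 else 0 := by
  unfold num add
  split_ifs with hv
  · obtain ⟨rfl, rfl⟩ := hv
    rw [← Finset.card_insert_of_notMem (a := x)]
    · congr 1; ext u; by_cases hu : u = x <;> simp [hu]
    · simp [h]
  · rw [add_zero]; congr 1; ext u
    by_cases hu : u = x
    · by_cases hv' : v = y
      · simp only [hv', true_and] at hv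
        simp [hu, hv', h, Ne.symm hv]
      · simp [hu, hv']
    · simp [hu]

theorem add_remove {x y : Fin n} {j : ℕ} (h : A.lab (x, y) = some j) :
    (A.remove x y).add x y j = A := by
  cases A
  simp only [add, remove, Function.update_idem]
  simp only at h
  rw [← h, Function.update_eq_self]

theorem remove_lab_self (x y : Fin n) : (A.remove x y).lab (x, y) = none := by
  simp [remove]

theorem deg_remove {x y : Fin n} {j : ℕ} (h : A.lab (x, y) = some j) (v : Fin n) :
    (A.remove x y).deg v + (if v = y then 1 else 0) = A.deg v := by
  rw [← deg_add (remove_lab_self x y) j v, add_remove h]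

theorem num_remove {x y : Fin n} {j : ℕ} (h : A.lab (x, y) = some j) (v : Fin n) (i : ℕ) :
    (A.remove x y).num v i + (if v = y ∧ i = j then 1 else 0) = A.num v i := by
  rw [← num_add (remove_lab_self x y) j v, add_remove h]

theorem deg_le (v : Fin n) : A.deg v ≤ n := by
  refine (Finset.card_le_univ _).trans ?_
  simp

end Conf

/-- Memory representation of a configuration, for the parameters `k` and `L` and weights `w`. -/
structure Stored {n : ℕ} (k L : ℕ) (ε : ℝ) (w : Fin n → ℝ) (s : State) (A : Conf n) : Prop where
  n_eq : s.ireg 0 = n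
  k_eq : s.ireg 4 = k
  L_eq : s.ireg 5 = L
  -- There are `L + 3` keys per vertex because labels are at most `L`, but deletions also look up
  -- the label level plus 2.
  keys_eq : s.ireg 6 = L + 3
  items_eq : s.ireg 7 = n * n
  eps_eq : s.rreg 0 = ε
  weight : ∀ v : Fin n, s.rmem 0 v = w v
  thr : ∀ i ≤ L, s.rmem 1 i = theta k i
  arc : ∀ p, s.imem 0 (pairCode p) = if (A.lab p).isSome then 1 else 0
  -- Entries of the label matrix outside the arcs may be stale.
  lab : ∀ p j, A.lab p = some j → s.imem 2 (pairCode p) = j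
  ins : Bucketed (n * n) pairCode (s.imem 3) (s.imem 4) (s.imem 5) (A.inKey L)
  outs : Bucketed (n * n) pairCode (s.imem 6) (s.imem 7) (s.imem 8) (A.outKey L)
  levs : Bucketed (n * n) Fin.val (s.imem 9) (s.imem 10) (s.imem 11) fun v => some (A.lev v)
  lev : ∀ v : Fin n, s.imem 12 v = A.lev v
  deg : ∀ v : Fin n, s.imem 13 v = A.deg v
  -- Register `8` is the highest occupied level, from which queries descend.
  le_top : ∀ v, A.lev v ≤ s.ireg 8
  top : ∃ v, A.lev v = s.ireg 8

/-- Set the item register to the arc `x → y`, given in registers `13` and `14`. -/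
def loadArc : Program := .iset 10 (.add (.mul (.var 13) (.var 0)) (.var 14))

/-- Set the key register to the head (`r = 14`) or tail (`r = 13`) and the label in `15`. -/
def loadKey (r : ℕ) : Program := .iset 11 (.add (.mul (.var r) (.var 6)) (.var 15))

/-- Add the arc `x → y` with label `j`, given in registers `13`, `14`, `15`. -/
def addArc : Program :=
  .seq loadArc <| .seq (.iwrite 0 (.var 10) (.const 1)) <| .seq (.iwrite 2 (.var 10) (.var 15)) <|
  .seq (.iwrite 13 (.var 14) (.add (.read 13 (.var 14)) (.const 1))) <|
  .seq (loadKey 14) <| .seq (bucketInsert 3) <| .seq (loadKey 13) (bucketInsert 6)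

/-- Remove the arc `x → y`, given in registers `13`, `14`, and store its label in `15`. -/
def removeArc : Program :=
  .seq loadArc <| .seq (.iwrite 0 (.var 10) (.const 0)) <| .seq (.iset 15 (.read 2 (.var 10))) <|
  .seq (.iwrite 13 (.var 14) (.sub (.read 13 (.var 14)) (.const 1))) <|
  .seq (loadKey 14) <| .seq (bucketRemove 3) <| .seq (loadKey 13) (bucketRemove 6)

section

variable {n k L B : ℕ} {ε : ℝ} {w : Fin n → ℝ} {s : State} {A : Conf n}

/-- There are `n * (L + 3)` blocks of length `n * n`; thus all addresses up to the end of the last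
block are below `B`, and reduction modulo `B` has no effect on them. -/
theorem key_bound (hB : n * (L + 3) * (n * n) + k + 100 < B) (x : Fin n) {j : ℕ} (hj : j < L + 3) :
    (x * (L + 3) + j) * (n * n) + n * n < B ∧ (x : ℕ) * (L + 3) + j < B ∧
      (x : ℕ) * (L + 3) < B := by
  have h1 : (x : ℕ) * (L + 3) + j + 1 ≤ n * (L + 3) := by
    calc (x : ℕ) * (L + 3) + j + 1 ≤ x * (L + 3) + (L + 3) := by omega
      _ = (x + 1) * (L + 3) := by ring
      _ ≤ n * (L + 3) := Nat.mul_le_mul_right _ x.isLt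
  have h2 : (x * (L + 3) + j) * (n * n) + n * n ≤ n * (L + 3) * (n * n) := by
    calc _ = (x * (L + 3) + j + 1) * (n * n) := by ring
      _ ≤ _ := Nat.mul_le_mul_right _ h1
  have hn : 0 < n := x.pos
  have h3 : n * (L + 3) ≤ n * (L + 3) * (n * n) := Nat.le_mul_of_pos_right _ (by positivity)
  omega

theorem small_bound (hB : n * (L + 3) * (n * n) + k + 100 < B) : n * n + n < B := by
  rcases Nat.eq_zero_or_pos n with rfl | hn
  · omega
  · have : n * n * 1 ≤ (n * n) * (n * (L + 3)) :=
      Nat.mul_le_mul_left _ (Nat.mul_pos hn (by omega))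
    have h4 : n ≤ n * (L + 3) * (n * n) := by
      calc n = n * 1 := by ring
        _ ≤ n * ((L + 3) * (n * n)) := Nat.mul_le_mul_left _ (Nat.mul_pos (by omega) (by positivity))
        _ = _ := by ring
    have h3 : n * 3 * (n * n) ≤ n * (L + 3) * (n * n) := by gcongr; omega
    nlinarith

theorem card_pair : Fintype.card (Fin n × Fin n) ≤ n * n := by simp

theorem card_vert : Fintype.card (Fin n) ≤ n * n := by
  simp only [Fintype.card_fin]; nlinarith

theorem wp_addArc (hB : n * (L + 3) * (n * n) + k + 100 < B) (h : Stored k L ε w s A)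
    {x y : Fin n} {j : ℕ} (hxy : A.lab (x, y) = none) (hj : j < L + 3)
    (h13 : s.ireg 13 = x) (h14 : s.ireg 14 = y) (h15 : s.ireg 15 = j) :
    WP B addArc s fun t s' => t ≤ 100 ∧ Stored k L ε w s' (A.add x y j) ∧
      ∀ r, r < 10 ∨ 13 ≤ r → s'.ireg r = s.ireg r := by
  obtain ⟨hx1, hx2, hx3⟩ := key_bound hB x hj
  obtain ⟨hy1, hy2, hy3⟩ := key_bound hB y hj
  have hn := small_bound hB
  have hp := pairCode_lt (x, y)
  have hp' : (x : ℕ) * n + y = pairCode (x, y) := rfl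
  have e1 : 1 % B = 1 := Nat.mod_eq_of_lt (by omega)
  have e2 : (x * n) % B = x * n := Nat.mod_eq_of_lt (by omega)
  have e3 : pairCode (x, y) % B = pairCode (x, y) := Nat.mod_eq_of_lt (by omega)
  have hd := A.deg_le y
  have e4 : (A.deg y + 1) % B = A.deg y + 1 := Nat.mod_eq_of_lt (by omega)
  have e5 : (y * (L + 3)) % B = y * (L + 3) := Nat.mod_eq_of_lt hy3
  have e6 : (y * (L + 3) + j) % B = y * (L + 3) + j := Nat.mod_eq_of_lt hy2
  have e7 : (x * (L + 3)) % B = x * (L + 3) := Nat.mod_eq_of_lt hx3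
  have e8 : (x * (L + 3) + j) % B = x * (L + 3) + j := Nat.mod_eq_of_lt hx2
  simp only [addArc, loadArc, loadKey, wp_seq, wp_iset, wp_iwrite]
  refine (wp_bucketInsert (κ := A.inKey L) (i := (x, y)) (c := y * (L + 3) + j) (N := n * n)
    (code := pairCode) (by simpa using h.ins) pairCode_injective card_pair (by simp [Conf.inKey, hxy])
    (by simp [h.items_eq]) (by simp [h13, h14, h.n_eq, e2, e3, hp'])
    (by simp [h14, h15, h.keys_eq, e5, e6]) hy1).mono ?_
  rintro t₁ s₁ ⟨ht₁, hb₁, hi₁, hr₁, hrm₁, hm₁⟩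
  refine (wp_bucketInsert (κ := A.outKey L) (i := (x, y)) (c := x * (L + 3) + j) (N := n * n)
    (code := pairCode) (by simpa [hm₁] using h.outs) pairCode_injective card_pair
    (by simp [Conf.outKey, hxy])
    (by simp [hi₁, h.items_eq]) (by simp [hi₁, h13, h14, h.n_eq, e2, e3, hp'])
    (by simp [hi₁, h13, h15, h.keys_eq, e7, e8]) hx1).mono ?_
  rintro t₂ s₂ ⟨ht₂, hb₂, hi₂, hr₂, hrm₂, hm₂⟩
  refine ⟨by simp; omega, ⟨?_, ?_, ?_, ?_, ?_, ?_, ?_, ?_, ?_, ?_, ?_, ?_, ?_, ?_, ?_, ?_, ?_⟩, ?_⟩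
  · simp [hi₂, hi₁, h.n_eq]
  · simp [hi₂, hi₁, h.k_eq]
  · simp [hi₂, hi₁, h.L_eq]
  · simp [hi₂, hi₁, h.keys_eq]
  · simp [hi₂, hi₁, h.items_eq]
  · simp [hr₂, hr₁, h.eps_eq]
  · simp [hrm₂, hrm₁, h.weight]
  · simpa [hrm₂, hrm₁] using h.thr
  · intro p
    by_cases hpe : p = (x, y)
    · subst hpe
      simp [hm₂, hm₁, h13, h14, h.n_eq, e1, e2, e3, hp', Conf.add]
    · have : pairCode p ≠ pairCode (x, y) := fun e => hpe (pairCode_injective e)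
      simp [hm₂, hm₁, h13, h14, h.n_eq, e2, e3, hp', this, h.arc, Conf.add, hpe]
  · intro p i hi
    by_cases hpe : p = (x, y)
    · subst hpe
      simp only [Conf.add, Function.update_self, Option.some.injEq] at hi
      simp [hm₂, hm₁, h13, h14, h15, h.n_eq, e2, e3, hp', hi]
    · have : pairCode p ≠ pairCode (x, y) := fun e => hpe (pairCode_injective e)
      simp only [Conf.add, Function.update_of_ne hpe] at hi
      simp [hm₂, hm₁, h13, h14, h.n_eq, e2, e3, hp', this, h.lab _ _ hi]
  · simpa [hm₂, Conf.add_inKey] using hb₁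
  · simpa [Conf.add_outKey] using hb₂
  · simpa [hm₂, hm₁] using h.levs
  · simpa [hm₂, hm₁] using h.lev
  · intro v
    by_cases hv : v = y
    · subst hv
      simp [hm₂, hm₁, h14, h.deg, Conf.deg_add hxy, e1, e4]
    · have : (v : ℕ) ≠ y := fun e => hv (Fin.ext e)
      simp [hm₂, hm₁, h14, h.deg, Conf.deg_add hxy, hv, this]
  · simpa [hi₂, hi₁] using h.le_top
  · simpa [hi₂, hi₁] using h.top
  · intro r hr
    simp only [hi₂, setI_ireg, hi₁, writeI_ireg]
    rw [if_neg (by omega), if_neg (by omega), if_neg (by omega)]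

theorem wp_removeArc (hB : n * (L + 3) * (n * n) + k + 100 < B) (h : Stored k L ε w s A)
    {x y : Fin n} {j : ℕ} (hxy : A.lab (x, y) = some j) (hj : j < L + 3)
    (h13 : s.ireg 13 = x) (h14 : s.ireg 14 = y) :
    WP B removeArc s fun t s' => t ≤ 100 ∧ Stored k L ε w s' (A.remove x y) ∧ s'.ireg 15 = j ∧
      ∀ r, r < 10 ∨ r = 13 ∨ r = 14 ∨ 16 ≤ r → s'.ireg r = s.ireg r := by
  obtain ⟨hx1, hx2, hx3⟩ := key_bound hB x hj
  obtain ⟨hy1, hy2, hy3⟩ := key_bound hB y hj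
  have hn := small_bound hB
  have hp := pairCode_lt (x, y)
  have hp' : (x : ℕ) * n + y = pairCode (x, y) := rfl
  have h15 := h.lab _ _ hxy
  have e1 : 1 % B = 1 := Nat.mod_eq_of_lt (by omega)
  have e2 : (x * n) % B = x * n := Nat.mod_eq_of_lt (by omega)
  have e3 : pairCode (x, y) % B = pairCode (x, y) := Nat.mod_eq_of_lt (by omega)
  have e5 : (y * (L + 3)) % B = y * (L + 3) := Nat.mod_eq_of_lt hy3
  have e6 : (y * (L + 3) + j) % B = y * (L + 3) + j := Nat.mod_eq_of_lt hy2
  have e7 : (x * (L + 3)) % B = x * (L + 3) := Nat.mod_eq_of_lt hx3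
  have e8 : (x * (L + 3) + j) % B = x * (L + 3) + j := Nat.mod_eq_of_lt hx2
  simp only [removeArc, loadArc, loadKey, wp_seq, wp_iset, wp_iwrite]
  refine (wp_bucketRemove (κ := A.inKey L) (i := (x, y)) (c := y * (L + 3) + j) (N := n * n)
    (code := pairCode) (by simpa using h.ins) pairCode_injective card_pair (by simp [Conf.inKey, hxy])
    (by simp [h.items_eq]) (by simp [h13, h14, h.n_eq, e2, e3, hp'])
    (by simp [h13, h14, h.n_eq, e2, e3, hp', h15, h.keys_eq, e5, e6]) hy1).mono ?_
  rintro t₁ s₁ ⟨ht₁, hb₁, hi₁, hr₁, hrm₁, hm₁⟩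
  refine (wp_bucketRemove (κ := A.outKey L) (i := (x, y)) (c := x * (L + 3) + j) (N := n * n)
    (code := pairCode) (by simpa [hm₁] using h.outs) pairCode_injective card_pair
    (by simp [Conf.outKey, hxy])
    (by simp [hi₁, h.items_eq]) (by simp [hi₁, h13, h14, h.n_eq, e2, e3, hp'])
    (by simp [hi₁, h13, h14, h.n_eq, e2, e3, hp', h15, h.keys_eq, e7, e8]) hx1).mono ?_
  rintro t₂ s₂ ⟨ht₂, hb₂, hi₂, hr₂, hrm₂, hm₂⟩
  refine ⟨by simp; omega,
    ⟨?_, ?_, ?_, ?_, ?_, ?_, ?_, ?_, ?_, ?_, ?_, ?_, ?_, ?_, ?_, ?_, ?_⟩, ?_, ?_⟩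
  · simp [hi₂, hi₁, h.n_eq]
  · simp [hi₂, hi₁, h.k_eq]
  · simp [hi₂, hi₁, h.L_eq]
  · simp [hi₂, hi₁, h.keys_eq]
  · simp [hi₂, hi₁, h.items_eq]
  · simp [hr₂, hr₁, h.eps_eq]
  · simp [hrm₂, hrm₁, h.weight]
  · simpa [hrm₂, hrm₁] using h.thr
  · intro p
    by_cases hpe : p = (x, y)
    · subst hpe
      simp [hm₂, hm₁, h13, h14, h.n_eq, e2, e3, hp', Conf.remove]
    · have : pairCode p ≠ pairCode (x, y) := fun e => hpe (pairCode_injective e)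
      simp [hm₂, hm₁, h13, h14, h.n_eq, e2, e3, hp', this, h.arc, Conf.remove, hpe]
  · intro p i hi
    by_cases hpe : p = (x, y)
    · subst hpe
      simp [Conf.remove] at hi
    · simp only [Conf.remove, Function.update_of_ne hpe] at hi
      simp [hm₂, hm₁, h.lab _ _ hi]
  · simpa [hm₂, Conf.remove_inKey] using hb₁
  · simpa [Conf.remove_outKey] using hb₂
  · simpa [hm₂, hm₁] using h.levs
  · simpa [hm₂, hm₁] using h.lev
  · intro v
    have hd := Conf.deg_remove hxy v
    by_cases hv : v = y
    · subst hv
      simp only [if_true] at hd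
      simp [hm₂, hm₁, h14, h.deg, e1, ← hd]
    · have : (v : ℕ) ≠ y := fun e => hv (Fin.ext e)
      simp only [hv, if_false] at hd
      simp [hm₂, hm₁, h14, h.deg, this, ← hd]
  · simpa [hi₂, hi₁] using h.le_top
  · simpa [hi₂, hi₁] using h.top
  · simp [hi₂, hi₁, h13, h14, h.n_eq, e2, e3, hp', h15]
  · intro r hr
    rw [hi₂ _ (by omega), setI_ireg, if_neg (by omega), hi₁ _ (by omega)]
    simp only [setI_ireg, writeI_ireg]
    rw [if_neg (by omega), if_neg (by omega), if_neg (by omega)]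

/-- Increase the level of the vertex in register `17`. -/
def raiseLevel : Program :=
  .seq (.iset 10 (.var 17)) <| .seq (.iset 11 (.read 12 (.var 17))) <| .seq (bucketRemove 9) <|
  .seq (.iset 11 (.add (.var 11) (.const 1))) <| .seq (.iwrite 12 (.var 17) (.var 11)) <|
  .seq (bucketInsert 9) <| .branch (.ilt (.var 8) (.var 11)) (.iset 8 (.var 11)) .skip

/-- Decrease the level of the vertex in register `17`. -/
def lowerLevel : Program :=
  .seq (.iset 10 (.var 17)) <| .seq (.iset 11 (.read 12 (.var 17))) <| .seq (bucketRemove 9) <|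
  .seq (.branch (.and (.ieq (.var 8) (.var 11)) (.ieq (.read 9 (.var 11)) (.const 0)))
    (.iset 8 (.sub (.var 8) (.const 1))) .skip) <|
  .seq (.iset 11 (.sub (.var 11) (.const 1))) <| .seq (.iwrite 12 (.var 17) (.var 11)) <|
  bucketInsert 9

theorem lev_bound (hB : n * (L + 3) * (n * n) + k + 100 < B) (y : Fin n) {j : ℕ}
    (hj : j < L + 3) : j * (n * n) + n * n < B ∧ j < B := by
  have hn : 0 < n := y.pos
  obtain ⟨h1, h2, -⟩ := key_bound hB (⟨0, hn⟩ : Fin n) hj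
  simpa using And.intro h1 h2

theorem update_levKey (y : Fin n) (c : ℕ) :
    Function.update (Function.update (fun v => some (A.lev v)) y none) y (some c) =
      fun v => some ((A.setLev y c).lev v) := by
  ext1 v
  by_cases h : v = y
  · subst h; simp
  · simp [h]

theorem wp_raiseLevel (hB : n * (L + 3) * (n * n) + k + 100 < B) (h : Stored k L ε w s A)
    {y : Fin n} (hL : A.lev y < L) (h17 : s.ireg 17 = y) :
    WP B raiseLevel s fun t s' => t ≤ 100 ∧ Stored k L ε w s' (A.setLev y (A.lev y + 1)) ∧
      ∀ r, r < 8 ∨ 13 ≤ r → s'.ireg r = s.ireg r := by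
  obtain ⟨hb1, hb2⟩ := lev_bound hB y (j := A.lev y) (by omega)
  obtain ⟨hb3, hb4⟩ := lev_bound hB y (j := A.lev y + 1) (by omega)
  have e1 : 1 % B = 1 := Nat.mod_eq_of_lt (by omega)
  have e2 : (A.lev y + 1) % B = A.lev y + 1 := Nat.mod_eq_of_lt (by omega)
  simp only [raiseLevel, wp_seq, wp_iset, wp_iwrite]
  refine (wp_bucketRemove (κ := fun v => some (A.lev v)) (i := y) (c := A.lev y) (N := n * n)
    (code := Fin.val) (by simpa using h.levs) Fin.val_injective card_vert rfl
    (by simp [h.items_eq]) (by simp [h17]) (by simp [h17, h.lev]) hb1).mono ?_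
  rintro t₁ s₁ ⟨ht₁, hb₁, hi₁, hr₁, hrm₁, hm₁⟩
  refine (wp_bucketInsert (κ := Function.update (fun v => some (A.lev v)) y none) (i := y)
    (c := A.lev y + 1) (N := n * n)
    (code := Fin.val) (by simpa using hb₁) Fin.val_injective card_vert (by simp)
    (by simp [hi₁, h.items_eq]) (by simp [hi₁, h17])
    (by simp [hi₁, h17, h.lev, e1, e2]) hb3).mono ?_
  rintro t₂ s₂ ⟨ht₂, hb₂, hi₂, hr₂, hrm₂, hm₂⟩
  rw [update_levKey] at hb₂
  have h8 : s₂.ireg 8 = s.ireg 8 := by simp [hi₂, hi₁]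
  have h11 : s₂.ireg 11 = A.lev y + 1 := by simp [hi₂, hi₁, h17, h.lev, e1, e2]
  have key : ∀ s₃ : State, s₃.imem = s₂.imem → s₃.rmem = s₂.rmem → s₃.rreg = s₂.rreg →
      (∀ r, r ≠ 8 → s₃.ireg r = s₂.ireg r) → (∀ v, (A.setLev y (A.lev y + 1)).lev v ≤ s₃.ireg 8) →
      (∃ v, (A.setLev y (A.lev y + 1)).lev v = s₃.ireg 8) →
      Stored k L ε w s₃ (A.setLev y (A.lev y + 1)) ∧
      ∀ r, r < 8 ∨ 13 ≤ r → s₃.ireg r = s.ireg r := by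
    intro s₃ g1 g2 g3 g4 g5 g6
    refine ⟨⟨?_, ?_, ?_, ?_, ?_, ?_, ?_, ?_, ?_, ?_, ?_, ?_, ?_, ?_, ?_, g5, g6⟩, ?_⟩
    · simp [g4, hi₂, hi₁, h.n_eq]
    · simp [g4, hi₂, hi₁, h.k_eq]
    · simp [g4, hi₂, hi₁, h.L_eq]
    · simp [g4, hi₂, hi₁, h.keys_eq]
    · simp [g4, hi₂, hi₁, h.items_eq]
    · simp [g3, hr₂, hr₁, h.eps_eq]
    · simp [g2, hrm₂, hrm₁, h.weight]
    · simpa [g2, hrm₂, hrm₁] using h.thr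
    · exact fun p => Eq.trans (by simp [g1, hm₂, hm₁]) (h.arc p)
    · simpa [g1, hm₂, hm₁] using h.lab
    · simpa [g1, hm₂, hm₁] using h.ins
    · simpa [g1, hm₂, hm₁] using h.outs
    · simpa [g1] using hb₂
    · intro v
      by_cases hv : v = y
      · subst hv
        simp [g1, hm₂, hm₁, hi₁, h17, h.lev, e1, e2]
      · have : (v : ℕ) ≠ y := fun e => hv (Fin.ext e)
        simp [g1, hm₂, hm₁, hi₁, h17, h.lev, this, hv]
    · simpa [g1, hm₂, hm₁] using h.deg
    · intro r hr
      rw [g4 _ (by omega), hi₂, writeI_ireg, setI_ireg, if_neg (by omega), hi₁ _ (by omega)]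
      simp only [setI_ireg]
      rw [if_neg (by omega), if_neg (by omega)]
  rw [wp_branch]
  simp only [Test.Holds, IExp.eval, h8, h11, wp_iset, wp_skip]
  -- The maximum changes only if `y` rises above it, and then `y` attains the new one. Otherwise a
  -- vertex attaining it differs from `y`.
  by_cases hlt : s.ireg 8 < A.lev y + 1
  · refine Or.inl ⟨hlt, by simp; omega, key _ rfl rfl rfl (by simp +contextual) ?_ ⟨y, by simp⟩⟩
    intro v
    by_cases hv : v = y
    · subst hv; simp
    · have := h.le_top v
      simp [hv]; omega
  · refine Or.inr ⟨hlt, by simp; omega, key _ rfl rfl rfl (by simp) ?_ ?_⟩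
    · intro v
      by_cases hv : v = y
      · subst hv; simp [h8]; omega
      · simp [hv, h8, h.le_top v]
    · obtain ⟨v, hv⟩ := h.top
      have : v ≠ y := by rintro rfl; omega
      exact ⟨v, by simp [this, h8, hv]⟩

/-- If `y` was the only vertex of the highest occupied level, it also attains the new maximum, one
level lower; so a single decrement of register `8` suffices and no search for an occupied level is
needed. -/
theorem wp_lowerLevel (hB : n * (L + 3) * (n * n) + k + 100 < B) (h : Stored k L ε w s A)
    {y : Fin n} (hL : A.lev y ≤ L) (h0 : 0 < A.lev y) (h17 : s.ireg 17 = y) :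
    WP B lowerLevel s fun t s' => t ≤ 100 ∧ Stored k L ε w s' (A.setLev y (A.lev y - 1)) ∧
      ∀ r, r < 8 ∨ 13 ≤ r → s'.ireg r = s.ireg r := by
  obtain ⟨hb1, hb2⟩ := lev_bound hB y (j := A.lev y) (by omega)
  obtain ⟨hb3, hb4⟩ := lev_bound hB y (j := A.lev y - 1) (by omega)
  have e1 : 1 % B = 1 := Nat.mod_eq_of_lt (by omega)
  simp only [lowerLevel, wp_seq, wp_iset, wp_iwrite]
  refine (wp_bucketRemove (κ := fun v => some (A.lev v)) (i := y) (c := A.lev y) (N := n * n)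
    (code := Fin.val) (by simpa using h.levs) Fin.val_injective card_vert rfl
    (by simp [h.items_eq]) (by simp [h17]) (by simp [h17, h.lev]) hb1).mono ?_
  rintro t₁ s₁ ⟨ht₁, hb₁, hi₁, hr₁, hrm₁, hm₁⟩
  have h8 : s₁.ireg 8 = s.ireg 8 := by simp [hi₁]
  have h11 : s₁.ireg 11 = A.lev y := by simp [hi₁, h17, h.lev]
  have key : ∀ s₂ : State, s₂.imem = s₁.imem → s₂.rmem = s₁.rmem → s₂.rreg = s₁.rreg →
      (∀ r, r ≠ 8 → s₂.ireg r = s₁.ireg r) → (∀ v, (A.setLev y (A.lev y - 1)).lev v ≤ s₂.ireg 8) →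
      (∃ v, (A.setLev y (A.lev y - 1)).lev v = s₂.ireg 8) →
      WP B (bucketInsert 9) ((s₂.setI 11 (s₂.ireg 11 - 1 % B)).writeI 12
        ((s₂.setI 11 (s₂.ireg 11 - 1 % B)).ireg 17)
        ((s₂.setI 11 (s₂.ireg 11 - 1 % B)).ireg 11)) fun t s' =>
      t ≤ 19 ∧ Stored k L ε w s' (A.setLev y (A.lev y - 1)) ∧
      ∀ r, r < 8 ∨ 13 ≤ r → s'.ireg r = s.ireg r := by
    intro s₂ g1 g2 g3 g4 g5 g6
    refine (wp_bucketInsert (κ := Function.update (fun v => some (A.lev v)) y none) (i := y)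
      (c := A.lev y - 1) (N := n * n)
      (code := Fin.val) (by simpa [g1] using hb₁) Fin.val_injective card_vert (by simp)
      (by simp [g4, hi₁, h.items_eq]) (by simp [g4, hi₁, h17])
      (by simp [g4, h11, e1]) hb3).mono ?_
    rintro t₃ s₃ ⟨ht₃, hb₃, hi₃, hr₃, hrm₃, hm₃⟩
    rw [update_levKey] at hb₃
    refine ⟨ht₃, ⟨?_, ?_, ?_, ?_, ?_, ?_, ?_, ?_, ?_, ?_, ?_, ?_, ?_, ?_, ?_, ?_, ?_⟩, ?_⟩
    · simp [hi₃, g4, hi₁, h.n_eq]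
    · simp [hi₃, g4, hi₁, h.k_eq]
    · simp [hi₃, g4, hi₁, h.L_eq]
    · simp [hi₃, g4, hi₁, h.keys_eq]
    · simp [hi₃, g4, hi₁, h.items_eq]
    · simp [hr₃, g3, hr₁, h.eps_eq]
    · simp [hrm₃, g2, hrm₁, h.weight]
    · simpa [hrm₃, g2, hrm₁] using h.thr
    · exact fun p => Eq.trans (by simp [hm₃, g1, hm₁]) (h.arc p)
    · simpa [hm₃, g1, hm₁] using h.lab
    · simpa [hm₃, g1, hm₁] using h.ins
    · simpa [hm₃, g1, hm₁] using h.outs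
    · exact hb₃
    · intro v
      by_cases hv : v = y
      · subst hv
        simp [hm₃, g1, g4, hm₁, hi₁, h17, h.lev, e1]
      · have : (v : ℕ) ≠ y := fun e => hv (Fin.ext e)
        simp [hm₃, g1, g4, hm₁, hi₁, h17, h.lev, this, hv]
    · simpa [hm₃, g1, hm₁] using h.deg
    · simpa [hi₃] using g5
    · simpa [hi₃] using g6
    · intro r hr
      rw [hi₃, writeI_ireg, setI_ireg, if_neg (by omega), g4 _ (by omega), hi₁ _ (by omega)]
      simp only [setI_ireg]
      rw [if_neg (by omega), if_neg (by omega)]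
  rw [wp_branch]
  simp only [Test.Holds, IExp.eval, wp_iset, wp_skip, Nat.zero_mod]
  by_cases hlt' : s₁.ireg 8 = s₁.ireg 11 ∧ s₁.imem 9 (s₁.ireg 11) = 0 <;> have hlt := hlt' <;>
    rw [h8, h11] at hlt
  · refine Or.inl ⟨hlt', (key (s₁.setI 8 (s₁.ireg 8 - 1 % B)) rfl rfl rfl (by simp +contextual) ?_ ?_).mono ?_⟩
    · intro v
      by_cases hv : v = y
      · subst hv; simp [h8, hlt.1, e1]
      · have h1 := h.le_top v
        have h2 : A.lev v ≠ A.lev y := by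
          intro e
          have := (hb₁.mem v (A.lev y) (by simp [hv, e])).1
          omega
        simp [hv, e1, h8]; omega
    · exact ⟨y, by simp [h8, hlt.1, e1]⟩
    · rintro t s' ⟨ht, hs⟩
      exact ⟨by simp; omega, hs⟩
  · refine Or.inr ⟨hlt', (key s₁ rfl rfl rfl (by simp) ?_ ?_).mono ?_⟩
    · intro v
      by_cases hv : v = y
      · subst hv
        have := h.le_top v
        simp [h8]; omega
      · simp [hv, h8, h.le_top v]
    · by_cases h' : s.ireg 8 = A.lev y
      · obtain ⟨v, hv, -⟩ := hb₁.get (A.lev y) 0 (by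
          simp only [h', true_and] at hlt; simp only [Nat.reduceAdd] at *; omega)
        have hvy : v ≠ y := by rintro rfl; simp at hv
        simp only [ne_eq, hvy, not_false_eq_true, Function.update_of_ne, Option.some.injEq] at hv
        exact ⟨v, by simp [hvy, h8, h', hv]⟩
      · obtain ⟨v, hv⟩ := h.top
        have : v ≠ y := by rintro rfl; omega
        exact ⟨v, by simp [this, h8, hv]⟩
    · rintro t s' ⟨ht, hs⟩
      exact ⟨by simp; omega, hs⟩

end
end VWDSG
-- Thresholds, degree bands, and the invariants of insertion and deletion.
namespace VWDSG

open RealRAM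

section Theta

variable {k : ℕ}

theorem theta_succ (k i : ℕ) : theta k (i + 1) = theta k i * (1 + 2 / k) + 2 := rfl

theorem theta_nonneg (k i : ℕ) : 0 ≤ theta k i := by
  induction i with
  | zero => exact le_rfl
  | succ i ih => rw [theta_succ]; positivity

/-- The bounds on the in-degree of a vertex of weight `w` and level `f` with `lo` arcs labelled `f`
and `hi` arcs labelled `f + 1`; `a` and `b` are the slacks in the two bounds. -/
structure Band (k L : ℕ) (w : ℝ) (f : ℕ) (lo hi : ℕ) (a b : ℝ) : Prop where
  -- Each unit of room below the next threshold accounts for `k - 1` arcs still labelled `f`. An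
  -- insertion uses one unit and adds one such arc, a loss of `k` that is made good by `k`
  -- relabellings.
  up : f < L → w * theta k f ≤ lo + hi → lo + a ≤ (k - 1) * (w * theta k (f + 1) - (lo + hi))
  -- Each unit of degree above the previous threshold accounts for `k` arcs still labelled `f + 1`.
  -- A deletion loses one unit, made good by `k` relabellings.
  down : 1 ≤ f → (lo + hi : ℝ) < w * theta k f →
    (hi : ℝ) ≤ k * (lo + hi - w * theta k (f - 1)) + b

/-- Upward relabelling can start close to `w * theta k f` with all arcs still to be moved: `(k - 1)
* w * theta k (f + 1)` is at least `k * w * theta k f + 2 * (k - 1)`, and `2 * (k - 1) ≥ k`. The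
parameter `a = 1` yields the slack `k` needed after a rise. -/
theorem near_up {w d a : ℝ} (hk : 2 ≤ k) (hw : 1 ≤ w) (f : ℕ)
    (h : d + a ≤ w * theta k f + 1) :
    d + k * a ≤ (k - 1) * (w * theta k (f + 1) - d) := by
  have hk' : (2 : ℝ) ≤ k := by exact_mod_cast hk
  have hθ := theta_nonneg k f
  have hwθ : 0 ≤ w * theta k f := by positivity
  set X := w * theta k f with hX
  have e : w * theta k (f + 1) = X + X * (2 / k) + 2 * w := by rw [theta_succ, hX]; ring
  rw [e]
  have e2 : (k - 1 : ℝ) * (X * (2 / k)) = X + X * ((k - 2) / k) := by field_simp; ring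
  have e3 : 0 ≤ X * ((k - 2) / k : ℝ) := mul_nonneg hwθ (div_nonneg (by linarith) (by linarith))
  nlinarith

/-- Downward counterpart of `near_up`: with `X = w * theta k f`, a degree within 1 of the next
threshold has `k * (d - X) ≥ 2 * X + k * (2 * w - 1)`, while `d ≤ 2 * X + 2 * w`. -/
theorem near_down {w d : ℝ} (hk : 2 ≤ k) (hw : 1 ≤ w) (f : ℕ)
    (h : w * theta k (f + 1) - 1 ≤ d) (h' : d ≤ w * theta k (f + 1)) :
    d ≤ k * (d - w * theta k f) := by
  have hk' : (2 : ℝ) ≤ k := by exact_mod_cast hk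
  have hθ := theta_nonneg k f
  have hwθ : 0 ≤ w * theta k f := by positivity
  set X := w * theta k f with hX
  have e : w * theta k (f + 1) = X + X * (2 / k) + 2 * w := by rw [theta_succ, hX]; ring
  rw [e] at h h'
  have e2 : (k : ℝ) * (X * (2 / k)) = 2 * X := by field_simp
  have e3 : X * (2 / k) ≤ X := by
    have : (2 / k : ℝ) ≤ 1 := by rw [div_le_one (by linarith)]; exact hk'
    nlinarith
  nlinarith

end Theta

namespace Conf

variable {n : ℕ}

/-- The number of arcs into `v` labelled with the level of `v`. -/
def lo (A : Conf n) (v : Fin n) : ℕ := A.num v (A.lev v)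

/-- The number of arcs into `v` labelled with the successor of the level of `v`. -/
def hi (A : Conf n) (v : Fin n) : ℕ := A.num v (A.lev v + 1)

/-- The potential: the sum of `L - j` over all arcs, where `j` is the label. -/
def phi (A : Conf n) (L : ℕ) : ℕ := ∑ p, ((A.lab p).map (L - ·)).getD 0

variable {A : Conf n} {x y z : Fin n} {j i : ℕ}

theorem phi_add (L : ℕ) (h : A.lab (x, y) = none) :
    (A.add x y j).phi L = A.phi L + (L - j) := by
  unfold phi
  rw [← Finset.add_sum_erase _ _ (Finset.mem_univ (x, y)),
    ← Finset.add_sum_erase (a := (x, y)) Finset.univ _ (Finset.mem_univ _)]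
  have : ∑ p ∈ Finset.univ.erase (x, y), (((A.add x y j).lab p).map (L - ·)).getD 0 =
      ∑ p ∈ Finset.univ.erase (x, y), ((A.lab p).map (L - ·)).getD 0 := by
    refine Finset.sum_congr rfl fun p hp => ?_
    simp [add, Finset.ne_of_mem_erase hp]
  rw [this]
  simp [add, h]
  omega

theorem phi_remove (L : ℕ) (h : A.lab (x, y) = some j) :
    (A.remove x y).phi L + (L - j) = A.phi L := by
  rw [← phi_add (j := j) L (remove_lab_self x y), add_remove h]

@[simp] theorem phi_setLev (L : ℕ) : (A.setLev y j).phi L = A.phi L := rfl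

theorem add_lab (p : Fin n × Fin n) :
    (A.add x y j).lab p = if p = (x, y) then some j else A.lab p := by
  simp [add, Function.update_apply]

theorem remove_lab (p : Fin n × Fin n) :
    (A.remove x y).lab p = if p = (x, y) then none else A.lab p := by
  simp [remove, Function.update_apply]

/-- The configuration stores an orientation of `G`. -/
structure Orients (G : SimpleGraph (Fin n)) (A : Conf n) : Prop where
  asymm : ∀ u v, (A.lab (u, v)).isSome → A.lab (v, u) = none
  adj : ∀ u v, G.Adj u v ↔ (A.lab (u, v)).isSome ∨ (A.lab (v, u)).isSome

/-- Levels and labels are consistent and in range, and no arc leads to a vertex whose level is much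
larger. -/
structure Fair (L : ℕ) (A : Conf n) : Prop where
  lab_lev : ∀ u v j, A.lab (u, v) = some j → j = A.lev v ∨ j = A.lev v + 1
  fair : ∀ u v j, A.lab (u, v) = some j → j ≤ A.lev u + 2
  lab_le : ∀ u v j, A.lab (u, v) = some j → j ≤ L
  lev_le : ∀ v, A.lev v ≤ L

theorem Fair.deg_eq {L : ℕ} (h : Fair L A) (v : Fin n) : A.deg v = A.lo v + A.hi v := by
  unfold deg lo hi num
  rw [← Finset.card_union_of_disjoint]
  · congr 1
    ext u
    simp only [Finset.mem_filter, Finset.mem_univ, true_and, Finset.mem_union,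
      Option.isSome_iff_exists]
    constructor
    · rintro ⟨j, hj⟩
      rcases h.lab_lev _ _ _ hj with rfl | rfl
      · exact .inl hj
      · exact .inr hj
    · rintro (h | h)
      · exact ⟨_, h⟩
      · exact ⟨_, h⟩
  · rw [Finset.disjoint_left]
    intro u hu hu'
    simp only [Finset.mem_filter, Finset.mem_univ, true_and] at hu hu'
    simp [hu] at hu'

theorem num_relabel (h : A.lab (z, y) = some j) (v : Fin n) (l : ℕ) :
    ((A.remove z y).add z y i).num v l + (if v = y ∧ l = j then 1 else 0) =
      A.num v l + if v = y ∧ l = i then 1 else 0 := by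
  rw [num_add (remove_lab_self z y), ← num_remove h]
  omega

/-- Exchanging the tail of an arc, with the same head and label, preserves all counts and hence all
bands. -/
theorem num_flip (h : A.lab (z, y) = some j) (hx : A.lab (x, y) = none) (v : Fin n) (l : ℕ) :
    ((A.remove z y).add x y j).num v l = A.num v l := by
  rw [num_add, ← num_remove h]
  simp [remove_lab, hx]

theorem lo_pos_of_num {A : Conf n} {v : Fin n} (h : ∀ u, A.lab (u, v) ≠ some j) :
    A.num v j = 0 := by
  simp [num, h]

end Conf

open Conf

variable {n : ℕ} (G : SimpleGraph (Fin n)) (k L : ℕ) (w : Fin n → ℝ)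

/-- Invariant of the data structure between two operations. -/
structure Valid (A : Conf n) : Prop where
  orients : A.Orients G
  fair : A.Fair L
  band : ∀ v, Band k L (w v) (A.lev v) (A.lo v) (A.hi v) 0 0

/-- Invariant while an arc `x → y` is to be added and `c` arcs into `y` were relabelled. -/
structure InsReady (A : Conf n) (x y : Fin n) (c : ℕ) : Prop where
  ne : x ≠ y
  lab_none : A.lab (x, y) = none
  -- `G` already contains the edge `xy`; the label `0` is a dummy.
  orients : (A.add x y 0).Orients G
  fair : A.Fair L
  -- This stronger bound is needed for raising `y`, which happens only if `c < k` and sets `c` to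
  -- `k`. Afterwards the next line suffices for the label of the arc to be added.
  lev_le : c < k → A.lev y ≤ A.lev x
  lev_le' : A.lev y ≤ A.lev x + 2
  band : ∀ v, v ≠ y → Band k L (w v) (A.lev v) (A.lo v) (A.hi v) 0 0
  band' : Band k L (w y) (A.lev y) (A.lo y) (A.hi y) c 0

/-- Invariant while an arc with label `j` into `y` is missing. -/
structure DelReady (A : Conf n) (y : Fin n) (j : ℕ) : Prop where
  orients : A.Orients G
  fair : A.Fair L
  label : j = A.lev y ∨ j = A.lev y + 1
  label_le : j ≤ L
  band : ∀ v, v ≠ y → Band k L (w v) (A.lev v) (A.lo v) (A.hi v) 0 0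
  -- The missing arc is counted as if it were still present.
  band' : Band k L (w y) (A.lev y) (A.lo y + if A.lev y = j then 1 else 0)
    (A.hi y + if A.lev y + 1 = j then 1 else 0) 0 0

/-- Invariant while the labels of arcs into `y` are decreased. -/
structure DownReady (A : Conf n) (y : Fin n) (c : ℕ) : Prop where
  orients : A.Orients G
  fair : A.Fair L
  -- Allows `y` to fall by one level without violating the bound on the labels of its out-arcs.
  out : c < k → ∀ z j, A.lab (y, z) = some j → j ≤ A.lev y + 1
  band : ∀ v, v ≠ y → Band k L (w v) (A.lev v) (A.lo v) (A.hi v) 0 0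
  -- The loss of one unit of degree creates the deficit `k`; every relabelling reduces it by 1.
  band' : Band k L (w y) (A.lev y) (A.lo y) (A.hi y) 0 (k - c)

variable {G k L w} {A : Conf n} {x y z : Fin n} {c j : ℕ}

theorem Band.mono {w : ℝ} {f lo hi : ℕ} {a b a' b' : ℝ} (h : Band k L w f lo hi a b) (ha : a' ≤ a)
    (hb : b ≤ b') : Band k L w f lo hi a' b' :=
  ⟨fun h1 h2 => by linarith [h.up h1 h2], fun h1 h2 => by linarith [h.down h1 h2]⟩

theorem InsReady.lab_none' (h : InsReady G k L w A x y c) : A.lab (y, x) = none := by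
  have := h.orients.asymm x y (by simp [add_lab])
  simpa [add_lab, h.ne, h.ne.symm] using this

/-- The degree does not change and one arc less is labelled with the level, so `lo + c` is constant.
The lower half of the band is vacuous since the degree is at least the threshold. The new label is
admissible because `lev y + 1 ≤ lev z + 2`. -/
theorem InsReady.relabel (h : InsReady G k L w A x y c) (hc : c < k) (hL : A.lev y < L)
    (hd : w y * theta k (A.lev y) ≤ A.deg y) (hz : A.lab (z, y) = some (A.lev y))
    (hzy : A.lev y < A.lev z + 2) :
    InsReady G k L w ((A.remove z y).add z y (A.lev y + 1)) x y (c + 1) := by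
  have hzx : z ≠ x := by rintro rfl; simp [h.lab_none] at hz
  have hpz : (x, y) ≠ (z, y) := by simp [hzx.symm]
  have hlo : ∀ v, ((A.remove z y).add z y (A.lev y + 1)).lo v + (if v = y then 1 else 0) =
      A.lo v := by
    intro v
    have := num_relabel (i := A.lev y + 1) hz v (A.lev v)
    simp only [lo, add_lev, remove_lev]
    by_cases hv : v = y
    · subst hv; simpa using this
    · simpa [hv] using this
  have hhi : ∀ v, ((A.remove z y).add z y (A.lev y + 1)).hi v =
      A.hi v + (if v = y then 1 else 0) := by
    intro v
    have := num_relabel (i := A.lev y + 1) hz v (A.lev v + 1)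
    simp only [hi, add_lev, remove_lev]
    by_cases hv : v = y
    · subst hv; simpa using this
    · simpa [hv] using this
  have hsome : ∀ p, (((A.remove z y).add z y (A.lev y + 1)).lab p).isSome = (A.lab p).isSome := by
    intro p
    simp only [add_lab, remove_lab]
    split_ifs with e
    · simp [e, hz]
    · rfl
  have hlab : ∀ u v i, ((A.remove z y).add z y (A.lev y + 1)).lab (u, v) = some i →
      (u = z ∧ v = y ∧ i = A.lev y + 1) ∨ A.lab (u, v) = some i := by
    intro u v i hi
    simp only [add_lab, remove_lab] at hi
    split_ifs at hi with e
    · simp only [Prod.mk.injEq] at e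
      simp only [Option.some.injEq] at hi
      exact .inl ⟨e.1, e.2, hi.symm⟩
    · exact .inr hi
  refine ⟨h.ne, ?_, ⟨?_, ?_⟩, ⟨?_, ?_, ?_, h.fair.lev_le⟩, fun hc => h.lev_le (by omega), h.lev_le',
    ?_, ?_⟩
  · simp [add_lab, remove_lab, hzx.symm, h.lab_none]
  · intro u v huv
    have := h.orients.asymm u v
    simp only [← Option.not_isSome_iff_eq_none] at this ⊢
    simp only [add_lab (x := x), apply_ite Option.isSome] at this huv ⊢
    simp only [hsome] at huv ⊢
    exact this huv
  · intro u v
    rw [h.orients.adj]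
    simp only [add_lab (x := x), apply_ite Option.isSome, hsome]
  · intro u v i hi
    rcases hlab u v i hi with ⟨rfl, rfl, rfl⟩ | hi
    · exact .inr rfl
    · exact h.fair.lab_lev _ _ _ hi
  · intro u v i hi
    rcases hlab u v i hi with ⟨rfl, rfl, rfl⟩ | hi
    · simp only [add_lev, remove_lev]; omega
    · exact h.fair.fair _ _ _ hi
  · intro u v i hi
    rcases hlab u v i hi with ⟨rfl, rfl, rfl⟩ | hi
    · exact hL
    · exact h.fair.lab_le _ _ _ hi
  · intro v hv
    have h1 := hlo v
    have h2 := hhi v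
    simp only [hv, if_false, add_zero] at h1 h2
    rw [h1, h2]
    exact h.band v hv
  · have h1 := hlo y
    have h2 := hhi y
    simp only [if_true] at h1 h2
    have h1' : (((A.remove z y).add z y (A.lev y + 1)).lo y : ℝ) + 1 = A.lo y := by exact_mod_cast h1
    have h2' : (((A.remove z y).add z y (A.lev y + 1)).hi y : ℝ) = A.hi y + 1 := by exact_mod_cast h2
    have h3 : (A.deg y : ℝ) = A.lo y + A.hi y := by exact_mod_cast h.fair.deg_eq y
    constructor
    · intro g1 g2
      have := h.band'.up g1 (by linarith)
      simp only [add_lev, remove_lev] at *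
      push_cast
      rw [h2']
      have e : (((A.remove z y).add z y (A.lev y + 1)).lo y : ℝ) = A.lo y - 1 := by linarith
      rw [e]
      ring_nf at this ⊢
      linarith
    · intro g1 g2
      simp only [add_lev, remove_lev] at *
      linarith

theorem Fair.no_hi_of (h : A.Fair L) (h0 : A.lo y = 0) (hzy : A.lab (z, y) = some j) :
    j = A.lev y + 1 := by
  rcases h.lab_lev _ _ _ hzy with rfl | e
  · exfalso
    have : z ∈ (Finset.univ.filter fun u => A.lab (u, y) = some (A.lev y)) := by simp [hzy]
    rw [lo, num, Finset.card_eq_zero] at h0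
    simp [h0] at this
  · exact e

theorem Fair.no_lo_of (h : A.Fair L) (h0 : A.hi y = 0) (hzy : A.lab (z, y) = some j) :
    j = A.lev y := by
  rcases h.lab_lev _ _ _ hzy with e | rfl
  · exact e
  · exfalso
    have : z ∈ (Finset.univ.filter fun u => A.lab (u, y) = some (A.lev y + 1)) := by simp [hzy]
    rw [hi, num, Finset.card_eq_zero] at h0
    simp [h0] at this

theorem setLev_lo_of_ne (A : Conf n) {v : Fin n} (i : ℕ) (hv : v ≠ y) :
    (A.setLev y i).lo v = A.lo v := by
  simp [lo, hv]

theorem setLev_hi_of_ne (A : Conf n) {v : Fin n} (i : ℕ) (hv : v ≠ y) :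
    (A.setLev y i).hi v = A.hi v := by
  simp [hi, hv]

/-- With no arc left at the old level, all labels already equal the new level and nothing has to be
moved. The upper half of the band starts afresh by `near_up`; in the lower half no arc is left to be
moved down. -/
theorem InsReady.raise (h : InsReady G k L w A x y c) (hk : 2 ≤ k) (hw : ∀ v, 1 ≤ w v)
    (hc : c < k) (hL : A.lev y < L)
    (hd : w y * theta k (A.lev y) ≤ A.deg y) (h0 : A.lo y = 0) :
    InsReady G k L w (A.setLev y (A.lev y + 1)) x y k := by
  have hne := h.ne
  have h3 : (A.deg y : ℝ) = A.lo y + A.hi y := by exact_mod_cast h.fair.deg_eq y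
  have hlo : (A.setLev y (A.lev y + 1)).lo y = A.hi y := by simp [lo, hi]
  have hhi : (A.setLev y (A.lev y + 1)).hi y = 0 := by
    simp only [hi, setLev_num, setLev_lev, Function.update_self]
    refine lo_pos_of_num fun u hu => ?_
    rcases h.fair.lab_lev _ _ _ hu with e | e <;> omega
  refine ⟨hne, h.lab_none, ⟨h.orients.asymm, h.orients.adj⟩, ⟨?_, ?_, h.fair.lab_le, ?_⟩,
    fun h => absurd h (lt_irrefl _), ?_, ?_, ?_⟩
  · intro u v i hi
    by_cases hv : v = y
    · subst hv
      simp [Fair.no_hi_of h.fair h0 hi]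
    · simpa [hv] using h.fair.lab_lev _ _ _ hi
  · intro u v i hi
    have := h.fair.fair u v i hi
    by_cases hu : u = y
    · subst hu; simp; omega
    · simpa [hu] using this
  · intro v
    by_cases hv : v = y
    · subst hv; simp; omega
    · simpa [hv] using h.fair.lev_le v
  · have := h.lev_le hc
    simp [hne]; omega
  · intro v hv
    rw [setLev_lo_of_ne A _ hv, setLev_hi_of_ne A _ hv]
    simpa [hv] using h.band v hv
  · have hup := h.band'.up hL (by linarith)
    rw [hlo, hhi]
    simp only [setLev_lev, Function.update_self]
    have hk' : (2 : ℝ) ≤ k := by exact_mod_cast hk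
    -- With `lo = 0` the band at the old level says that the room below the next threshold is
    -- nonnegative.
    have hd' : (A.hi y : ℝ) ≤ w y * theta k (A.lev y + 1) := by
      rw [h0] at hup
      by_contra hcon
      push Not at hcon
      have : (k - 1 : ℝ) * (w y * theta k (A.lev y + 1) - ((0 : ℕ) + A.hi y)) < 0 :=
        mul_neg_of_pos_of_neg (by linarith) (by push_cast; linarith)
      have hc0 : (0 : ℝ) ≤ c := by positivity
      push_cast at hup this
      linarith
    constructor
    · intro g1 g2
      have := near_up (a := 1) hk (hw y) (A.lev y + 1) (d := A.hi y) (by linarith)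
      push_cast
      linarith
    · intro g1 g2
      push_cast
      have : (0 : ℝ) ≤ A.hi y - w y * theta k (A.lev y) := by
        rw [h0] at h3; push_cast at h3; linarith
      have := mul_nonneg (by linarith : (0 : ℝ) ≤ k) this
      linarith

/-- The arc `x → y` takes over the place and the label of `z → y`, so `y` keeps its counts and its
band. It remains to add `y → z`, and `z` lies at least two levels below `y`. -/
theorem InsReady.flip (h : InsReady G k L w A x y c)
    (hz : A.lab (z, y) = some (A.lev y))
    (hzy : A.lev z + 2 ≤ A.lev y) :
    InsReady G k L w ((A.remove z y).add x y (A.lev y)) y z 0 := by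
  have hzx : z ≠ x := by rintro rfl; simp [h.lab_none] at hz
  have hne := h.ne
  have hyx := h.lab_none'
  have hxy := h.lab_none
  have hzy' : z ≠ y := by rintro rfl; omega
  have hnum := num_flip hz hxy
  have hlo : ∀ v, ((A.remove z y).add x y (A.lev y)).lo v = A.lo v := fun v => hnum v _
  have hhi : ∀ v, ((A.remove z y).add x y (A.lev y)).hi v = A.hi v := fun v => hnum v _
  have hyz : A.lab (y, z) = none := by
    have := h.orients.asymm z y (by simp [add_lab, hzx, hz])
    simpa [add_lab, hne.symm] using this
  have hlab : ∀ u v i, ((A.remove z y).add x y (A.lev y)).lab (u, v) = some i →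
      (u = x ∧ v = y ∧ i = A.lev y) ∨ A.lab (u, v) = some i := by
    intro u v i hi
    simp only [add_lab, remove_lab] at hi
    split_ifs at hi with e
    · simp only [Prod.mk.injEq] at e
      simp only [Option.some.injEq] at hi
      exact .inl ⟨e.1, e.2, hi.symm⟩
    · exact .inr hi
  have hsome : ∀ u v, ((((A.remove z y).add x y (A.lev y)).add y z 0).lab (u, v)).isSome ↔
      (u = y ∧ v = z) ∨ (¬ (u = z ∧ v = y) ∧ ((A.add x y 0).lab (u, v)).isSome) := by
    intro u v
    simp only [add_lab, remove_lab, Prod.mk.injEq]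
    by_cases h1 : u = y ∧ v = z
    · simp [h1]
    · by_cases h2 : u = x ∧ v = y
      · obtain ⟨rfl, rfl⟩ := h2
        simp [hne, hzx.symm]
      · by_cases h3 : u = z ∧ v = y
        · obtain ⟨rfl, rfl⟩ := h3
          simp [hzx, hzy']
        · simp [h1, h2, h3]
  refine ⟨hzy'.symm, ?_, ⟨?_, ?_⟩, ⟨?_, ?_, ?_, h.fair.lev_le⟩, fun hc => ?_, ?_, ?_, ?_⟩
  · simp [add_lab, remove_lab, hzy', hne.symm, hyz]
  · intro u v huv
    rw [← Option.not_isSome_iff_eq_none]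
    rw [hsome] at huv ⊢
    rintro h2
    rcases huv with ⟨rfl, rfl⟩ | ⟨h3, h4⟩
    · simp [hzy'] at h2
    · rcases h2 with ⟨rfl, rfl⟩ | ⟨h5, h6⟩
      · simp at h3
      · rw [h.orients.asymm u v h4] at h6
        simp at h6
  · intro u v
    rw [h.orients.adj, hsome, hsome]
    have e1 : ((A.add x y 0).lab (z, y)).isSome := by simp [add_lab, hzx, hz]
    have e2 : ((A.add x y 0).lab (y, z)).isSome = false := by simp [add_lab, hne.symm, hyz]
    by_cases h1 : u = y ∧ v = z
    · obtain ⟨rfl, rfl⟩ := h1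
      simp [e1]
    · by_cases h2 : u = z ∧ v = y
      · obtain ⟨rfl, rfl⟩ := h2
        simp [e1]
      · have h1' : ¬ (v = z ∧ u = y) := fun e => h1 ⟨e.2, e.1⟩
        have h2' : ¬ (v = y ∧ u = z) := fun e => h2 ⟨e.2, e.1⟩
        simp [h1, h2, h1', h2']
  · intro u v i hi
    rcases hlab u v i hi with ⟨rfl, rfl, rfl⟩ | hi
    · exact .inl rfl
    · exact h.fair.lab_lev _ _ _ hi
  · intro u v i hi
    rcases hlab u v i hi with ⟨rfl, rfl, rfl⟩ | hi
    · exact h.lev_le'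
    · exact h.fair.fair _ _ _ hi
  · intro u v i hi
    rcases hlab u v i hi with ⟨rfl, rfl, rfl⟩ | hi
    · exact h.fair.lev_le _
    · exact h.fair.lab_le _ _ _ hi
  · simp only [add_lev, remove_lev]; omega
  · simp only [add_lev, remove_lev]; omega
  · intro v hv
    rw [hlo, hhi]
    by_cases hvy : v = y
    · subst hvy
      exact h.band'.mono (by positivity) le_rfl
    · exact h.band v hvy
  · rw [hlo, hhi]
    push_cast
    exact h.band z hzy'

/-- The loop ends for one of three reasons. If `c ≥ k`, the slack `k` pays for the new arc and for
the `k - 1` lost with one unit of room. At level `L` the upper half is vacuous. Below the threshold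
of the current level, `near_up` applies. -/
theorem InsReady.finish (h : InsReady G k L w A x y c) (hk : 2 ≤ k) (hw : ∀ v, 1 ≤ w v)
    (hend : ¬ (c < k ∧ A.lev y < L ∧ w y * theta k (A.lev y) ≤ A.deg y)) :
    Valid G k L w (A.add x y (A.lev y)) := by
  have hne := h.ne
  have hxy := h.lab_none
  have hlo : ∀ v, (A.add x y (A.lev y)).lo v = A.lo v + if v = y then 1 else 0 := by
    intro v
    simp only [lo, num_add hxy, add_lev]
    by_cases hv : v = y
    · subst hv; simp
    · simp [hv]
  have hhi : ∀ v, (A.add x y (A.lev y)).hi v = A.hi v := by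
    intro v
    simp only [hi, num_add hxy, add_lev]
    by_cases hv : v = y
    · subst hv; simp
    · simp [hv]
  have hsome : ∀ p, ((A.add x y (A.lev y)).lab p).isSome = ((A.add x y 0).lab p).isSome := by
    intro p
    simp only [add_lab]
    split_ifs <;> rfl
  have hlab : ∀ u v i, (A.add x y (A.lev y)).lab (u, v) = some i →
      (u = x ∧ v = y ∧ i = A.lev y) ∨ A.lab (u, v) = some i := by
    intro u v i hi
    simp only [add_lab] at hi
    split_ifs at hi with e
    · simp only [Prod.mk.injEq] at e
      simp only [Option.some.injEq] at hi
      exact .inl ⟨e.1, e.2, hi.symm⟩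
    · exact .inr hi
  refine ⟨⟨?_, ?_⟩, ⟨?_, ?_, ?_, h.fair.lev_le⟩, ?_⟩
  · intro u v huv
    rw [← Option.not_isSome_iff_eq_none, hsome, Option.not_isSome_iff_eq_none]
    exact h.orients.asymm u v (by rwa [hsome] at huv)
  · intro u v
    rw [h.orients.adj, hsome, hsome]
  · intro u v i hi
    rcases hlab u v i hi with ⟨rfl, rfl, rfl⟩ | hi
    · exact .inl rfl
    · exact h.fair.lab_lev _ _ _ hi
  · intro u v i hi
    rcases hlab u v i hi with ⟨rfl, rfl, rfl⟩ | hi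
    · exact h.lev_le'
    · exact h.fair.fair _ _ _ hi
  · intro u v i hi
    rcases hlab u v i hi with ⟨rfl, rfl, rfl⟩ | hi
    · exact h.fair.lev_le _
    · exact h.fair.lab_le _ _ _ hi
  · intro v
    rw [hlo, hhi]
    by_cases hv : v = y
    · subst hv
      have h3 : (A.deg v : ℝ) = A.lo v + A.hi v := by exact_mod_cast h.fair.deg_eq v
      have hhi0 : (0 : ℝ) ≤ A.hi v := by positivity
      have hlo0 : (0 : ℝ) ≤ A.lo v := by positivity
      simp only [if_true, add_lev]
      constructor
      · intro g1 g2
        push_cast at g2 ⊢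
        by_cases hdeg : w v * theta k (A.lev v) ≤ A.deg v
        · have hck : k ≤ c := by
            by_contra hcon
            exact hend ⟨by omega, g1, hdeg⟩
          have hck' : (k : ℝ) ≤ c := by exact_mod_cast hck
          have := h.band'.up g1 (by linarith)
          nlinarith
        · push Not at hdeg
          have := near_up (a := 0) hk (hw v) (A.lev v) (d := A.lo v + A.hi v + 1) (by linarith)
          have e : (A.lo v : ℝ) + 1 + A.hi v = A.lo v + A.hi v + 1 := by ring
          rw [e]
          linarith
      · intro g1 g2
        push_cast at g2 ⊢
        have := h.band'.down g1 (by linarith)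
        have hk0 : (0 : ℝ) ≤ k := by positivity
        nlinarith
    · simpa [hv] using h.band v hv

theorem Valid.insReady (h : Valid G k L w A) (hne : x ≠ y) (hadj : ¬ G.Adj x y)
    (hlev : A.lev y ≤ A.lev x) :
    InsReady (G ⊔ SimpleGraph.edge x y) k L w A x y 0 := by
  have h1 : A.lab (x, y) = none := by
    rw [← Option.not_isSome_iff_eq_none]
    exact fun e => hadj ((h.orients.adj x y).2 (.inl e))
  have h2 : A.lab (y, x) = none := by
    rw [← Option.not_isSome_iff_eq_none]
    exact fun e => hadj ((h.orients.adj x y).2 (.inr e))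
  refine ⟨hne, h1, ⟨?_, ?_⟩, h.fair, fun _ => hlev, by omega, fun v _ => h.band v,
    by simpa using h.band y⟩
  · intro u v huv
    simp only [add_lab, Prod.mk.injEq] at huv ⊢
    by_cases h3 : u = x ∧ v = y
    · obtain ⟨rfl, rfl⟩ := h3
      simp [hne, hne.symm, h2]
    · simp only [h3, if_false] at huv
      have := h.orients.asymm u v huv
      by_cases h4 : v = x ∧ u = y
      · obtain ⟨rfl, rfl⟩ := h4
        simp [h2] at huv
      · simp [h4, this]
  · intro u v
    simp only [SimpleGraph.sup_adj, SimpleGraph.edge_adj, add_lab, Prod.mk.injEq, h.orients.adj]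
    by_cases h3 : u = x ∧ v = y
    · obtain ⟨rfl, rfl⟩ := h3
      simp [hne]
    · by_cases h4 : v = x ∧ u = y
      · obtain ⟨rfl, rfl⟩ := h4
        simp [hne.symm]
      · have h4' : ¬ (u = y ∧ v = x) := fun e => h4 ⟨e.2, e.1⟩
        simp [h3, h4, h4']

end VWDSG
-- Invariants while a deletion is carried out.
namespace VWDSG
open RealRAM Conf

variable {n : ℕ} {G : SimpleGraph (Fin n)} {k L : ℕ} {w : Fin n → ℝ}
variable {A : Conf n} {x y z : Fin n} {c j : ℕ}

theorem Valid.delReady (h : Valid G k L w A) (hxy : A.lab (x, y) = some j) :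
    DelReady (G.deleteEdges {s(x, y)}) k L w (A.remove x y) y j := by
  have hyx : A.lab (y, x) = none := h.orients.asymm x y (by simp [hxy])
  have hne : x ≠ y := by rintro rfl; simp [hxy] at hyx
  have hnum := fun v i => num_remove hxy v i
  have hlab : ∀ u v i, (A.remove x y).lab (u, v) = some i → A.lab (u, v) = some i := by
    intro u v i hi
    simp only [remove_lab] at hi
    split_ifs at hi
    exact hi
  refine ⟨⟨?_, ?_⟩, ⟨fun u v i hi => h.fair.lab_lev u v i (hlab _ _ _ hi),
    fun u v i hi => h.fair.fair u v i (hlab _ _ _ hi),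
    fun u v i hi => h.fair.lab_le u v i (hlab _ _ _ hi), h.fair.lev_le⟩,
    h.fair.lab_lev _ _ _ hxy, h.fair.lab_le _ _ _ hxy, ?_, ?_⟩
  · intro u v huv
    obtain ⟨i, hi⟩ := Option.isSome_iff_exists.1 huv
    have := h.orients.asymm u v (by simp [hlab _ _ _ hi])
    simp [remove_lab, this]
  · intro u v
    simp only [SimpleGraph.deleteEdges_adj, h.orients.adj, remove_lab, Prod.mk.injEq,
      Set.mem_singleton_iff, Sym2.eq_iff]
    by_cases h1 : u = x ∧ v = y
    · obtain ⟨rfl, rfl⟩ := h1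
      simp [hne.symm, hyx]
    · by_cases h2 : u = y ∧ v = x
      · obtain ⟨rfl, rfl⟩ := h2
        simp [hne.symm, hyx]
      · have h2' : ¬ (v = x ∧ u = y) := fun e => h2 ⟨e.2, e.1⟩
        simp [h1, h2, h2']
  · intro v hv
    have h1 := hnum v (A.lev v)
    have h2 := hnum v (A.lev v + 1)
    simp only [hv, false_and, if_false, add_zero] at h1 h2
    simp only [lo, hi, remove_lev, h1, h2]
    exact h.band v
  · have h1 : (A.remove x y).lo y + (if A.lev y = j then 1 else 0) = A.lo y := by
      simpa [lo] using hnum y (A.lev y)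
    have h2 : (A.remove x y).hi y + (if A.lev y + 1 = j then 1 else 0) = A.hi y := by
      simpa [hi] using hnum y (A.lev y + 1)
    have := h.band y
    rw [← h1, ← h2] at this
    exact this

theorem DelReady.lab_symm_none (h : DelReady G k L w A y j) {i : ℕ}
    (hz : A.lab (y, z) = some i) : A.lab (z, y) = none ∧ z ≠ y := by
  have := h.orients.asymm y z (by simp [hz])
  refine ⟨this, ?_⟩
  rintro rfl
  simp [hz] at this

/-- The reversed arc `z → y` fills the gap at `y` with the missing label `j`, and the gap moves to
`z`. Since `lev y + 2` is `lev z` or `lev z + 1`, the gap climbs by at least one level. -/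
theorem DelReady.flip (h : DelReady G k L w A y j) (hz : A.lab (y, z) = some (A.lev y + 2)) :
    DelReady G k L w ((A.remove y z).add z y j) z (A.lev y + 2) := by
  obtain ⟨hzy, hne⟩ := h.lab_symm_none hz
  have hzy' : (A.remove y z).lab (z, y) = none := by simp [remove_lab, hzy]
  have hnum : ∀ v i, ((A.remove y z).add z y j).num v i +
      (if v = z ∧ i = A.lev y + 2 then 1 else 0) =
      A.num v i + if v = y ∧ i = j then 1 else 0 := by
    intro v i
    rw [num_add hzy', ← num_remove hz]
    omega
  have hlz := h.fair.lab_lev _ _ _ hz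
  have hlab : ∀ u v i, ((A.remove y z).add z y j).lab (u, v) = some i →
      (u = z ∧ v = y ∧ i = j) ∨ A.lab (u, v) = some i := by
    intro u v i hi
    simp only [add_lab, remove_lab] at hi
    split_ifs at hi with e
    · simp only [Prod.mk.injEq] at e
      simp only [Option.some.injEq] at hi
      exact .inl ⟨e.1, e.2, hi.symm⟩
    · exact .inr hi
  have hj := h.label
  have hsome : ∀ u v, (((A.remove y z).add z y j).lab (u, v)).isSome ↔
      (u = z ∧ v = y) ∨ (¬ (u = y ∧ v = z) ∧ (A.lab (u, v)).isSome) := by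
    intro u v
    simp only [add_lab, remove_lab, Prod.mk.injEq]
    by_cases h1 : u = z ∧ v = y
    · simp [h1]
    · by_cases h3 : u = y ∧ v = z
      · obtain ⟨rfl, rfl⟩ := h3
        simp [hne]
      · simp [h1, h3]
  refine ⟨⟨?_, ?_⟩, ⟨?_, ?_, ?_, h.fair.lev_le⟩, hlz, h.fair.lab_le _ _ _ hz, ?_, ?_⟩
  · intro u v huv
    rw [← Option.not_isSome_iff_eq_none]
    rw [hsome] at huv ⊢
    rintro h2
    rcases huv with ⟨rfl, rfl⟩ | ⟨h3, h4⟩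
    · simp [hne] at h2
    · rcases h2 with ⟨rfl, rfl⟩ | ⟨h5, h6⟩
      · simp at h3
      · rw [h.orients.asymm u v h4] at h6
        simp at h6
  · intro u v
    rw [h.orients.adj, hsome, hsome]
    by_cases h1 : u = y ∧ v = z
    · obtain ⟨rfl, rfl⟩ := h1
      simp [hz]
    · by_cases h2 : u = z ∧ v = y
      · obtain ⟨rfl, rfl⟩ := h2
        simp [hz]
      · have h1' : ¬ (v = z ∧ u = y) := fun e => h1 ⟨e.2, e.1⟩
        have h2' : ¬ (v = y ∧ u = z) := fun e => h2 ⟨e.2, e.1⟩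
        simp [h1, h2, h1', h2']
  · intro u v i hi
    rcases hlab u v i hi with ⟨rfl, rfl, rfl⟩ | hi
    · exact h.label
    · exact h.fair.lab_lev _ _ _ hi
  · intro u v i hi
    rcases hlab u v i hi with ⟨rfl, rfl, rfl⟩ | hi
    · simp only [add_lev, remove_lev]; omega
    · exact h.fair.fair _ _ _ hi
  · intro u v i hi
    rcases hlab u v i hi with ⟨rfl, rfl, rfl⟩ | hi
    · exact h.label_le
    · exact h.fair.lab_le _ _ _ hi
  · intro v hv
    have h1 := hnum v (A.lev v)
    have h2 := hnum v (A.lev v + 1)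
    simp only [hv, false_and, if_false, add_zero] at h1 h2
    simp only [lo, hi, add_lev, remove_lev, h1, h2]
    by_cases hvy : v = y
    · subst hvy
      simp only [true_and]
      exact h.band'
    · simp only [hvy, false_and, if_false, add_zero]
      exact h.band v hvy
  · have h1 : ((A.remove y z).add z y j).lo z +
        (if A.lev z = A.lev y + 2 then 1 else 0) = A.lo z := by
      simpa [lo, hne] using hnum z (A.lev z)
    have h2 : ((A.remove y z).add z y j).hi z +
        (if A.lev z + 1 = A.lev y + 2 then 1 else 0) = A.hi z := by
      simpa [hi, hne] using hnum z (A.lev z + 1)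
    have := h.band z hne
    rw [← h1, ← h2] at this
    exact this

theorem DelReady.finish (h : DelReady G k L w A y j) (hk : 2 ≤ k) (hw : ∀ v, 1 ≤ w v)
    (hend : ∀ z, A.lab (y, z) ≠ some (A.lev y + 2)) : DownReady G k L w A y 0 := by
  refine ⟨h.orients, h.fair, ?_, h.band, ?_⟩
  · intro _ z i hi
    have h1 := h.fair.fair _ _ _ hi
    have h2 : i ≠ A.lev y + 2 := by rintro rfl; exact hend z hi
    omega
  · have hk' : (2 : ℝ) ≤ k := by exact_mod_cast hk
    -- Exactly one of the two counts misses an arc.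
    obtain ⟨a, b, hab, ha, hb, hband⟩ : ∃ a b : ℕ, a + b = 1 ∧ (0 : ℝ) ≤ a ∧ (0 : ℝ) ≤ b ∧
        Band k L (w y) (A.lev y) (A.lo y + a) (A.hi y + b) 0 0 := by
      refine ⟨_, _, ?_, by positivity, by positivity, h.band'⟩
      rcases h.label with rfl | rfl <;> simp
    have hab' : (a : ℝ) + b = 1 := by exact_mod_cast hab
    have hlo : (0 : ℝ) ≤ A.lo y := by positivity
    constructor
    · intro g1 g2
      have := hband.up g1 (by push_cast; linarith)
      push_cast at this
      have e : (A.lo y : ℝ) + a + (A.hi y + b) = A.lo y + A.hi y + 1 := by linarith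
      rw [e] at this
      linarith
    · intro g1 g2
      push_cast
      -- Either the degree was below the threshold before the loss, and the old bound holds with
      -- deficit `k`; or it has just crossed the threshold, and `near_down` gives the bound without
      -- any deficit.
      by_cases g3 : (A.lo y : ℝ) + A.hi y + 1 < w y * theta k (A.lev y)
      · have := hband.down g1 (by push_cast; linarith)
        push_cast at this
        have e : (A.lo y : ℝ) + a + (A.hi y + b) = A.lo y + A.hi y + 1 := by linarith
        rw [e] at this
        linarith
      · obtain ⟨f, hf⟩ := Nat.exists_eq_add_of_le' g1
        rw [hf] at g2 g3 ⊢
        have := near_down hk (hw y) f (d := A.lo y + A.hi y) (by linarith) g2.le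
        simp only [Nat.add_sub_cancel]
        linarith

theorem DownReady.relabel (h : DownReady G k L w A y c) (hc : c < k)
    (hd : A.deg y < w y * theta k (A.lev y)) (hz : A.lab (z, y) = some (A.lev y + 1)) :
    DownReady G k L w ((A.remove z y).add z y (A.lev y)) y (c + 1) := by
  have hyz := h.orients.asymm z y (by simp [hz])
  have hlo : ∀ v, ((A.remove z y).add z y (A.lev y)).lo v =
      A.lo v + (if v = y then 1 else 0) := by
    intro v
    have := num_relabel (i := A.lev y) hz v (A.lev v)
    simp only [lo, add_lev, remove_lev]
    by_cases hv : v = y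
    · subst hv; simpa using this
    · simpa [hv] using this
  have hhi : ∀ v, ((A.remove z y).add z y (A.lev y)).hi v + (if v = y then 1 else 0) =
      A.hi v := by
    intro v
    have := num_relabel (i := A.lev y) hz v (A.lev v + 1)
    simp only [hi, add_lev, remove_lev]
    by_cases hv : v = y
    · subst hv; simpa using this
    · simpa [hv] using this
  have hsome : ∀ p, (((A.remove z y).add z y (A.lev y)).lab p).isSome = (A.lab p).isSome := by
    intro p
    simp only [add_lab, remove_lab]
    split_ifs with e
    · simp [e, hz]
    · rfl
  have hlab : ∀ u v i, ((A.remove z y).add z y (A.lev y)).lab (u, v) = some i →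
      (u = z ∧ v = y ∧ i = A.lev y) ∨ A.lab (u, v) = some i := by
    intro u v i hi
    simp only [add_lab, remove_lab] at hi
    split_ifs at hi with e
    · simp only [Prod.mk.injEq] at e
      simp only [Option.some.injEq] at hi
      exact .inl ⟨e.1, e.2, hi.symm⟩
    · exact .inr hi
  refine ⟨⟨?_, ?_⟩, ⟨?_, ?_, ?_, h.fair.lev_le⟩, ?_, ?_, ?_⟩
  · intro u v huv
    rw [hsome] at huv
    rw [← Option.not_isSome_iff_eq_none, hsome, Option.not_isSome_iff_eq_none]
    exact h.orients.asymm u v huv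
  · intro u v
    rw [h.orients.adj, hsome, hsome]
  · intro u v i hi
    rcases hlab u v i hi with ⟨rfl, rfl, rfl⟩ | hi
    · exact .inl rfl
    · exact h.fair.lab_lev _ _ _ hi
  · intro u v i hi
    rcases hlab u v i hi with ⟨rfl, rfl, rfl⟩ | hi
    · have := h.fair.fair _ _ _ hz
      simp only [add_lev, remove_lev]; omega
    · exact h.fair.fair _ _ _ hi
  · intro u v i hi
    rcases hlab u v i hi with ⟨rfl, rfl, rfl⟩ | hi
    · exact h.fair.lev_le _
    · exact h.fair.lab_le _ _ _ hi
  · intro _ u i hi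
    rcases hlab y u i hi with ⟨rfl, rfl, rfl⟩ | hi
    · simp [hz] at hyz
    · exact h.out hc u i hi
  · intro v hv
    have h1 := hlo v
    have h2 := hhi v
    simp only [hv, if_false, add_zero] at h1 h2
    rw [h1, h2]
    exact h.band v hv
  · have h1 := hlo y
    have h2 := hhi y
    simp only [if_true] at h1 h2
    have h1' : (((A.remove z y).add z y (A.lev y)).lo y : ℝ) = A.lo y + 1 := by exact_mod_cast h1
    have h2' : (((A.remove z y).add z y (A.lev y)).hi y : ℝ) = A.hi y - 1 := by
      rw [← h2]; push_cast; ring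
    have h3 : (A.deg y : ℝ) = A.lo y + A.hi y := by exact_mod_cast h.fair.deg_eq y
    constructor
    · intro g1 g2
      simp only [add_lev, remove_lev] at *
      linarith
    · intro g1 g2
      have := h.band'.down g1 (by linarith)
      simp only [add_lev, remove_lev] at *
      rw [h1', h2']
      push_cast
      ring_nf at this ⊢
      linarith

theorem lev_pos_of_deg_lt {A : Conf n} {y : Fin n}
    (hd : A.deg y < w y * theta k (A.lev y)) : 1 ≤ A.lev y := by
  by_contra hcon
  have : A.lev y = 0 := by omega
  rw [this] at hd
  have h0 : (0 : ℝ) ≤ A.deg y := by positivity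
  simp only [theta, mul_zero] at hd
  linarith

/-- All labels already equal the old level, which is the new level plus 1, so nothing is moved. The
upper half is clear since no arc carries the new level; for the lower half, the band with `hi = 0`
shows that the degree is at most 1 below the previous threshold, where `near_down` applies. -/
theorem DownReady.lower (h : DownReady G k L w A y c) (hk : 2 ≤ k) (hw : ∀ v, 1 ≤ w v)
    (hc : c < k) (hd : A.deg y < w y * theta k (A.lev y)) (h0 : A.hi y = 0) :
    DownReady G k L w (A.setLev y (A.lev y - 1)) y k := by
  have hpos := lev_pos_of_deg_lt hd
  have h3 : (A.deg y : ℝ) = A.lo y + A.hi y := by exact_mod_cast h.fair.deg_eq y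
  have hhi : (A.setLev y (A.lev y - 1)).hi y = A.lo y := by
    simp only [lo, hi, setLev_num, setLev_lev, Function.update_self]
    congr 1; omega
  have hlo : (A.setLev y (A.lev y - 1)).lo y = 0 := by
    simp only [lo, setLev_num, setLev_lev, Function.update_self]
    refine lo_pos_of_num fun u hu => ?_
    rcases h.fair.lab_lev _ _ _ hu with e | e <;> omega
  refine ⟨⟨h.orients.asymm, h.orients.adj⟩, ⟨?_, ?_, h.fair.lab_le, ?_⟩,
    fun h => absurd h (lt_irrefl _), ?_, ?_⟩
  · intro u v i hi
    by_cases hv : v = y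
    · subst hv
      have := Fair.no_lo_of h.fair h0 hi
      simp; omega
    · simpa [hv] using h.fair.lab_lev _ _ _ hi
  · intro u v i hi
    by_cases hu : u = y
    · subst hu
      have := h.out hc v i hi
      simp; omega
    · simpa [hu] using h.fair.fair u v i hi
  · intro v
    have := h.fair.lev_le v
    by_cases hv : v = y
    · subst hv; simp; omega
    · simpa [hv] using this
  · intro v hv
    rw [setLev_lo_of_ne A _ hv, setLev_hi_of_ne A _ hv]
    simpa [hv] using h.band v hv
  · obtain ⟨f, hf⟩ := Nat.exists_eq_add_of_le' hpos
    have hdown := h.band'.down hpos (by linarith)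
    rw [hlo, hhi]
    rw [hf] at hd hdown
    rw [h0] at hdown h3
    simp only [setLev_lev, Function.update_self, hf, Nat.add_sub_cancel] at hdown ⊢
    have hk' : (2 : ℝ) ≤ k := by exact_mod_cast hk
    push_cast at hdown h3
    have hc0 : (0 : ℝ) ≤ c := by positivity
    constructor
    · intro g1 g2
      push_cast
      have : (0 : ℝ) ≤ w y * theta k (f + 1) - (0 + A.lo y) := by linarith
      have := mul_nonneg (by linarith : (0 : ℝ) ≤ k - 1) this
      linarith
    · intro g1 g2
      obtain ⟨f', hf'⟩ := Nat.exists_eq_add_of_le' g1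
      subst hf'
      push_cast at g2 ⊢
      -- A degree more than 1 below the threshold would contradict the band with `hi = 0`, whose
      -- deficit is at most `k`.
      have := near_down hk (hw y) f' (d := A.lo y) (by
        by_contra hcon
        push Not at hcon
        have : (k : ℝ) * (A.lo y + 0 - w y * theta k (f' + 1)) < k * (-1) :=
          mul_lt_mul_of_pos_left (by linarith) (by linarith)
        linarith) (by linarith)
      rw [zero_add]
      linarith

theorem DownReady.finish (h : DownReady G k L w A y c)
    (hend : ¬ (c < k ∧ A.deg y < w y * theta k (A.lev y))) : Valid G k L w A := by
  refine ⟨h.orients, h.fair, fun v => ?_⟩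
  by_cases hv : v = y
  · subst hv
    have h3 : (A.deg v : ℝ) = A.lo v + A.hi v := by exact_mod_cast h.fair.deg_eq v
    refine ⟨h.band'.up, fun g1 g2 => ?_⟩
    have hck : k ≤ c := by
      by_contra hcon
      exact hend ⟨by omega, by linarith⟩
    have hck' : (k : ℝ) ≤ c := by exact_mod_cast hck
    have := h.band'.down g1 g2
    linarith
  · exact h.band v hv

end VWDSG
-- The update programs; correctness and cost of insertion.
namespace VWDSG
open RealRAM Conf

/-- Store the key for head or tail in register `17` and label `e` in register `21`. -/
def keyOf (e : IExp) : IExp := .add (.mul (.var 17) (.var 6)) e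

/-- The last entry of the list with the key in register `21`. -/
def lastOf (a : ℕ) : IExp :=
  .read (a + 1) (.add (.mul (.var 21) (.var 7)) (.sub (.read a (.var 21)) (.const 1)))

/-- The level of the vertex in register `17`. -/
def lev17 : IExp := .read 12 (.var 17)

/-- The threshold at the level of the vertex in register `17`, times its weight. -/
def thr17 : RExp := .mul (.read 0 (.var 17)) (.read 1 lev17)

/-- The in-degree of the vertex in register `17`. -/
def deg17 : RExp := .ofInt (.read 13 (.var 17))

def insTest : Test :=
  .and (.ilt (.var 18) (.var 4)) (.and (.ilt lev17 (.var 5)) (.not (.rlt deg17 thr17)))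

/-- Registers `14` and `15` still hold the head and the label of the arc just removed, so only the
tail is replaced. -/
def insFlip : Program :=
  .seq (.iset 13 (.var 16)) <| .seq addArc <| .seq (.iset 16 (.var 17)) <|
  .seq (.iset 17 (.var 19)) (.iset 18 (.const 0))

def insRelabel : Program :=
  .seq (.iset 15 (.add (.var 15) (.const 1))) <| .seq addArc <|
  .iset 18 (.add (.var 18) (.const 1))

def insVisit : Program :=
  .seq (.iset 19 (.div (lastOf 3) (.var 0))) <| .seq (.iset 13 (.var 19)) <|
  .seq (.iset 14 (.var 17)) <| .seq removeArc <|
  .branch (.ilt lev17 (.add (.read 12 (.var 19)) (.const 2))) insRelabel insFlip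

def insBody : Program :=
  .seq (.iset 21 (keyOf lev17)) <|
  .branch (.ieq (.read 3 (.var 21)) (.const 0)) (.seq raiseLevel (.iset 18 (.var 4))) insVisit

/-- Insert the edge with endpoints in registers `1` and `2`. -/
def insertProgram : Program :=
  .seq (.branch (.ilt (.read 12 (.var 1)) (.read 12 (.var 2)))
    (.seq (.iset 16 (.var 2)) (.iset 17 (.var 1))) (.seq (.iset 16 (.var 1)) (.iset 17 (.var 2)))) <|
  .seq (.iset 18 (.const 0)) <| .seq (.loop insTest insBody) <|
  .seq (.iset 13 (.var 16)) <| .seq (.iset 14 (.var 17)) <| .seq (.iset 15 lev17) addArc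

def delTest : Test := .ilt (.const 0) (.read 6 (keyOf (.add lev17 (.const 2))))

def delBody : Program :=
  .seq (.iset 21 (keyOf (.add lev17 (.const 2)))) <| .seq (.iset 19 (.mod (lastOf 6) (.var 0))) <|
  .seq (.iset 13 (.var 17)) <| .seq (.iset 14 (.var 19)) <| .seq removeArc <|
  .seq (.iset 22 (.var 15)) <| .seq (.iset 13 (.var 19)) <| .seq (.iset 14 (.var 17)) <|
  .seq (.iset 15 (.var 20)) <| .seq addArc <| .seq (.iset 20 (.var 22)) (.iset 17 (.var 19))

def downTest : Test := .and (.ilt (.var 18) (.var 4)) (.rlt deg17 thr17)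

def downVisit : Program :=
  .seq (.iset 19 (.div (lastOf 3) (.var 0))) <| .seq (.iset 13 (.var 19)) <|
  .seq (.iset 14 (.var 17)) <| .seq removeArc <| .seq (.iset 15 (.sub (.var 15) (.const 1))) <|
  .seq addArc (.iset 18 (.add (.var 18) (.const 1)))

def downBody : Program :=
  .seq (.iset 21 (keyOf (.add lev17 (.const 1)))) <|
  .branch (.ieq (.read 3 (.var 21)) (.const 0)) (.seq lowerLevel (.iset 18 (.var 4))) downVisit

/-- Delete the edge with endpoints in registers `1` and `2`. -/
def deleteProgram : Program :=
  .seq (.branch (.ieq (.read 0 (.add (.mul (.var 1) (.var 0)) (.var 2))) (.const 1))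
    (.seq (.iset 16 (.var 1)) (.iset 17 (.var 2))) (.seq (.iset 16 (.var 2)) (.iset 17 (.var 1)))) <|
  .seq (.iset 13 (.var 16)) <| .seq (.iset 14 (.var 17)) <| .seq removeArc <|
  .seq (.iset 20 (.var 15)) <| .seq (.loop delTest delBody) <|
  .seq (.iset 18 (.const 0)) (.loop downTest downBody)

variable {n : ℕ} {G : SimpleGraph (Fin n)} {k L B : ℕ} {ε : ℝ} {w : Fin n → ℝ} {s : State}
variable {A : Conf n} {x y z : Fin n} {c j : ℕ}

theorem Stored.setI (h : Stored k L ε w s A) {r : ℕ} (hr : r = 1 ∨ r = 2 ∨ 9 ≤ r) (m : ℕ) :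
    Stored k L ε w (s.setI r m) A := by
  have hi : ∀ q, q = 0 ∨ q = 4 ∨ q = 5 ∨ q = 6 ∨ q = 7 ∨ q = 8 → (s.setI r m).ireg q = s.ireg q := by
    intro q hq
    rw [setI_ireg, if_neg (by omega)]
  refine ⟨?_, ?_, ?_, ?_, ?_, h.eps_eq, h.weight, h.thr, h.arc, h.lab, h.ins, h.outs, h.levs, h.lev,
    h.deg, ?_, ?_⟩
  · rw [hi _ (by omega)]; exact h.n_eq
  · rw [hi _ (by omega)]; exact h.k_eq
  · rw [hi _ (by omega)]; exact h.L_eq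
  · rw [hi _ (by omega)]; exact h.keys_eq
  · rw [hi _ (by omega)]; exact h.items_eq
  · rw [hi _ (by omega)]; exact h.le_top
  · rw [hi _ (by omega)]; exact h.top

theorem key_inj {a b i j l : ℕ} (hi : i < l) (hj : j < l) (h : a * l + i = b * l + j) :
    a = b ∧ i = j :=
  Bucketed.index_inj hi hj h

theorem Stored.exists_in (h : Stored k L ε w s A) (hf : A.Fair L) (hj : j < L + 3)
    (h0 : s.imem 3 (y * (L + 3) + j) ≠ 0) :
    ∃ z, A.lab (z, y) = some j ∧
      s.imem 4 ((y * (L + 3) + j) * (n * n) + (s.imem 3 (y * (L + 3) + j) - 1)) =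
        pairCode (z, y) := by
  obtain ⟨⟨u, v⟩, hκ, he, -⟩ :=
    h.ins.get (y * (L + 3) + j) (s.imem 3 (y * (L + 3) + j) - 1) (by omega)
  simp only [inKey, Option.map_eq_some_iff] at hκ
  obtain ⟨i, hi, hκ⟩ := hκ
  have := hf.lab_le _ _ _ hi
  obtain ⟨h1, rfl⟩ := key_inj (by omega) hj hκ
  obtain rfl := Fin.ext h1
  exact ⟨u, hi, he⟩

theorem Stored.num_eq_zero (h : Stored k L ε w s A)
    (h0 : s.imem 3 (y * (L + 3) + j) = 0) : A.num y j = 0 := by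
  refine lo_pos_of_num fun u hu => ?_
  have := (h.ins.mem (u, y) (y * (L + 3) + j) (by simp [inKey, hu])).1
  omega

theorem Stored.exists_out (h : Stored k L ε w s A) (hf : A.Fair L) (hj : j < L + 3)
    (h0 : s.imem 6 (y * (L + 3) + j) ≠ 0) :
    ∃ z, A.lab (y, z) = some j ∧
      s.imem 7 ((y * (L + 3) + j) * (n * n) + (s.imem 6 (y * (L + 3) + j) - 1)) =
        pairCode (y, z) := by
  obtain ⟨⟨u, v⟩, hκ, he, -⟩ :=
    h.outs.get (y * (L + 3) + j) (s.imem 6 (y * (L + 3) + j) - 1) (by omega)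
  simp only [outKey, Option.map_eq_some_iff] at hκ
  obtain ⟨i, hi, hκ⟩ := hκ
  have := hf.lab_le _ _ _ hi
  obtain ⟨h1, rfl⟩ := key_inj (by omega) hj hκ
  obtain rfl := Fin.ext h1
  exact ⟨v, hi, he⟩

theorem Stored.no_out (h : Stored k L ε w s A)
    (h0 : s.imem 6 (y * (L + 3) + j) = 0) (z : Fin n) : A.lab (y, z) ≠ some j := by
  intro hz
  have := (h.outs.mem (y, z) (y * (L + 3) + j) (by simp [outKey, hz])).1
  omega

theorem Stored.insTest_iff (h : Stored k L ε w s A) (hf : A.Fair L)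
    (h17 : s.ireg 17 = y) (h18 : s.ireg 18 = c) :
    insTest.Holds B s ↔ (c < k ∧ A.lev y < L ∧ w y * theta k (A.lev y) ≤ A.deg y) := by
  simp [insTest, lev17, thr17, deg17, h17, h18, h.k_eq, h.L_eq, h.lev, h.deg, h.weight,
    h.thr _ (hf.lev_le y)]

theorem Stored.downTest_iff (h : Stored k L ε w s A) (hf : A.Fair L)
    (h17 : s.ireg 17 = y) (h18 : s.ireg 18 = c) :
    downTest.Holds B s ↔ (c < k ∧ A.deg y < w y * theta k (A.lev y)) := by
  simp [downTest, lev17, thr17, deg17, h17, h18, h.k_eq, h.lev, h.deg, h.weight,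
    h.thr _ (hf.lev_le y)]

/-- The credit that pays for the remaining iterations of the insertion loop. -/
def credit (k L : ℕ) (A : Conf n) (y : Fin n) (c : ℕ) : ℕ :=
  A.phi L + if c < k then A.lev y + 1 else 0

/-- A bound on the number of remaining iterations of the insertion loop. -/
def insMeasure (k : ℕ) (A : Conf n) (y : Fin n) (c : ℕ) : ℕ :=
  if c < k then A.lev y * (k + 1) + (k - c) else 0

/-- The state of the insertion loop. -/
structure InsState (G : SimpleGraph (Fin n)) (k L : ℕ) (ε : ℝ) (w : Fin n → ℝ) (s : State)
    (A : Conf n) (x y : Fin n) (c : ℕ) : Prop where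
  stored : Stored k L ε w s A
  tail : s.ireg 16 = x
  head : s.ireg 17 = y
  count : s.ireg 18 = c
  ready : InsReady G k L w A x y c

/-- A relabelling lowers the potential by 1, a rise releases the level term of `credit`, and a flip
keeps the potential but goes down at least two levels. The second measure bounds the number of
iterations independently of the potential. -/
theorem wp_insBody (hB : n * (L + 3) * (n * n) + k + 100 < B) (hk : 2 ≤ k) (hw : ∀ v, 1 ≤ w v)
    (h : InsState G k L ε w s A x y c)
    (ht : c < k ∧ A.lev y < L ∧ w y * theta k (A.lev y) ≤ A.deg y) :
    WP B insBody s fun t s' => t ≤ 300 ∧ ∃ A' x' y' c', InsState G k L ε w s' A' x' y' c' ∧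
      credit k L A' y' c' + 1 ≤ credit k L A y c ∧
      insMeasure k A' y' c' + 1 ≤ insMeasure k A y c := by
  obtain ⟨hs, h16, h17, h18, hr⟩ := h
  obtain ⟨hc, hL, hd⟩ := ht
  obtain ⟨hy1, hy2, hy3⟩ := key_bound hB y (j := A.lev y) (by omega)
  have e5 : (y * (L + 3)) % B = y * (L + 3) := Nat.mod_eq_of_lt hy3
  have e6 : (y * (L + 3) + A.lev y) % B = y * (L + 3) + A.lev y := Nat.mod_eq_of_lt hy2
  have e1 : 1 % B = 1 := Nat.mod_eq_of_lt (by omega)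
  have e2 : 2 % B = 2 := Nat.mod_eq_of_lt (by omega)
  have hkey : (keyOf lev17).eval B s = y * (L + 3) + A.lev y := by
    simp [keyOf, lev17, h17, hs.keys_eq, hs.lev, e5, e6]
  have hs' := hs.setI (r := 21) (by omega) (y * (L + 3) + A.lev y)
  simp only [insBody, wp_seq, wp_iset, hkey]
  by_cases h0 : s.imem 3 (y * (L + 3) + A.lev y) = 0
  · refine wp_branch_true (by simp [h0]) ?_
    rw [wp_seq]
    refine (wp_raiseLevel hB hs' hL (by simp [h17])).mono ?_
    rintro t₁ s₁ ⟨ht₁, hs₁, hf₁⟩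
    rw [wp_iset]
    refine ⟨by simp [keyOf, lev17]; omega, A.setLev y (A.lev y + 1), x, y, k,
      ⟨hs₁.setI (by omega) _, ?_, ?_, ?_, hr.raise hk hw hc hL hd (hs.num_eq_zero h0)⟩, ?_, ?_⟩
    · simp [hf₁, h16]
    · simp [hf₁, h17]
    · simp [hf₁, hs.k_eq]
    · simp [credit, hc]
    · simp only [insMeasure, lt_irrefl, if_false, hc, if_true]; omega
  · refine wp_branch_false (by simp [h0]) ?_
    obtain ⟨z, hz, he⟩ := hs.exists_in hr.fair (by omega) h0
    have hcnt : s.imem 3 (y * (L + 3) + A.lev y) ≤ n * n :=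
      hs.ins.cnt_le pairCode_injective card_pair _
    have e7 : ((y * (L + 3) + A.lev y) * (n * n)) % B = (y * (L + 3) + A.lev y) * (n * n) :=
      Nat.mod_eq_of_lt (by omega)
    have e8 : ((y * (L + 3) + A.lev y) * (n * n) + (s.imem 3 (y * (L + 3) + A.lev y) - 1)) % B =
        (y * (L + 3) + A.lev y) * (n * n) + (s.imem 3 (y * (L + 3) + A.lev y) - 1) :=
      Nat.mod_eq_of_lt (by omega)
    have hzv : (IExp.div (lastOf 3) (.var 0)).eval B (s.setI 21 (y * (L + 3) + A.lev y)) = z := by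
      simp [lastOf, hs.items_eq, e1, e7, e8, he, hs.n_eq, pairCode_div]
    simp only [insVisit, wp_seq, wp_iset, hzv]
    have hs'' := ((hs'.setI (r := 19) (by omega) z).setI (r := 13) (by omega) z).setI (r := 14)
      (by omega) y
    have hst : ((s.setI 21 (y * (L + 3) + A.lev y)).setI 19 z).setI 13
        (((s.setI 21 (y * (L + 3) + A.lev y)).setI 19 z).ireg 19) =
        ((s.setI 21 (y * (L + 3) + A.lev y)).setI 19 z).setI 13 z := by simp
    simp only [IExp.eval, hst]
    have hst' : (((s.setI 21 (y * (L + 3) + A.lev y)).setI 19 z).setI 13 z).ireg 17 = y := by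
      simp [h17]
    rw [hst']
    refine (wp_removeArc hB hs'' hz (by omega) (by simp) (by simp)).mono ?_
    rintro t₁ s₁ ⟨ht₁, hs₁, h15, hf₁⟩
    have g16 : s₁.ireg 16 = x := by simp [hf₁, h16]
    have g17 : s₁.ireg 17 = y := by simp [hf₁, h17]
    have g18 : s₁.ireg 18 = c := by simp [hf₁, h18]
    have g19 : s₁.ireg 19 = z := by simp [hf₁]
    have g13 : s₁.ireg 13 = z := by simp [hf₁]
    have g14 : s₁.ireg 14 = y := by simp [hf₁]
    have hlz := hr.fair.lev_le z
    have hbz := (lev_bound hB z (j := A.lev z + 2) (by omega)).2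
    have hby := (lev_bound hB y (j := A.lev y + 1) (by omega)).2
    have e9 : (A.lev z + 2) % B = A.lev z + 2 := Nat.mod_eq_of_lt hbz
    have e10 : (A.lev y + 1) % B = A.lev y + 1 := Nat.mod_eq_of_lt hby
    have e11 : (c + 1) % B = c + 1 := Nat.mod_eq_of_lt (by omega)
    by_cases hv : A.lev y < A.lev z + 2
    · refine wp_branch_true (by simp [lev17, g17, g19, hs₁.lev, e2, e9, hv]) ?_
      simp only [insRelabel, wp_seq, wp_iset]
      refine (wp_addArc (x := z) (y := y) (j := A.lev y + 1) hB (hs₁.setI (by omega) _)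
        (remove_lab_self z y) (by omega) (by simp [g13]) (by simp [g14])
        (by simp [h15, e1, e10])).mono ?_
      rintro t₂ s₂ ⟨ht₂, hs₂, hf₂⟩
      have hphi : ((A.remove z y).add z y (A.lev y + 1)).phi L + 1 = A.phi L := by
        rw [phi_add _ (remove_lab_self z y), ← phi_remove L hz]; omega
      refine ⟨by simp [keyOf, lev17, lastOf]; omega, _, x, y, c + 1,
        ⟨hs₂.setI (by omega) _, ?_, ?_, ?_, hr.relabel hc hL hd hz hv⟩, ?_, ?_⟩
      · simp [hf₂, g16]
      · simp [hf₂, g17]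
      · simp [hf₂, g18, e1, e11]
      · simp only [credit, add_lev, remove_lev, hc, if_true]
        split_ifs <;> omega
      · simp only [insMeasure, add_lev, remove_lev, hc, if_true]
        split_ifs <;> omega
    · refine wp_branch_false (by simpa [lev17, g17, g19, hs₁.lev, e2, e9] using hv) ?_
      simp only [insFlip, wp_seq, wp_iset]
      refine (wp_addArc (x := x) (y := y) (j := A.lev y) hB (hs₁.setI (by omega) _)
        (by simp [remove_lab, hr.lab_none]) (by omega) (by simp [g16]) (by simp [g14])
        (by simp [h15])).mono ?_
      rintro t₂ s₂ ⟨ht₂, hs₂, hf₂⟩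
      have hzx : z ≠ x := by rintro rfl; simp [hr.lab_none] at hz
      have hphi : ((A.remove z y).add x y (A.lev y)).phi L = A.phi L := by
        rw [phi_add _ (by simp [remove_lab, hr.lab_none]), ← phi_remove L hz]
      refine ⟨by simp [keyOf, lev17, lastOf]; omega, _, y, z, 0,
        ⟨((hs₂.setI (by omega) _).setI (by omega) _).setI (by omega) _, ?_, ?_, ?_,
        hr.flip hz (by omega)⟩, ?_, ?_⟩
      · simp [hf₂, g17]
      · simp [hf₂, g19]
      · simp
      · simp only [credit, add_lev, remove_lev, hc, if_true, hphi]
        split_ifs <;> omega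
      · simp only [insMeasure, add_lev, remove_lev, hc, if_true]
        -- Falling two levels frees `2 * (k + 1)`, more than the counter regains by its reset.
        have : (A.lev z + 2) * (k + 1) ≤ A.lev y * (k + 1) := Nat.mul_le_mul_right _ (by omega)
        rw [Nat.add_mul] at this
        split_ifs <;> omega

/-- The bound through `credit` serves the amortized analysis, the one through `insMeasure` the worst
case. Each iteration costs at most 300 steps for the body and 100 for the test. -/
theorem wp_insLoop (hB : n * (L + 3) * (n * n) + k + 100 < B) (hk : 2 ≤ k) (hw : ∀ v, 1 ≤ w v)
    (m : ℕ) : ∀ (s : State) (A : Conf n) (x y : Fin n) (c : ℕ), insMeasure k A y c ≤ m →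
    InsState G k L ε w s A x y c →
    WP B (.loop insTest insBody) s fun t s' => ∃ A' x' y' c', InsState G k L ε w s' A' x' y' c' ∧
      ¬ (c' < k ∧ A'.lev y' < L ∧ w y' * theta k (A'.lev y') ≤ A'.deg y') ∧
      t + 400 * A'.phi L ≤ 400 * (credit k L A y c + 1) ∧
      t ≤ 400 * (insMeasure k A y c + 1) := by
  induction m with
  | zero =>
    intro s A x y c hm h
    by_cases ht : c < k ∧ A.lev y < L ∧ w y * theta k (A.lev y) ≤ A.deg y
    · simp only [insMeasure, ht.1, if_true] at hm
      omega
    · refine wp_loop_end (by rwa [h.stored.insTest_iff h.ready.fair h.head h.count])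
        ⟨A, x, y, c, h, ht, ?_, ?_⟩
      · simp only [insTest, lev17, thr17, deg17, Test.cost, IExp.cost, RExp.cost, credit]; omega
      · simp only [insTest, lev17, thr17, deg17, Test.cost, IExp.cost, RExp.cost]; omega
  | succ m ih =>
    intro s A x y c hm h
    by_cases ht : c < k ∧ A.lev y < L ∧ w y * theta k (A.lev y) ≤ A.deg y
    · refine wp_loop_step (by rwa [h.stored.insTest_iff h.ready.fair h.head h.count]) ?_
      refine (wp_insBody hB hk hw h ht).mono ?_
      rintro t₁ s₁ ⟨ht₁, A₁, x₁, y₁, c₁, h₁, hcr, hme⟩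
      refine (ih s₁ A₁ x₁ y₁ c₁ (by omega) h₁).mono ?_
      rintro t₂ s₂ ⟨A₂, x₂, y₂, c₂, h₂, hend, hcr₂, hme₂⟩
      refine ⟨A₂, x₂, y₂, c₂, h₂, hend, ?_, ?_⟩
      · simp only [insTest, lev17, thr17, deg17, Test.cost, IExp.cost, RExp.cost]; omega
      · simp only [insTest, lev17, thr17, deg17, Test.cost, IExp.cost, RExp.cost]; omega
    · refine wp_loop_end (by rwa [h.stored.insTest_iff h.ready.fair h.head h.count])
        ⟨A, x, y, c, h, ht, ?_, ?_⟩
      · simp only [insTest, lev17, thr17, deg17, Test.cost, IExp.cost, RExp.cost, credit]; omega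
      · simp only [insTest, lev17, thr17, deg17, Test.cost, IExp.cost, RExp.cost]; omega

theorem wp_insert_aux (hB : n * (L + 3) * (n * n) + k + 100 < B) (hk : 2 ≤ k) (hw : ∀ v, 1 ≤ w v)
    (h : Stored k L ε w s A) (hv : Valid G k L w A) (hne : x ≠ y) (hadj : ¬ G.Adj x y)
    (hlev : A.lev y ≤ A.lev x) (h16 : s.ireg 16 = x) (h17 : s.ireg 17 = y) :
    WP B (.seq (.iset 18 (.const 0)) <| .seq (.loop insTest insBody) <|
      .seq (.iset 13 (.var 16)) <| .seq (.iset 14 (.var 17)) <| .seq (.iset 15 lev17) addArc) s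
      fun t s' => ∃ A', Stored k L ε w s' A' ∧ Valid (G ⊔ SimpleGraph.edge x y) k L w A' ∧
        t + 400 * A'.phi L ≤ 400 * A.phi L + 400 * (2 * L + 3) ∧
        t ≤ 400 * (L * (k + 1) + k + 2) := by
  simp only [wp_seq, wp_iset]
  have hk0 : 0 < k := by omega
  refine (wp_insLoop hB hk hw _ _ A x y 0 le_rfl ⟨h.setI (by omega) _, by simp [h16], by simp [h17],
    by simp, hv.insReady hne hadj hlev⟩).mono ?_
  rintro t₁ s₁ ⟨A₁, x₁, y₁, c₁, ⟨hs₁, g16, g17, g18, hr₁⟩, hend, hcr, hme⟩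
  refine (wp_addArc (x := x₁) (y := y₁) (j := A₁.lev y₁) hB
    (((hs₁.setI (by omega) _).setI (by omega) _).setI (by omega) _) hr₁.lab_none
    (by have := hr₁.fair.lev_le y₁; omega) (by simp [g16]) (by simp [g17])
    (by simp [lev17, g17, hs₁.lev])).mono ?_
  rintro t₂ s₂ ⟨ht₂, hs₂, hf₂⟩
  have hl := hv.fair.lev_le y
  refine ⟨_, hs₂, hr₁.finish hk hw hend, ?_, ?_⟩
  · rw [phi_add _ hr₁.lab_none]
    simp only [credit, hk0, if_true] at hcr
    simp only [IExp.cost, lev17]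
    omega
  · simp only [insMeasure, hk0, if_true] at hme
    have := Nat.mul_le_mul_right (k + 1) hl
    simp only [IExp.cost, lev17]
    omega

theorem wp_insertProgram (hB : n * (L + 3) * (n * n) + k + 100 < B) (hk : 2 ≤ k)
    (hw : ∀ v, 1 ≤ w v) (h : Stored k L ε w s A) (hv : Valid G k L w A) (hne : x ≠ y)
    (hadj : ¬ G.Adj x y) (h1 : s.ireg 1 = x) (h2 : s.ireg 2 = y) :
    WP B insertProgram s fun t s' => ∃ A', Stored k L ε w s' A' ∧
        Valid (G ⊔ SimpleGraph.edge x y) k L w A' ∧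
        t + 400 * A'.phi L ≤ 400 * A.phi L + 400 * (2 * L + 4) ∧
        t ≤ 400 * (L * (k + 1) + k + 3) := by
  rw [insertProgram, wp_seq]
  -- A new edge is directed towards the endpoint of smaller level.
  by_cases hlt : A.lev x < A.lev y
  · refine wp_branch_true (by simpa [h1, h2, h.lev] using hlt) ?_
    simp only [wp_seq (q := Program.iset _ _), wp_iset]
    refine (wp_insert_aux (x := y) (y := x) hB hk hw ((h.setI (by omega) _).setI (by omega) _) hv
      hne.symm (fun e => hadj e.symm) hlt.le (by simp [h2]) (by simp [h1])).mono ?_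
    rintro t s' ⟨A', hs', hv', ht, ht'⟩
    refine ⟨A', hs', ?_, by simp; omega, by simp; omega⟩
    rwa [SimpleGraph.edge_comm]
  · refine wp_branch_false (by simpa [h1, h2, h.lev] using hlt) ?_
    simp only [wp_seq (q := Program.iset _ _), wp_iset]
    refine (wp_insert_aux (x := x) (y := y) hB hk hw ((h.setI (by omega) _).setI (by omega) _) hv
      hne hadj (by omega) (by simp [h1]) (by simp [h2])).mono ?_
    rintro t s' ⟨A', hs', hv', ht, ht'⟩
    exact ⟨A', hs', hv', by simp; omega, by simp; omega⟩

end VWDSG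
-- Correctness and cost of deletion.
namespace VWDSG
open RealRAM Conf

variable {n : ℕ} {G : SimpleGraph (Fin n)} {k L B : ℕ} {ε : ℝ} {w : Fin n → ℝ} {s : State}
variable {A : Conf n} {x y z : Fin n} {c j : ℕ}

/-- The state of the loop that moves a missing arc. -/
structure DelState (G : SimpleGraph (Fin n)) (k L : ℕ) (ε : ℝ) (w : Fin n → ℝ) (s : State)
    (A : Conf n) (y : Fin n) (j : ℕ) : Prop where
  stored : Stored k L ε w s A
  head : s.ireg 17 = y
  label : s.ireg 20 = j
  ready : DelReady G k L w A y j

/-- The state of the loop that decreases labels. -/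
structure DownState (G : SimpleGraph (Fin n)) (k L : ℕ) (ε : ℝ) (w : Fin n → ℝ) (s : State)
    (A : Conf n) (y : Fin n) (c : ℕ) : Prop where
  stored : Stored k L ε w s A
  head : s.ireg 17 = y
  count : s.ireg 18 = c
  ready : DownReady G k L w A y c

theorem Stored.delKey (hB : n * (L + 3) * (n * n) + k + 100 < B) (h : Stored k L ε w s A)
    (hl : A.lev y ≤ L) (h17 : s.ireg 17 = y) :
    (keyOf (.add lev17 (.const 2))).eval B s = y * (L + 3) + (A.lev y + 2) := by
  obtain ⟨hy1, hy2, hy3⟩ := key_bound hB y (j := A.lev y + 2) (by omega)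
  have e5 : (y * (L + 3)) % B = y * (L + 3) := Nat.mod_eq_of_lt hy3
  have e6 : (y * (L + 3) + (A.lev y + 2)) % B = y * (L + 3) + (A.lev y + 2) :=
    Nat.mod_eq_of_lt hy2
  have e2 : 2 % B = 2 := Nat.mod_eq_of_lt (by omega)
  have e3 : (A.lev y + 2) % B = A.lev y + 2 := Nat.mod_eq_of_lt (by omega)
  simp [keyOf, lev17, h17, h.keys_eq, h.lev, e2, e3, e5, e6]

/-- An arc labelled `lev y + 2` is replaced by one labelled `j ≥ lev y`, so the potential grows by
at most 2. -/
theorem wp_delBody (hB : n * (L + 3) * (n * n) + k + 100 < B)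
    (h : DelState G k L ε w s A y j) (h0 : s.imem 6 (y * (L + 3) + (A.lev y + 2)) ≠ 0) :
    WP B delBody s fun t s' => t ≤ 300 ∧ ∃ A' z j', DelState G k L ε w s' A' z j' ∧
      A'.phi L ≤ A.phi L + 2 ∧ A.lev y + 1 ≤ A'.lev z := by
  obtain ⟨hs, h17, h20, hr⟩ := h
  have hl := hr.fair.lev_le y
  obtain ⟨hy1, hy2, hy3⟩ := key_bound hB y (j := A.lev y + 2) (by omega)
  have e1 : 1 % B = 1 := Nat.mod_eq_of_lt (by omega)
  have hs' := hs.setI (r := 21) (by omega) (y * (L + 3) + (A.lev y + 2))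
  obtain ⟨z, hz, he⟩ := hs.exists_out hr.fair (by omega) h0
  have hcnt : s.imem 6 (y * (L + 3) + (A.lev y + 2)) ≤ n * n :=
    hs.outs.cnt_le pairCode_injective card_pair _
  have e7 : ((y * (L + 3) + (A.lev y + 2)) * (n * n)) % B =
      (y * (L + 3) + (A.lev y + 2)) * (n * n) := Nat.mod_eq_of_lt (by omega)
  have e8 : ((y * (L + 3) + (A.lev y + 2)) * (n * n) +
      (s.imem 6 (y * (L + 3) + (A.lev y + 2)) - 1)) % B =
      (y * (L + 3) + (A.lev y + 2)) * (n * n) + (s.imem 6 (y * (L + 3) + (A.lev y + 2)) - 1) :=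
    Nat.mod_eq_of_lt (by omega)
  have hzv : (IExp.mod (lastOf 6) (.var 0)).eval B
      (s.setI 21 (y * (L + 3) + (A.lev y + 2))) = z := by
    simp [lastOf, hs.items_eq, e1, e7, e8, he, hs.n_eq, pairCode_mod]
  simp only [delBody, wp_seq, wp_iset, hs.delKey hB hl h17, hzv]
  have hs'' := hs'.setI (r := 19) (by omega) z
  have hlz := hr.fair.lab_lev _ _ _ hz
  obtain ⟨hzy, hne⟩ := hr.lab_symm_none hz
  have hzy' : (A.remove y z).lab (z, y) = none := by simp [remove_lab, hzy]
  have hll := hr.fair.lab_le _ _ _ hz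
  have hjl := hr.label_le
  have hj := hr.label
  refine (wp_removeArc (x := y) (y := z) hB ((hs''.setI (by omega) _).setI (by omega) _) hz
    (by omega) (by simp [h17]) (by simp)).mono ?_
  rintro t₁ s₁ ⟨ht₁, hs₁, h15, hf₁⟩
  have g17 : s₁.ireg 17 = y := by simp [hf₁, h17]
  have g19 : s₁.ireg 19 = z := by simp [hf₁]
  have g20 : s₁.ireg 20 = j := by simp [hf₁, h20]
  have hs₁' := hs₁.setI (r := 22) (by omega) (A.lev y + 2)
  simp only [IExp.eval, h15]
  refine (wp_addArc (x := z) (y := y) (j := j) hB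
    (((hs₁'.setI (by omega) _).setI (by omega) _).setI (by omega) _) hzy' (by omega)
    (by simp [g19]) (by simp [g17]) (by simp [g20])).mono ?_
  rintro t₂ s₂ ⟨ht₂, hs₂, hf₂⟩
  refine ⟨by simp [keyOf, lev17, lastOf]; omega, _, z, A.lev y + 2,
    ⟨(hs₂.setI (by omega) _).setI (by omega) _, ?_, ?_, hr.flip hz⟩, ?_, ?_⟩
  · simp [hf₂, g19]
  · simp [hf₂]
  · rw [phi_add _ hzy', ← phi_remove L hz]
    omega
  · simp only [add_lev, remove_lev]; omega

/-- The level of the head grows in every iteration. At level `L` there is no arc with label `L + 2`,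
so the loop ends there at the latest. -/
theorem wp_delLoop (hB : n * (L + 3) * (n * n) + k + 100 < B) (hk : 2 ≤ k) (hw : ∀ v, 1 ≤ w v)
    (m : ℕ) : ∀ (s : State) (A : Conf n) (y : Fin n) (j : ℕ), L ≤ A.lev y + m →
    DelState G k L ε w s A y j →
    WP B (.loop delTest delBody) s fun t s' => ∃ (A' : Conf n) (y' : Fin n), Stored k L ε w s' A' ∧ s'.ireg 17 = y' ∧
      DownReady G k L w A' y' 0 ∧ A'.phi L ≤ A.phi L + 2 * m ∧ t ≤ 400 * (m + 1) := by
  induction m with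
  | zero =>
    intro s A y j hm h
    have hl := h.ready.fair.lev_le y
    have h0 : s.imem 6 (y * (L + 3) + (A.lev y + 2)) = 0 := by
      by_contra hcon
      obtain ⟨z, hz, -⟩ := h.stored.exists_out h.ready.fair (by omega) hcon
      have := h.ready.fair.lab_le _ _ _ hz
      omega
    refine wp_loop_end ?_ ⟨A, y, h.stored, h.head,
      h.ready.finish hk hw (h.stored.no_out h0), by omega, ?_⟩
    · simp [delTest, h.stored.delKey hB hl h.head, h0]
    · simp [delTest, keyOf, lev17]
  | succ m ih =>
    intro s A y j hm h
    have hl := h.ready.fair.lev_le y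
    by_cases h0 : s.imem 6 (y * (L + 3) + (A.lev y + 2)) = 0
    · refine wp_loop_end ?_ ⟨A, y, h.stored, h.head,
        h.ready.finish hk hw (h.stored.no_out h0), by omega, ?_⟩
      · simp [delTest, h.stored.delKey hB hl h.head, h0]
      · simp [delTest, keyOf, lev17]; omega
    · refine wp_loop_step ?_ ?_
      · simp [delTest, h.stored.delKey hB hl h.head]; omega
      refine (wp_delBody hB h h0).mono ?_
      rintro t₁ s₁ ⟨ht₁, A₁, y₁, j₁, h₁, hphi, hlev⟩
      refine (ih s₁ A₁ y₁ j₁ (by omega) h₁).mono ?_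
      rintro t₂ s₂ ⟨A₂, y₂, hs₂, h17, h₂, hphi₂, ht₂⟩
      refine ⟨A₂, y₂, hs₂, h17, h₂, by omega, ?_⟩
      simp only [delTest, keyOf, lev17, Test.cost, IExp.cost]; omega

theorem wp_downBody (hB : n * (L + 3) * (n * n) + k + 100 < B) (hk : 2 ≤ k) (hw : ∀ v, 1 ≤ w v)
    (h : DownState G k L ε w s A y c)
    (ht : c < k ∧ A.deg y < w y * theta k (A.lev y)) :
    WP B downBody s fun t s' => t ≤ 300 ∧ ∃ A' c', DownState G k L ε w s' A' y c' ∧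
      A'.phi L ≤ A.phi L + 1 ∧ c + 1 ≤ c' := by
  obtain ⟨hs, h17, h18, hr⟩ := h
  obtain ⟨hc, hd⟩ := ht
  have hl := hr.fair.lev_le y
  have hpos := lev_pos_of_deg_lt hd
  obtain ⟨hy1, hy2, hy3⟩ := key_bound hB y (j := A.lev y + 1) (by omega)
  have e5 : (y * (L + 3)) % B = y * (L + 3) := Nat.mod_eq_of_lt hy3
  have e6 : (y * (L + 3) + (A.lev y + 1)) % B = y * (L + 3) + (A.lev y + 1) :=
    Nat.mod_eq_of_lt hy2
  have e1 : 1 % B = 1 := Nat.mod_eq_of_lt (by omega)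
  have e10 : (A.lev y + 1) % B = A.lev y + 1 := Nat.mod_eq_of_lt (by omega)
  have e11 : (c + 1) % B = c + 1 := Nat.mod_eq_of_lt (by omega)
  have hkey : (keyOf (.add lev17 (.const 1))).eval B s = y * (L + 3) + (A.lev y + 1) := by
    simp [keyOf, lev17, h17, hs.keys_eq, hs.lev, e1, e10, e5, e6]
  have hs' := hs.setI (r := 21) (by omega) (y * (L + 3) + (A.lev y + 1))
  simp only [downBody, wp_seq, wp_iset, hkey]
  by_cases h0 : s.imem 3 (y * (L + 3) + (A.lev y + 1)) = 0
  · refine wp_branch_true (by simp [h0]) ?_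
    rw [wp_seq]
    refine (wp_lowerLevel hB hs' hl hpos (by simp [h17])).mono ?_
    rintro t₁ s₁ ⟨ht₁, hs₁, hf₁⟩
    rw [wp_iset]
    refine ⟨by simp [keyOf, lev17]; omega, A.setLev y (A.lev y - 1), k,
      ⟨hs₁.setI (by omega) _, ?_, ?_, hr.lower hk hw hc hd (hs.num_eq_zero h0)⟩, ?_, by omega⟩
    · simp [hf₁, h17]
    · simp [hf₁, hs.k_eq]
    · simp
  · refine wp_branch_false (by simp [h0]) ?_
    obtain ⟨z, hz, he⟩ := hs.exists_in hr.fair (by omega) h0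
    have hcnt : s.imem 3 (y * (L + 3) + (A.lev y + 1)) ≤ n * n :=
      hs.ins.cnt_le pairCode_injective card_pair _
    have e7 : ((y * (L + 3) + (A.lev y + 1)) * (n * n)) % B =
        (y * (L + 3) + (A.lev y + 1)) * (n * n) := Nat.mod_eq_of_lt (by omega)
    have e8 : ((y * (L + 3) + (A.lev y + 1)) * (n * n) +
        (s.imem 3 (y * (L + 3) + (A.lev y + 1)) - 1)) % B =
        (y * (L + 3) + (A.lev y + 1)) * (n * n) +
          (s.imem 3 (y * (L + 3) + (A.lev y + 1)) - 1) := Nat.mod_eq_of_lt (by omega)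
    have hzv : (IExp.div (lastOf 3) (.var 0)).eval B
        (s.setI 21 (y * (L + 3) + (A.lev y + 1))) = z := by
      simp [lastOf, hs.items_eq, e1, e7, e8, he, hs.n_eq, pairCode_div]
    simp only [downVisit, wp_seq, wp_iset, hzv]
    have hs'' := hs'.setI (r := 19) (by omega) z
    refine (wp_removeArc (x := z) (y := y) hB ((hs''.setI (by omega) _).setI (by omega) _) hz
      (by omega) (by simp) (by simp [h17])).mono ?_
    rintro t₁ s₁ ⟨ht₁, hs₁, h15, hf₁⟩
    have g17 : s₁.ireg 17 = y := by simp [hf₁, h17]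
    have g18 : s₁.ireg 18 = c := by simp [hf₁, h18]
    have g13 : s₁.ireg 13 = z := by simp [hf₁]
    have g14 : s₁.ireg 14 = y := by simp [hf₁, h17]
    refine (wp_addArc (x := z) (y := y) (j := A.lev y) hB (hs₁.setI (by omega) _)
      (remove_lab_self z y) (by omega) (by simp [g13]) (by simp [g14])
      (by simp [h15, e1])).mono ?_
    rintro t₂ s₂ ⟨ht₂, hs₂, hf₂⟩
    refine ⟨by simp [keyOf, lev17, lastOf]; omega, _, c + 1,
      ⟨hs₂.setI (by omega) _, ?_, ?_, hr.relabel hc hd hz⟩, ?_, le_rfl⟩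
    · simp [hf₂, g17]
    · simp [hf₂, g18, e1, e11]
    · rw [phi_add _ (remove_lab_self z y), ← phi_remove L hz]; omega

/-- The counter reaches `k` after at most `k` iterations, each of which increases the potential by
at most 1. -/
theorem wp_downLoop (hB : n * (L + 3) * (n * n) + k + 100 < B) (hk : 2 ≤ k) (hw : ∀ v, 1 ≤ w v)
    (m : ℕ) : ∀ (s : State) (A : Conf n) (y : Fin n) (c : ℕ), k ≤ c + m →
    DownState G k L ε w s A y c →
    WP B (.loop downTest downBody) s fun t s' => ∃ A', Stored k L ε w s' A' ∧
      Valid G k L w A' ∧ A'.phi L ≤ A.phi L + m ∧ t ≤ 400 * (m + 1) := by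
  induction m with
  | zero =>
    intro s A y c hm h
    have ht : ¬ (c < k ∧ A.deg y < w y * theta k (A.lev y)) := fun h => by omega
    refine wp_loop_end (by rwa [h.stored.downTest_iff h.ready.fair h.head h.count])
      ⟨A, h.stored, h.ready.finish ht, by omega, ?_⟩
    simp [downTest, deg17, thr17, lev17]
  | succ m ih =>
    intro s A y c hm h
    by_cases ht : c < k ∧ A.deg y < w y * theta k (A.lev y)
    · refine wp_loop_step (by rwa [h.stored.downTest_iff h.ready.fair h.head h.count]) ?_
      refine (wp_downBody hB hk hw h ht).mono ?_
      rintro t₁ s₁ ⟨ht₁, A₁, c₁, h₁, hphi, hc₁⟩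
      refine (ih s₁ A₁ y c₁ (by omega) h₁).mono ?_
      rintro t₂ s₂ ⟨A₂, hs₂, h₂, hphi₂, ht₂⟩
      refine ⟨A₂, hs₂, h₂, by omega, ?_⟩
      simp only [downTest, deg17, thr17, lev17, Test.cost, IExp.cost, RExp.cost]; omega
    · refine wp_loop_end (by rwa [h.stored.downTest_iff h.ready.fair h.head h.count])
        ⟨A, h.stored, h.ready.finish ht, by omega, ?_⟩
      simp [downTest, deg17, thr17, lev17]; omega

theorem wp_delete_aux (hB : n * (L + 3) * (n * n) + k + 100 < B) (hk : 2 ≤ k) (hw : ∀ v, 1 ≤ w v)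
    (h : Stored k L ε w s A) (hv : Valid G k L w A) (hxy : (A.lab (x, y)).isSome)
    (h16 : s.ireg 16 = x) (h17 : s.ireg 17 = y) :
    WP B (.seq (.iset 13 (.var 16)) <| .seq (.iset 14 (.var 17)) <| .seq removeArc <|
      .seq (.iset 20 (.var 15)) <| .seq (.loop delTest delBody) <|
      .seq (.iset 18 (.const 0)) (.loop downTest downBody)) s
      fun t s' => ∃ A', Stored k L ε w s' A' ∧ Valid (G.deleteEdges {s(x, y)}) k L w A' ∧
        A'.phi L ≤ A.phi L + 2 * L + k ∧ t ≤ 400 * (L + k + 3) := by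
  obtain ⟨j, hj⟩ := Option.isSome_iff_exists.1 hxy
  have hjL := hv.fair.lab_le _ _ _ hj
  simp only [wp_seq, wp_iset]
  refine (wp_removeArc (x := x) (y := y) hB ((h.setI (by omega) _).setI (by omega) _) hj
    (by omega) (by simp [h16]) (by simp [h17])).mono ?_
  rintro t₁ s₁ ⟨ht₁, hs₁, h15, hf₁⟩
  have hphi := phi_remove L hj
  refine (wp_delLoop hB hk hw L _ (A.remove x y) y j (by omega) ⟨hs₁.setI (by omega) _,
    by simp [hf₁, h17], by simp [h15], hv.delReady hj⟩).mono ?_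
  rintro t₂ s₂ ⟨A₂, y₂, hs₂, g17, h₂, hphi₂, ht₂⟩
  refine (wp_downLoop hB hk hw k _ A₂ y₂ 0 (by omega) ⟨hs₂.setI (by omega) _,
    by simp [g17], by simp, h₂⟩).mono ?_
  rintro t₃ s₃ ⟨A₃, hs₃, h₃, hphi₃, ht₃⟩
  exact ⟨A₃, hs₃, h₃, by omega, by simp; omega⟩

theorem wp_deleteProgram (hB : n * (L + 3) * (n * n) + k + 100 < B) (hk : 2 ≤ k)
    (hw : ∀ v, 1 ≤ w v) (h : Stored k L ε w s A) (hv : Valid G k L w A)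
    (hadj : G.Adj x y) (h1 : s.ireg 1 = x) (h2 : s.ireg 2 = y) :
    WP B deleteProgram s fun t s' => ∃ A', Stored k L ε w s' A' ∧
        Valid (G.deleteEdges {s(x, y)}) k L w A' ∧
        A'.phi L ≤ A.phi L + 2 * L + k ∧ t ≤ 400 * (L + k + 4) := by
  have hn := small_bound hB
  have hp := pairCode_lt (x, y)
  have e1 : 1 % B = 1 := Nat.mod_eq_of_lt (by omega)
  have hp' : (x : ℕ) * n + y = pairCode (x, y) := rfl
  have e2 : (x * n) % B = x * n := Nat.mod_eq_of_lt (by omega)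
  have e3 : pairCode (x, y) % B = pairCode (x, y) := Nat.mod_eq_of_lt (by omega)
  have harc := h.arc (x, y)
  rw [deleteProgram, wp_seq]
  by_cases hlt : (A.lab (x, y)).isSome
  · rw [if_pos hlt] at harc
    refine wp_branch_true (by simp [h1, h2, h.n_eq, e1, e2, hp', e3, harc]) ?_
    simp only [wp_seq (q := Program.iset _ _), wp_iset]
    refine (wp_delete_aux (x := x) (y := y) hB hk hw ((h.setI (by omega) _).setI (by omega) _) hv
      hlt (by simp [h1]) (by simp [h2])).mono ?_
    rintro t s' ⟨A', hs', hv', ht, ht'⟩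
    exact ⟨A', hs', hv', ht, by simp; omega⟩
  · rw [if_neg hlt] at harc
    refine wp_branch_false (by simp [h1, h2, h.n_eq, e1, e2, hp', e3, harc]) ?_
    simp only [wp_seq (q := Program.iset _ _), wp_iset]
    refine (wp_delete_aux (x := y) (y := x) hB hk hw ((h.setI (by omega) _).setI (by omega) _) hv
      (((hv.orients.adj x y).1 hadj).resolve_left hlt) (by simp [h2]) (by simp [h1])).mono ?_
    rintro t s' ⟨A', hs', hv', ht, ht'⟩
    refine ⟨A', hs', ?_, ht, by simp; omega⟩
    rwa [Sym2.eq_swap]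

end VWDSG
-- Linear programming duality, load bounds and cuts.
namespace VWDSG
open RealRAM Conf

variable {n : ℕ} {G : SimpleGraph (Fin n)} {k L : ℕ} {w : Fin n → ℝ} {A : Conf n}

namespace Conf

/-- The set of arcs. -/
def arcs (A : Conf n) : Finset (Fin n × Fin n) := Finset.univ.filter fun p => (A.lab p).isSome

theorem mem_arcs {p : Fin n × Fin n} : p ∈ A.arcs ↔ (A.lab p).isSome := by simp [arcs]

theorem Orients.injOn (h : A.Orients G) :
    Set.InjOn (fun p : Fin n × Fin n => s(p.1, p.2)) A.arcs := by
  rintro ⟨u, v⟩ hp ⟨u', v'⟩ hp' he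
  simp only [Finset.mem_coe, mem_arcs] at hp hp'
  simp only [Sym2.eq_iff] at he
  rcases he with ⟨rfl, rfl⟩ | ⟨rfl, rfl⟩
  · rfl
  · simp [h.asymm _ _ hp] at hp'

open Classical in
theorem Orients.edgeFinset (h : A.Orients G) :
    G.edgeFinset = A.arcs.image fun p => s(p.1, p.2) := by
  ext e
  induction e using Sym2.ind with
  | _ u v =>
    simp only [SimpleGraph.mem_edgeFinset, SimpleGraph.mem_edgeSet, h.adj, Finset.mem_image,
      mem_arcs, Prod.exists, Sym2.eq_iff]
    constructor
    · rintro (h1 | h1)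
      · exact ⟨u, v, h1, .inl ⟨rfl, rfl⟩⟩
      · exact ⟨v, u, h1, .inr ⟨rfl, rfl⟩⟩
    · rintro ⟨a, b, h1, ⟨rfl, rfl⟩ | ⟨rfl, rfl⟩⟩
      · exact .inl h1
      · exact .inr h1

theorem sum_arcs (f : Fin n → ℝ) : ∑ p ∈ A.arcs, f p.2 = ∑ v, A.deg v * f v := by
  rw [arcs, Finset.sum_filter, Fintype.sum_prod_type_right]
  refine Finset.sum_congr rfl fun v _ => ?_
  rw [← Finset.sum_filter]
  simp [deg]

end Conf

/-- Weak duality: an orientation is a dual solution. The term of each edge is bounded by the value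
at its head, and each vertex then pays its in-degree. -/
theorem lpObjective_le (h : A.Orients G) {X : ℝ} (hX : ∀ v, A.deg v ≤ w v * X)
    {x : Fin n → ℝ} (hx : ∀ v, 0 ≤ x v) (hx1 : ∑ v, w v * x v ≤ 1) (hX0 : 0 ≤ X) :
    lpObjective G x ≤ X := by
  classical
  have h1 : lpObjective G x = ∑ p ∈ A.arcs, min (x p.1) (x p.2) := by
    have : lpObjective G x = ∑ e ∈ G.edgeFinset, (e.map x).inf := by
      unfold lpObjective; congr!
    rw [this, h.edgeFinset, Finset.sum_image h.injOn]
    rfl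
  rw [h1]
  calc ∑ p ∈ A.arcs, min (x p.1) (x p.2) ≤ ∑ p ∈ A.arcs, x p.2 :=
        Finset.sum_le_sum fun p _ => min_le_right _ _
    _ = ∑ v, A.deg v * x v := sum_arcs x
    _ ≤ ∑ v, X * (w v * x v) := Finset.sum_le_sum fun v _ => by
        have := mul_le_mul_of_nonneg_right (hX v) (hx v)
        linarith
    _ = X * ∑ v, w v * x v := by rw [Finset.mul_sum]
    _ ≤ X := by nlinarith

theorem optLP_le (h : A.Orients G) {X : ℝ} (hX : ∀ v, A.deg v ≤ w v * X) (hX0 : 0 ≤ X) :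
    optLP G w ≤ X := by
  refine csSup_le ⟨lpObjective G 0, 0, by simp, by simp, rfl⟩ ?_
  rintro r ⟨x, hx, hx1, rfl⟩
  exact lpObjective_le h hX hx hx1 hX0

/-- The indicator of `S` divided by its weight is feasible, and its objective is the density. -/
theorem density_le_optLP (h : A.Orients G) (hw : ∀ v, 1 ≤ w v) {S : Finset (Fin n)}
    (hS : S.Nonempty) : density G w S ≤ optLP G w := by
  classical
  have hW : 0 < ∑ v ∈ S, w v := Finset.sum_pos (fun v _ => by linarith [hw v]) hS
  -- In-degrees are at most `n` and weights at least 1, so `n` bounds the objective and the supremum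
  -- is a genuine one.
  refine le_csSup ⟨n, ?_⟩ ⟨fun v => if v ∈ S then (∑ v ∈ S, w v)⁻¹ else 0, ?_, ?_, ?_⟩
  · rintro r ⟨x, hx, hx1, rfl⟩
    refine lpObjective_le h (X := n) (fun v => ?_) hx hx1 (by positivity)
    have h1 : (A.deg v : ℝ) ≤ n := by exact_mod_cast A.deg_le v
    have h2 : (0 : ℝ) ≤ n := by positivity
    nlinarith [hw v]
  · intro v
    dsimp only
    split_ifs
    · positivity
    · exact le_rfl
  · simp only [mul_ite, mul_zero, Finset.sum_ite_mem, Finset.univ_inter, ← Finset.sum_mul]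
    exact (mul_inv_cancel₀ hW.ne').le
  · have h1 : {e ∈ G.edgeSet | ∀ v ∈ e, v ∈ S} =
        ((G.edgeFinset.filter fun e => ∀ v ∈ e, v ∈ S : Finset (Sym2 (Fin n))) :
          Set (Sym2 (Fin n))) := by
      ext e; simp
    rw [density, h1, Set.ncard_coe_finset, div_eq_mul_inv, lpObjective]
    trans ∑ e ∈ G.edgeFinset, if ∀ v ∈ e, v ∈ S then (∑ v ∈ S, w v)⁻¹ else 0
    · rw [← Finset.sum_filter, Finset.sum_const, nsmul_eq_mul]
    · have : ∀ e : Sym2 (Fin n), (if ∀ v ∈ e, v ∈ S then (∑ v ∈ S, w v)⁻¹ else 0) =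
          (e.map fun v => if v ∈ S then (∑ v ∈ S, w v)⁻¹ else 0).inf := by
        intro e
        induction e using Sym2.ind with
        | _ u v =>
          have h0 : 0 ≤ (∑ v ∈ S, w v)⁻¹ := by positivity
          rw [Sym2.map_mk, Sym2.inf_mk]
          by_cases hu : u ∈ S <;> by_cases hv : v ∈ S <;> simp [hu, hv, h0]
      simp only [this]

section Theta

theorem theta_mono (k : ℕ) : Monotone (theta k) := by
  refine monotone_nat_of_le_succ fun i => ?_
  rw [theta_succ]
  have h1 := theta_nonneg k i
  have : 0 ≤ theta k i * (2 / k : ℝ) := by positivity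
  linarith

/-- Separates the multiplicative and additive errors incurred in climbing `d` levels. -/
theorem theta_add_le (k i d : ℕ) :
    theta k (i + d) ≤ (1 + 2 / k : ℝ) ^ d * (theta k i + 2 * d) := by
  induction d with
  | zero => simp
  | succ d ih =>
    have h0 : (1 : ℝ) ≤ (1 + 2 / k : ℝ) := by
      have : (0 : ℝ) ≤ 2 / k := by positivity
      linarith
    have h1 : (1 : ℝ) ≤ (1 + 2 / k : ℝ) ^ (d + 1) := one_le_pow₀ h0
    rw [← add_assoc, theta_succ]
    calc _ ≤ (1 + 2 / k : ℝ) ^ d * (theta k i + 2 * d) * (1 + 2 / k) +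
          (1 + 2 / k : ℝ) ^ (d + 1) * 2 := by
          have := mul_le_mul_of_nonneg_right ih (by linarith : (0 : ℝ) ≤ 1 + 2 / k)
          linarith
      _ = _ := by push_cast; ring

theorem theta_eq (hk : 0 < k) (i : ℕ) : theta k i = k * ((1 + 2 / k : ℝ) ^ i - 1) := by
  induction i with
  | zero => simp [theta]
  | succ i ih =>
    have : (k : ℝ) ≠ 0 := by positivity
    rw [theta_succ, ih, pow_succ]
    field_simp
    ring

end Theta

/-- Beyond the next threshold the right-hand side of `Band.up` would be negative. At level `L` there
is no such bound. -/
theorem Valid.deg_le (h : Valid G k L w A) (hk : 2 ≤ k) {v : Fin n} (hL : A.lev v < L) :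
    A.deg v ≤ w v * theta k (A.lev v + 1) := by
  have hw' : (2 : ℝ) ≤ k := by exact_mod_cast hk
  have h3 : (A.deg v : ℝ) = A.lo v + A.hi v := by exact_mod_cast h.fair.deg_eq v
  by_contra hcon
  push Not at hcon
  by_cases hd : w v * theta k (A.lev v) ≤ A.deg v
  · have := (h.band v).up hL (by linarith)
    have h0 : (0 : ℝ) ≤ A.lo v := by positivity
    have : (k - 1 : ℝ) * (w v * theta k (A.lev v + 1) - (A.lo v + A.hi v)) < 0 :=
      mul_neg_of_pos_of_neg (by linarith) (by linarith)
    linarith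
  · push Not at hd
    have h1 := theta_mono k (Nat.le_succ (A.lev v))
    have h2 := theta_nonneg k (A.lev v)
    have h4 := theta_nonneg k (A.lev v + 1)
    have h5 : (0 : ℝ) ≤ A.deg v := by positivity
    have : 0 ≤ w v := by
      by_contra hw
      push Not at hw
      nlinarith
    have := mul_le_mul_of_nonneg_left h1 this
    simp only [Nat.succ_eq_add_one] at this
    linarith

theorem Valid.le_deg (h : Valid G k L w A) (hk : 2 ≤ k) (hw : ∀ v, 1 ≤ w v) {v : Fin n}
    (hL : 1 ≤ A.lev v) : w v * theta k (A.lev v - 1) ≤ A.deg v := by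
  have hw' : (2 : ℝ) ≤ k := by exact_mod_cast hk
  have h3 : (A.deg v : ℝ) = A.lo v + A.hi v := by exact_mod_cast h.fair.deg_eq v
  by_cases hd : w v * theta k (A.lev v) ≤ A.deg v
  · have h1 := theta_mono k (Nat.sub_le (A.lev v) 1)
    have := mul_le_mul_of_nonneg_left h1 (by linarith [hw v] : 0 ≤ w v)
    linarith
  · push Not at hd
    have := (h.band v).down hL (by linarith)
    have h0 : (0 : ℝ) ≤ A.hi v := by positivity
    by_contra hcon
    push Not at hcon
    have : (k : ℝ) * (A.lo v + A.hi v - w v * theta k (A.lev v - 1)) < 0 :=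
      mul_neg_of_pos_of_neg (by linarith) (by linarith)
    linarith

/-- The set of vertices of level at least `i`. -/
def upSet (A : Conf n) (i : ℕ) : Finset (Fin n) := Finset.univ.filter fun v => i ≤ A.lev v

theorem mem_upSet {i : ℕ} {v : Fin n} : v ∈ upSet A i ↔ i ≤ A.lev v := by simp [upSet]

/-- The weight of the set of vertices of level at least `i`. -/
noncomputable def upWeight (w : Fin n → ℝ) (A : Conf n) (i : ℕ) : ℝ := ∑ v ∈ upSet A i, w v

/-- Level `i` is the first level below the top level `M` where the weights grow slowly. -/
structure IsCut (ε : ℝ) (w : Fin n → ℝ) (A : Conf n) (M i : ℕ) : Prop where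
  le : i ≤ M
  le_top : ∀ v, A.lev v ≤ M
  top : ∃ v, A.lev v = M
  -- Levels `j` and `j + 2` are compared because an arc may climb two levels.
  grow : ∀ j, i < j → j ≤ M → (1 + ε / 4) * upWeight w A (j + 2) < upWeight w A j
  halts : i = 0 ∨ upWeight w A i ≤ (1 + ε / 4) * upWeight w A (i + 2)

variable {ε : ℝ} {M i : ℕ}

theorem upSet_anti {i j : ℕ} (h : i ≤ j) : upSet A j ⊆ upSet A i := by
  intro v hv
  rw [mem_upSet] at hv ⊢
  omega

theorem IsCut.nonempty (h : IsCut ε w A M i) : (upSet A i).Nonempty := by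
  obtain ⟨v, hv⟩ := h.top
  exact ⟨v, by rw [mem_upSet, hv]; exact h.le⟩

theorem IsCut.card_lt (h : IsCut ε w A M i) (hw : ∀ v, 1 ≤ w v) (hε : 0 < ε) {j : ℕ}
    (hij : i < j) (hj : j ≤ M) : (upSet A (j + 2)).card < (upSet A j).card := by
  refine Finset.card_lt_card ⟨upSet_anti (by omega), fun hcon => ?_⟩
  have h1 := h.grow j hij hj
  have h2 : upWeight w A j ≤ upWeight w A (j + 2) :=
    Finset.sum_le_sum_of_subset_of_nonneg hcon fun v _ _ => by linarith [hw v]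
  have h3 : 0 ≤ upWeight w A (j + 2) := Finset.sum_nonneg fun v _ => by linarith [hw v]
  nlinarith

/-- Bounds the levels traversed, including empty ones, by the size of the output. Above the cut the
sizes of the upper sets strictly decrease every two levels, separately in each parity class. -/
theorem IsCut.depth_le (h : IsCut ε w A M i) (hw : ∀ v, 1 ≤ w v) (hε : 0 < ε) :
    M - i ≤ 2 * (upSet A i).card := by
  have key : ∀ d, ∀ j, j + d = M → i < j →
      d + 1 ≤ (upSet A j).card + (upSet A (j + 1)).card := by
    intro d
    induction d with
    | zero =>
      intro j hj hij
      have := h.card_lt hw hε hij (by omega)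
      omega
    | succ d ih =>
      intro j hj hij
      have h1 := h.card_lt hw hε hij (by omega)
      have h2 := ih (j + 1) (by omega) (by omega)
      have : j + 1 + 1 = j + 2 := rfl
      rw [this] at h2
      omega
  by_cases hi : M = i
  · omega
  · have := h.le
    have h1 := key (M - (i + 1)) (i + 1) (by omega) (by omega)
    have h2 := Finset.card_le_card (upSet_anti (A := A) (show i ≤ i + 1 by omega))
    have h3 := Finset.card_le_card (upSet_anti (A := A) (show i ≤ i + 1 + 1 by omega))
    omega

/-- An arc into a vertex of level at least `i + 2` has a label at least `i + 2`, hence a tail of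
level at least `i`, and its edge lies inside `upSet A i`. The heads supply the claimed number of
such arcs by `Valid.le_deg`. -/
theorem Valid.density_ge (h : Valid G k L w A) (hk : 2 ≤ k) (hw : ∀ v, 1 ≤ w v) (i : ℕ) :
    theta k (i + 1) * upWeight w A (i + 2) ≤ density G w (upSet A i) * upWeight w A i := by
  classical
  rcases (upSet A i).eq_empty_or_nonempty with he | hne
  · have : upSet A (i + 2) = ∅ := by
      rw [← Finset.subset_empty, ← he]
      exact upSet_anti (by omega)
    simp [upWeight, he, this]
  have hW : 0 < upWeight w A i := Finset.sum_pos (fun v _ => by linarith [hw v]) hne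
  have e1 : density G w (upSet A i) * upWeight w A i =
      ({e ∈ G.edgeSet | ∀ v ∈ e, v ∈ upSet A i}.ncard : ℝ) := by
    rw [density]
    exact div_mul_cancel₀ _ hW.ne'
  rw [e1]
  let F := (A.arcs.filter fun p => p.2 ∈ upSet A (i + 2))
  have hF : F.card ≤ {e ∈ G.edgeSet | ∀ v ∈ e, v ∈ upSet A i}.ncard := by
    have hinj : Set.InjOn (fun p : Fin n × Fin n => s(p.1, p.2)) F :=
      h.orients.injOn.mono fun p hp => Finset.mem_of_mem_filter p hp
    rw [← Finset.card_image_of_injOn hinj, ← Set.ncard_coe_finset]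
    refine Set.ncard_le_ncard ?_ (Set.toFinite _)
    intro e he
    simp only [Finset.coe_image, Set.mem_image, Finset.mem_coe, F, Finset.mem_filter, mem_arcs,
      mem_upSet] at he
    obtain ⟨⟨u, v⟩, ⟨h1, h2⟩, rfl⟩ := he
    obtain ⟨j, hj⟩ := Option.isSome_iff_exists.1 h1
    have h3 := h.fair.fair _ _ _ hj
    have h4 := h.fair.lab_lev _ _ _ hj
    simp only [Set.mem_ofPred_eq, SimpleGraph.mem_edgeSet, h.orients.adj, h1, true_or, true_and,
      Sym2.mem_iff, forall_eq_or_imp, forall_eq, mem_upSet]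
    simp only at h2
    omega
  have hF' : (F.card : ℝ) = ∑ v ∈ upSet A (i + 2), (A.deg v : ℝ) := by
    have : (F.card : ℝ) = ∑ p ∈ A.arcs, if p.2 ∈ upSet A (i + 2) then 1 else 0 := by
      simp [F]
    rw [this, sum_arcs fun v => if v ∈ upSet A (i + 2) then (1 : ℝ) else 0]
    simp
  have : ∑ v ∈ upSet A (i + 2), w v * theta k (i + 1) ≤ ∑ v ∈ upSet A (i + 2), (A.deg v : ℝ) := by
    refine Finset.sum_le_sum fun v hv => ?_
    rw [mem_upSet] at hv
    refine le_trans ?_ (h.le_deg hk hw (by omega))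
    exact mul_le_mul_of_nonneg_left (theta_mono k (by omega)) (by linarith [hw v])
  rw [← Finset.sum_mul] at this
  calc _ = upWeight w A (i + 2) * theta k (i + 1) := mul_comm _ _
    _ ≤ F.card := by rw [hF']; exact this
    _ ≤ _ := by exact_mod_cast hF

/-- The top level has weight at least 1, every two levels down multiply by `1 + ε / 4`, and the
total weight is at most `n * W`. -/
theorem IsCut.pow_le (h : IsCut ε w A M i) (hw : ∀ v, 1 ≤ w v) (hε : 0 < ε) {W : ℝ}
    (hW : ∀ v, w v ≤ W) (d : ℕ) (hd : i + 2 * d < M) : (1 + ε / 4) ^ d ≤ n * W := by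
  have key : ∀ e ≤ d, (1 + ε / 4) ^ e ≤ upWeight w A (M - 2 * e) := by
    intro e
    induction e with
    | zero =>
      intro _
      obtain ⟨v, hv⟩ := h.top
      simp only [pow_zero, mul_zero, Nat.sub_zero]
      exact (hw v).trans (Finset.single_le_sum (f := w) (fun v _ => by linarith [hw v])
        (by rw [mem_upSet, hv]))
    | succ e ih =>
      intro he
      have h1 := h.grow (M - 2 * (e + 1)) (by omega) (by omega)
      have e1 : M - 2 * (e + 1) + 2 = M - 2 * e := by omega
      rw [e1] at h1
      have h2 := mul_le_mul_of_nonneg_left (ih (by omega)) (by linarith : 0 ≤ 1 + ε / 4)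
      rw [pow_succ, mul_comm]
      linarith
  refine (key d le_rfl).trans ?_
  calc upWeight w A (M - 2 * d) ≤ ∑ v, w v :=
        Finset.sum_le_sum_of_subset_of_nonneg (Finset.subset_univ _)
          fun v _ _ => by linarith [hw v]
    _ ≤ ∑ _v : Fin n, W := Finset.sum_le_sum fun v _ => hW v
    _ = n * W := by simp

end VWDSG
-- The query program.
namespace VWDSG
open RealRAM Conf

def queryTest : Test := .ieq (.var 23) (.const 0)

def queryList : Program :=
  .seq (.iset 24 (.read 10 (.add (.mul (.var 21) (.var 7)) (.var 22)))) <|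
  .seq (.iwrite 1 (.var 3) (.var 24)) <| .seq (.iset 3 (.add (.var 3) (.const 1))) <|
  .seq (.rset 2 (.add (.var 2) (.read 0 (.var 24)))) (.iset 22 (.add (.var 22) (.const 1)))

/-- Real registers `2`, `3`, `4` hold the weights of the listed vertices and of the two preceding
upper sets. Shifting them makes each cut test constant time. -/
def queryDown : Program :=
  .seq (.rset 4 (.var 3)) <| .seq (.rset 3 (.var 2)) <|
  .seq (.iset 21 (.sub (.var 21) (.const 1))) (.iset 22 (.const 0))

def queryMore : Test :=
  .and (.not (.ieq (.var 21) (.const 0)))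
    (.rlt (.mul (.add (.ofInt (.const 1)) (.div (.var 0) (.ofInt (.const 4)))) (.var 4)) (.var 2))

def queryBody : Program :=
  .branch (.ilt (.var 22) (.read 9 (.var 21))) queryList
    (.branch queryMore queryDown (.iset 23 (.const 1)))

/-- List the vertices of the levels above the first cut. -/
def queryProgram : Program :=
  .seq (.iset 3 (.const 0)) <| .seq (.iset 21 (.var 8)) <| .seq (.iset 22 (.const 0)) <|
  .seq (.iset 23 (.const 0)) <| .seq (.rset 2 (.ofInt (.const 0))) <|
  .seq (.rset 3 (.ofInt (.const 0))) <| .seq (.rset 4 (.ofInt (.const 0))) <|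
  .loop queryTest queryBody

variable {n : ℕ} {G : SimpleGraph (Fin n)} {k L B : ℕ} {ε : ℝ} {w : Fin n → ℝ} {s s' : State}
variable {A : Conf n} {M i r : ℕ}

/-- Word array `1` is pure output and not part of the representation, so queries may overwrite it.
-/
theorem Stored.congr (h : Stored k L ε w s A)
    (hi : ∀ q, q = 0 ∨ q = 4 ∨ q = 5 ∨ q = 6 ∨ q = 7 ∨ q = 8 → s'.ireg q = s.ireg q)
    (hr : s'.rreg 0 = s.rreg 0) (hm : ∀ a, a ≠ 1 → s'.imem a = s.imem a)
    (hrm : s'.rmem = s.rmem) : Stored k L ε w s' A := by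
  refine ⟨?_, ?_, ?_, ?_, ?_, hr ▸ h.eps_eq, hrm ▸ h.weight, hrm ▸ h.thr, ?_, ?_, ?_, ?_, ?_, ?_,
    ?_, ?_, ?_⟩
  · rw [hi _ (by omega)]; exact h.n_eq
  · rw [hi _ (by omega)]; exact h.k_eq
  · rw [hi _ (by omega)]; exact h.L_eq
  · rw [hi _ (by omega)]; exact h.keys_eq
  · rw [hi _ (by omega)]; exact h.items_eq
  · rw [hm _ (by omega)]; exact h.arc
  · rw [hm _ (by omega)]; exact h.lab
  · rw [hm _ (by omega), hm _ (by omega), hm _ (by omega)]; exact h.ins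
  · rw [hm _ (by omega), hm _ (by omega), hm _ (by omega)]; exact h.outs
  · rw [hm _ (by omega), hm _ (by omega), hm _ (by omega)]; exact h.levs
  · rw [hm _ (by omega)]; exact h.lev
  · rw [hm _ (by omega)]; exact h.deg
  · rw [hi _ (by omega)]; exact h.le_top
  · rw [hi _ (by omega)]; exact h.top

/-- The vertices listed before entry `r` of level `i`. -/
def listed (s : State) (A : Conf n) (i r : ℕ) : Finset (Fin n) :=
  Finset.univ.filter fun v => i < A.lev v ∨ A.lev v = i ∧ s.imem 11 v < r

/-- The state of the query loop. -/
structure QueryState (k L : ℕ) (ε : ℝ) (w : Fin n → ℝ) (s : State) (A : Conf n) (M i r : ℕ) :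
    Prop where
  stored : Stored k L ε w s A
  lvl : s.ireg 21 = i
  idx : s.ireg 22 = r
  top : s.ireg 8 = M
  le : i ≤ M
  le_cnt : r ≤ s.imem 9 i
  lists : ListsVertices s (listed s A i r)
  cur : s.rreg 2 = ∑ v ∈ listed s A i r, w v
  prev : s.rreg 3 = upWeight w A (i + 1)
  prev' : s.rreg 4 = upWeight w A (i + 2)
  grow : ∀ j, i < j → j ≤ M → (1 + ε / 4) * upWeight w A (j + 2) < upWeight w A j

theorem listed_zero (s : State) (A : Conf n) (i : ℕ) : listed s A i 0 = upSet A (i + 1) := by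
  ext v
  simp only [listed, Finset.mem_filter, Finset.mem_univ, true_and, mem_upSet]
  omega

theorem Stored.listed_all (h : Stored k L ε w s A) (hr : s.imem 9 i ≤ r) :
    listed s A i r = upSet A i := by
  ext v
  simp only [listed, Finset.mem_filter, Finset.mem_univ, true_and, mem_upSet]
  constructor
  · omega
  · intro hv
    rcases Nat.lt_or_ge i (A.lev v) with h1 | h1
    · exact .inl h1
    · have e : A.lev v = i := by omega
      have := (h.levs.mem v i (by simp [e])).1
      exact .inr ⟨e, by omega⟩

theorem Stored.listed_succ (h : Stored k L ε w s A) (hr : r < s.imem 9 i) :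
    ∃ v : Fin n, s.imem 10 (i * (n * n) + r) = v ∧ v ∉ listed s A i r ∧
      listed s A i (r + 1) = insert v (listed s A i r) := by
  obtain ⟨v, hv, he, hp⟩ := h.levs.get i r hr
  simp only [Option.some.injEq] at hv
  refine ⟨v, he, by simp [listed, hv, hp], ?_⟩
  ext u
  simp only [listed, Finset.mem_filter, Finset.mem_univ, true_and, Finset.mem_insert]
  constructor
  · rintro (h1 | ⟨h1, h2⟩)
    · exact .inr (.inl h1)
    · rcases Nat.lt_or_ge (s.imem 11 u) r with h3 | h3
      · exact .inr (.inr ⟨h1, h3⟩)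
      · left
        have h4 := (h.levs.mem u i (by simp [h1])).2
        have : s.imem 11 u = r := by omega
        rw [this, he] at h4
        exact (Fin.ext h4).symm
  · rintro (rfl | h1 | ⟨h1, h2⟩)
    · exact .inr ⟨hv, by omega⟩
    · exact .inl h1
    · exact .inr ⟨h1, by omega⟩

/-- Every iteration but the last lists one vertex or descends one level, which gives both
termination and the running time. -/
theorem wp_queryLoop (hB : n * (L + 3) * (n * n) + k + 100 < B) (hM : M ≤ L) (m : ℕ) :
    ∀ (s : State) (i r : ℕ), s.ireg 23 = 0 → QueryState k L ε w s A M i r →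
    n + i < (listed s A i r).card + m →
    WP B (.loop queryTest queryBody) s fun t s' => ∃ i', Stored k L ε w s' A ∧
      IsCut ε w A M i' ∧ ListsVertices s' (upSet A i') ∧
      t + 100 * (listed s A i r).card + 100 * i' ≤ 100 * (upSet A i').card + 100 * i + 200 := by
  have e1 : 1 % B = 1 := Nat.mod_eq_of_lt (by omega)
  have e4 : 4 % B = 4 := Nat.mod_eq_of_lt (by omega)
  have hsm := small_bound hB
  induction m with
  | zero =>
    intro s i r h23 h hm
    have hcl : (listed s A i r).card ≤ n := (Finset.card_le_univ _).trans (by simp)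
    omega
  | succ m ih =>
    intro s i r h23 h hm
    have htop := h.stored.top
    obtain ⟨v₀, hv₀⟩ := htop
    have hn : 0 < n := v₀.pos
    have hb := (lev_bound hB v₀ (j := i) (by have := h.le; omega)).1
    have hcl : (listed s A i r).card ≤ n := (Finset.card_le_univ _).trans (by simp)
    refine wp_loop_step (by simp [queryTest, h23]) ?_
    by_cases hr : r < s.imem 9 i
    · obtain ⟨v, hv, hv', hins⟩ := h.stored.listed_succ hr
      have hcard : (listed s A i (r + 1)).card = (listed s A i r).card + 1 := by
        rw [hins, Finset.card_insert_of_notMem hv']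
      have hcl' : (listed s A i (r + 1)).card ≤ n := (Finset.card_le_univ _).trans (by simp)
      have hcn : s.imem 9 i ≤ n * n := h.stored.levs.cnt_le Fin.val_injective card_vert _
      have e2 : (i * (n * n)) % B = i * (n * n) := Nat.mod_eq_of_lt (by omega)
      have e3 : (i * (n * n) + r) % B = i * (n * n) + r := Nat.mod_eq_of_lt (by omega)
      have e5 : ((listed s A i r).card + 1) % B = (listed s A i r).card + 1 :=
        Nat.mod_eq_of_lt (by omega)
      have e6 : (r + 1) % B = r + 1 := Nat.mod_eq_of_lt (by omega)
      have h3 := h.lists.1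
      refine wp_branch_true (by simp [h.lvl, h.idx, hr]) ?_
      simp only [queryList, wp_seq, wp_iset, wp_iwrite, wp_rset]
      simp only [IExp.eval, RExp.eval, setI_ireg, setI_rmem, setI_rreg, writeI_ireg,
        writeI_rreg, writeI_rmem, setR_ireg, h.lvl, h.idx, h.stored.items_eq, e2, e3, hv, h3,
        h.stored.weight, h.cur, e1, if_true, if_false, Nat.reduceEqDiff, e5, e6]
      have hl : ∀ s₁ : State, s₁.imem 11 = s.imem 11 →
          listed s₁ A i (r + 1) = listed s A i (r + 1) := by
        intro s₁ hs₁; simp only [listed, hs₁]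
      refine (ih _ i (r + 1) ?_ ⟨?_, ?_, ?_, ?_, h.le, ?_, ⟨?_, ?_⟩, ?_, ?_, ?_, h.grow⟩ ?_).mono ?_
      · simp [h23]
      · refine h.stored.congr ?_ ?_ ?_ ?_
        · intro q hq
          simp only [setI_ireg, setR_ireg, writeI_ireg]
          rw [if_neg (by omega), if_neg (by omega), if_neg (by omega)]
        · simp
        · intro a ha
          simp [ha]
        · simp
      · simp [h.lvl]
      · simp
      · simp [h.top]
      · simpa using hr
      · rw [hl _ (by simp)]; simp [hcard]
      · intro u
        rw [hl _ (by simp), hcard, hins, Finset.mem_insert, h.lists.2]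
        simp only [setI_imem, setR_imem, writeI_imem, if_true]
        constructor
        · rintro (rfl | ⟨q, hq, hq'⟩)
          · exact ⟨_, Nat.lt_succ_self _, by simp⟩
          · exact ⟨q, by omega, by rw [Function.update_of_ne (by omega)]; exact hq'⟩
        · rintro ⟨q, hq, hq'⟩
          by_cases e : q = (listed s A i r).card
          · subst e
            simp only [Function.update_self] at hq'
            exact .inl (Fin.ext hq'.symm)
          · rw [Function.update_of_ne e] at hq'
            exact .inr ⟨q, by omega, hq'⟩
      · rw [hl _ (by simp), hins, Finset.sum_insert hv']
        simp [add_comm]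
      · simp [h.prev]
      · simp [h.prev']
      · rw [hl _ (by simp), hcard]; omega
      · rintro t s₁ ⟨i', hs₁, hcut, hlist, ht⟩
        rw [hl _ (by simp), hcard] at ht
        refine ⟨i', hs₁, hcut, hlist, ?_⟩
        simp [queryTest]
        omega
    · have hall := h.stored.listed_all (r := r) (i := i) (by omega)
      have hcur := h.cur
      have hlists := h.lists
      rw [hall] at hcur hlists
      refine wp_branch_false (by simpa [h.lvl, h.idx] using hr) ?_
      have hmore : queryMore.Holds B s ↔
          (i ≠ 0 ∧ (1 + ε / 4) * upWeight w A (i + 2) < upWeight w A i) := by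
        simp [queryMore, h.lvl, e1, e4, h.stored.eps_eq, h.prev', hcur, upWeight]
      by_cases hst : queryMore.Holds B s
      · refine wp_branch_true hst ?_
        rw [hmore] at hst
        simp only [queryDown, wp_seq, wp_iset, wp_rset]
        have hl : ∀ s₁ : State, listed s₁ A (i - 1) 0 = upSet A i := by
          intro s₁
          rw [listed_zero]
          congr 1
          omega
        have hi1 : i - 1 + 1 = i := by omega
        have hi2 : i - 1 + 2 = i + 1 := by omega
        have hle := h.le
        refine (ih _ (i - 1) 0 ?_ ⟨?_, ?_, ?_, ?_, by omega, ?_, ⟨?_, ?_⟩, ?_, ?_, ?_, ?_⟩ ?_).mono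
          ?_
        · simp [h23]
        · refine h.stored.congr ?_ ?_ ?_ ?_
          · intro q hq
            simp only [setI_ireg, setR_ireg]
            rw [if_neg (by omega), if_neg (by omega)]
          · simp
          · simp
          · simp
        · simp [h.lvl, e1]
        · simp
        · simp [h.top]
        · simp
        · rw [hl]; simpa using hlists.1
        · rw [hl]; simpa using hlists.2
        · rw [hl]; simpa using hcur
        · rw [hi1]; simpa [upWeight] using hcur
        · rw [hi2]; simpa using h.prev
        · intro j hj hj'
          by_cases e : j = i
          · subst e; exact hst.2
          · exact h.grow j (by omega) hj'
        · rw [hl]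
          rw [hall] at hm
          omega
        · rintro t s₁ ⟨i', hs₁, hcut, hlist, ht⟩
          rw [hl] at ht
          refine ⟨i', hs₁, hcut, hlist, ?_⟩
          rw [hall]
          simp [queryTest, queryMore]
          omega
      · refine wp_branch_false hst ?_
        rw [hmore] at hst
        rw [wp_iset]
        refine wp_loop_end (by simp [queryTest, e1]) ⟨i, ?_, ⟨h.le, ?_, ?_, h.grow, ?_⟩, ?_, ?_⟩
        · refine h.stored.congr ?_ ?_ ?_ ?_
          · intro q hq
            rw [setI_ireg, if_neg (by omega)]
          · simp
          · simp
          · simp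
        · rw [← h.top]; exact h.stored.le_top
        · rw [← h.top]; exact h.stored.top
        · by_contra hcon
          push Not at hcon
          exact hst hcon
        · exact ⟨by simpa using hlists.1, by simpa using hlists.2⟩
        · rw [hall]
          simp [queryTest, queryMore]
          omega

theorem wp_queryProgram (hB : n * (L + 3) * (n * n) + k + 100 < B) (h : Stored k L ε w s A)
    (hL : ∀ v, A.lev v ≤ L) (hw : ∀ v, 1 ≤ w v) (hε : 0 < ε) :
    WP B queryProgram s fun t s' => ∃ M i, Stored k L ε w s' A ∧
      IsCut ε w A M i ∧ ListsVertices s' (upSet A i) ∧ t ≤ 1000 * (1 + (upSet A i).card) := by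
  obtain ⟨v₀, hv₀⟩ := h.top
  have hM : s.ireg 8 ≤ L := by rw [← hv₀]; exact hL v₀
  have hup : ∀ j, s.ireg 8 < j → upSet A j = ∅ := by
    intro j hj
    rw [Finset.eq_empty_iff_forall_notMem]
    intro v hv
    rw [mem_upSet] at hv
    have := h.le_top v
    omega
  have hl : ∀ s₁ : State, listed s₁ A (s.ireg 8) 0 = ∅ := by
    intro s₁
    rw [listed_zero]
    exact hup _ (by omega)
  simp only [queryProgram, wp_seq, wp_iset, wp_rset]
  refine (wp_queryLoop (A := A) (M := s.ireg 8) (w := w) (ε := ε) hB hM (n + s.ireg 8 + 1) _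
    (s.ireg 8) 0 ?_ ⟨?_, ?_, ?_, ?_, le_rfl, ?_, ⟨?_, ?_⟩, ?_, ?_, ?_, ?_⟩ ?_).mono ?_
  · simp
  · refine h.congr ?_ ?_ ?_ ?_
    · intro q hq
      simp only [setI_ireg, setR_ireg]
      rw [if_neg (by omega), if_neg (by omega), if_neg (by omega), if_neg (by omega)]
    · simp
    · simp
    · simp
  · simp
  · simp
  · simp
  · simp
  · rw [hl]; simp
  · rw [hl]; simp
  · rw [hl]; simp
  · simp [upWeight, hup (s.ireg 8 + 1) (by omega)]
  · simp [upWeight, hup (s.ireg 8 + 2) (by omega)]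
  · intro j h1 h2; omega
  · omega
  · rintro t s₁ ⟨i', hs₁, hcut, hlist, ht⟩
    rw [hl] at ht
    -- Turns the number of levels traversed into a multiple of the number of listed vertices.
    have := hcut.depth_le hw hε
    refine ⟨_, i', hs₁, hcut, hlist, ?_⟩
    simp at ht ⊢
    omega

end VWDSG
-- Preprocessing.
namespace VWDSG
open RealRAM Conf

def logTest : Test := .ilt (.var 10) (.var 0)

/-- Reals cannot be rounded to words, so the integer logarithm is found by doubling: each iteration
doubles the current power or moves on to the next vertex. -/
def logBody : Program :=
  .branch (.rlt (.var 2) (.mul (.ofInt (.var 0)) (.read 0 (.var 10))))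
    (.seq (.rset 2 (.add (.var 2) (.var 2))) (.iset 11 (.add (.var 11) (.const 1))))
    (.iset 10 (.add (.var 10) (.const 1)))

/-- Counting up to `q * ε² ≥ 1` gives an integer substitute for `1 / ε²`. -/
def sqTest : Test := .rlt (.mul (.mul (.ofInt (.var 12)) (.var 0)) (.var 0)) (.ofInt (.const 1))

def sqBody : Program := .iset 12 (.add (.var 12) (.const 1))

/-- Thresholds are tabulated up to the first that is at least `4 * T`; no vertex reaches that level
while the optimum is at most `T`. -/
def thetaTest : Test := .rlt (.read 1 (.var 5)) (.mul (.ofInt (.const 4)) (.var 1))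

def thetaBody : Program :=
  .seq (.rwrite 1 (.add (.var 5) (.const 1))
    (.add (.mul (.read 1 (.var 5))
      (.add (.ofInt (.const 1)) (.div (.ofInt (.const 2)) (.ofInt (.var 4)))))
      (.ofInt (.const 2))))
    (.iset 5 (.add (.var 5) (.const 1)))

def fillBody : Program := .seq (bucketInsert 9) (.iset 10 (.add (.var 10) (.const 1)))

/-- Preprocessing: compute the parameters and thresholds and put all vertices into level `0`. -/
def initProgram : Program :=
  .seq (.rset 2 (.ofInt (.const 1))) <| .seq (.loop logTest logBody) <|
  -- The constant 300 keeps `(1 + 2 / k) ^ d` below `1 + ε / 4` for the depth `d ≤ 18 * log (n * W)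
  -- / ε` of a cut.
  .seq (.loop sqTest sqBody) <| .seq (.iset 4 (.mul (.const 300) (.mul (.var 11) (.var 12)))) <|
  .seq (.loop thetaTest thetaBody) <| .seq (.iset 6 (.add (.var 5) (.const 3))) <|
  .seq (.iset 7 (.mul (.var 0) (.var 0))) <| .seq (.iset 10 (.const 0)) <|
  .seq (.iset 11 (.const 0)) <| .loop logTest fillBody

variable {n : ℕ} {k L B : ℕ} {ε T : ℝ} {w : Fin n → ℝ}

theorem wp_logLoop {P : ℕ} (hP : ∀ v, n * w v ≤ 2 ^ P) (hB : n + P + 1 < B) (m : ℕ) :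
    ∀ (s : State) (v l : ℕ), s.ireg 0 = n → (∀ u : Fin n, s.rmem 0 u = w u) → s.ireg 10 = v →
    s.ireg 11 = l → s.rreg 2 = 2 ^ l → v ≤ n → l ≤ P → (∀ u : Fin n, (u : ℕ) < v → n * w u ≤ 2 ^ l) →
    n + P ≤ v + l + m →
    WP B (.loop logTest logBody) s fun t s' => ∃ l' ≤ P, s'.ireg 11 = l' ∧
      (∀ u, n * w u ≤ 2 ^ l') ∧ (∀ r, r ≠ 10 → r ≠ 11 → s'.ireg r = s.ireg r) ∧
      (∀ r, r ≠ 2 → s'.rreg r = s.rreg r) ∧ s'.imem = s.imem ∧ s'.rmem = s.rmem ∧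
      t ≤ 30 * (m + 1) := by
  induction m with
  | zero =>
    intro s v l h0 hw h10 h11 h2 hv hl hu hm
    have : v = n := by omega
    subst this
    exact wp_loop_end (by simp [logTest, h0, h10])
      ⟨l, hl, h11, fun u => hu u u.isLt, by simp, by simp, rfl, rfl, by simp [logTest]⟩
  | succ m ih =>
    intro s v l h0 hw h10 h11 h2 hv hl hu hm
    have e1 : 1 % B = 1 := Nat.mod_eq_of_lt (by omega)
    have e2 : (v + 1) % B = v + 1 := Nat.mod_eq_of_lt (by omega)
    have e3 : (l + 1) % B = l + 1 := Nat.mod_eq_of_lt (by omega)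
    by_cases hvn : v < n
    · refine wp_loop_step (by simpa [logTest, h0, h10] using hvn) ?_
      have hwv : s.rmem 0 v = w ⟨v, hvn⟩ := hw ⟨v, hvn⟩
      by_cases hlt : (2 : ℝ) ^ l < n * w ⟨v, hvn⟩
      · have hlP : l < P := by
          by_contra hcon
          have : l = P := by omega
          subst this
          linarith [hP ⟨v, hvn⟩]
        refine wp_branch_true (by simpa [h0, h10, h2, hwv] using hlt) ?_
        simp only [wp_seq, wp_iset, wp_rset]
        refine (ih _ v (l + 1) (by simp [h0]) (by simpa using hw) (by simp [h10])
          (by simp [h11, e1, e3]) (by simp [h2]; ring) hv hlP ?_ (by omega)).mono ?_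
        · intro u huv
          refine (hu u huv).trans ?_
          exact pow_le_pow_right₀ (by norm_num) (by omega)
        · rintro t s' ⟨l', hl', g1, g2, g3, g4, g5, g6, ht⟩
          refine ⟨l', hl', g1, g2, ?_, ?_, by simpa using g5, by simpa using g6, ?_⟩
          · intro r hr hr'
            simp [g3 r hr hr', hr']
          · intro r hr
            simp [g4 r hr, hr]
          · simp [logTest]; omega
      · refine wp_branch_false (by simpa [h0, h10, h2, hwv] using hlt) ?_
        rw [wp_iset]
        refine (ih _ (v + 1) l (by simp [h0]) (by simpa using hw) (by simp [h10, e1, e2])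
          (by simp [h11]) (by simp [h2]) hvn hl ?_ (by omega)).mono ?_
        · intro u huv
          rcases Nat.lt_succ_iff_lt_or_eq.1 huv with h | h
          · exact hu u h
          · have : u = ⟨v, hvn⟩ := Fin.ext h
            subst this
            exact not_lt.1 hlt
        · rintro t s' ⟨l', hl', g1, g2, g3, g4, g5, g6, ht⟩
          refine ⟨l', hl', g1, g2, ?_, by simpa using g4, by simpa using g5, by simpa using g6, ?_⟩
          · intro r hr hr'
            simp [g3 r hr hr', hr]
          · simp [logTest]; omega
    · have : v = n := by omega
      subst this
      exact wp_loop_end (by simp [logTest, h0, h10])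
        ⟨l, hl, h11, fun u => hu u u.isLt, by simp, by simp, rfl, rfl, by simp [logTest]; omega⟩

theorem wp_sqLoop {Q : ℕ} (hQ : 1 ≤ Q * ε * ε) (hB : Q + 1 < B) (m : ℕ) :
    ∀ (s : State) (q : ℕ), s.rreg 0 = ε → s.ireg 12 = q → q ≤ Q → Q ≤ q + m →
    WP B (.loop sqTest sqBody) s fun t s' => ∃ q' ≤ Q, s'.ireg 12 = q' ∧ 1 ≤ q' * ε * ε ∧
      (∀ r, r ≠ 12 → s'.ireg r = s.ireg r) ∧ s'.rreg = s.rreg ∧ s'.imem = s.imem ∧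
      s'.rmem = s.rmem ∧ t ≤ 30 * (m + 1) := by
  have e1 : 1 % B = 1 := Nat.mod_eq_of_lt (by omega)
  induction m with
  | zero =>
    intro s q h0 h12 hq hm
    have : q = Q := by omega
    subst this
    exact wp_loop_end (by simpa [sqTest, h0, h12, e1] using hQ)
      ⟨q, hq, h12, hQ, by simp, rfl, rfl, rfl, by simp [sqTest]⟩
  | succ m ih =>
    intro s q h0 h12 hq hm
    by_cases hlt : (q : ℝ) * ε * ε < 1
    · have hqQ : q < Q := by
        by_contra hcon
        have : q = Q := by omega
        subst this
        linarith
      have e2 : (q + 1) % B = q + 1 := Nat.mod_eq_of_lt (by omega)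
      refine wp_loop_step (by simpa [sqTest, h0, h12, e1] using hlt) ?_
      rw [sqBody, wp_iset]
      refine (ih _ (q + 1) (by simp [h0]) (by simp [h12, e1, e2]) hqQ (by omega)).mono ?_
      rintro t s' ⟨q', hq', g1, g2, g3, g4, g5, g6, ht⟩
      refine ⟨q', hq', g1, g2, ?_, by simpa using g4, by simpa using g5, by simpa using g6, ?_⟩
      · intro r hr
        simp [g3 r hr, hr]
      · simp [sqTest]; omega
    · exact wp_loop_end (by simpa [sqTest, h0, h12, e1] using hlt)
        ⟨q, hq, h12, not_lt.1 hlt, by simp, rfl, rfl, rfl, by simp [sqTest]; omega⟩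

theorem wp_thetaLoop {H : ℕ} (hH : 4 * T ≤ theta k H) (hB : H + 5 < B) (m : ℕ) :
    ∀ (s : State) (i : ℕ), s.rreg 1 = T → s.ireg 4 = k → s.ireg 5 = i → i ≤ H →
    (∀ j ≤ i, s.rmem 1 j = theta k j) → H ≤ i + m →
    WP B (.loop thetaTest thetaBody) s fun t s' => ∃ i' ≤ H, s'.ireg 5 = i' ∧
      4 * T ≤ theta k i' ∧ (∀ j ≤ i', s'.rmem 1 j = theta k j) ∧
      (∀ r, r ≠ 5 → s'.ireg r = s.ireg r) ∧ s'.rreg = s.rreg ∧ s'.imem = s.imem ∧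
      s'.rmem 0 = s.rmem 0 ∧ t ≤ 40 * (m + 1) := by
  have e1 : 1 % B = 1 := Nat.mod_eq_of_lt (by omega)
  have e2 : 2 % B = 2 := Nat.mod_eq_of_lt (by omega)
  have e4 : 4 % B = 4 := Nat.mod_eq_of_lt (by omega)
  induction m with
  | zero =>
    intro s i h1 h4 h5 hi hj hm
    have : i = H := by omega
    subst this
    exact wp_loop_end (by simpa [thetaTest, h1, h5, e4, hj i le_rfl] using hH)
      ⟨i, hi, h5, hH, hj, by simp, rfl, rfl, rfl, by simp [thetaTest]⟩
  | succ m ih =>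
    intro s i h1 h4 h5 hi hj hm
    by_cases hlt : theta k i < 4 * T
    · have hiH : i < H := by
        by_contra hcon
        have : i = H := by omega
        subst this
        linarith
      have e3 : (i + 1) % B = i + 1 := Nat.mod_eq_of_lt (by omega)
      refine wp_loop_step (by simpa [thetaTest, h1, h5, e4, hj i le_rfl] using hlt) ?_
      simp only [thetaBody, wp_seq, wp_iset, wp_rwrite]
      refine (ih _ (i + 1) (by simp [h1]) (by simp [h4]) (by simp [h5, e1, e3]) hiH ?_
        (by omega)).mono ?_
      · intro j hji
        rcases Nat.le_succ_iff.1 hji with h | h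
        · have : j ≠ i + 1 := by omega
          simp [h5, e1, e3, this, hj j h]
        · simp [h, h5, e1, e2, e3, h4, hj i le_rfl, theta_succ]
      · rintro t s' ⟨i', hi', g1, g2, g3, g4, g5, g6, g7, ht⟩
        refine ⟨i', hi', g1, g2, g3, ?_, by simpa using g5, by simpa using g6, by simpa using g7, ?_⟩
        · intro r hr
          simp [g4 r hr, hr]
        · simp [thetaTest]; omega
    · exact wp_loop_end (by simpa [thetaTest, h1, h5, e4, hj i le_rfl] using hlt)
        ⟨i, hi, h5, not_lt.1 hlt, hj, by simp, rfl, rfl, rfl, by simp [thetaTest]; omega⟩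

theorem wp_fillLoop (hB : n * n + n + 1 < B) (m : ℕ) :
    ∀ (s : State) (v : ℕ), s.ireg 0 = n → s.ireg 7 = n * n → s.ireg 10 = v → s.ireg 11 = 0 →
    v ≤ n → n ≤ v + m →
    Bucketed (n * n) Fin.val (s.imem 9) (s.imem 10) (s.imem 11)
      (fun u : Fin n => if (u : ℕ) < v then some 0 else none) →
    WP B (.loop logTest fillBody) s fun t s' =>
      Bucketed (n * n) Fin.val (s'.imem 9) (s'.imem 10) (s'.imem 11) (fun _ : Fin n => some 0) ∧
      (∀ r, r ≠ 10 → s'.ireg r = s.ireg r) ∧ s'.rreg = s.rreg ∧ s'.rmem = s.rmem ∧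
      (∀ a, a ≠ 9 → a ≠ 10 → a ≠ 11 → s'.imem a = s.imem a) ∧ t ≤ 30 * (m + 1) := by
  induction m with
  | zero =>
    intro s v h0 h7 h10 h11 hv hm hb
    have : v = n := by omega
    subst this
    refine wp_loop_end (by simp [logTest, h0, h10]) ⟨by simpa using hb, by simp, rfl, rfl, by simp, ?_⟩
    simp [logTest]
  | succ m ih =>
    intro s v h0 h7 h10 h11 hv hm hb
    by_cases hvn : v < n
    · refine wp_loop_step (by simpa [logTest, h0, h10] using hvn) ?_
      rw [fillBody, wp_seq]
      refine (wp_bucketInsert (i := (⟨v, hvn⟩ : Fin n)) (c := 0) hb Fin.val_injective card_vert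
        (by simp) h7 h10 h11 (by omega)).mono ?_
      rintro t₁ s₁ ⟨ht₁, hb₁, hi₁, hr₁, hrm₁, hm₁⟩
      rw [wp_iset]
      have e1 : 1 % B = 1 := Nat.mod_eq_of_lt (by omega)
      have e2 : (v + 1) % B = v + 1 := Nat.mod_eq_of_lt (by omega)
      refine (ih _ (v + 1) (by simp [hi₁, h0]) (by simp [hi₁, h7]) (by simp [hi₁, h10, e1, e2])
        (by simp [hi₁, h11]) hvn (by omega) ?_).mono ?_
      · have e : (fun u : Fin n => if (u : ℕ) < v + 1 then some 0 else none) =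
            Function.update (fun u : Fin n => if (u : ℕ) < v then some 0 else none) ⟨v, hvn⟩
              (some 0) := by
          funext u
          by_cases hu : u = ⟨v, hvn⟩
          · subst hu; simp
          · have : (u : ℕ) ≠ v := fun e => hu (Fin.ext e)
            have e : (u : ℕ) < v + 1 ↔ (u : ℕ) < v := by omega
            simp [hu, e]
        rw [e]
        exact hb₁
      · rintro t s' ⟨g1, g2, g3, g4, g5, ht⟩
        refine ⟨g1, ?_, by simpa [hr₁] using g3, by simpa [hrm₁] using g4, ?_, ?_⟩
        · intro r hr
          simp [g2 r hr, hr, hi₁]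
        · intro a h1 h2 h3
          simp [g5 a h1 h2 h3, hm₁ a h1 h2 h3]
        · simp [logTest]; omega
    · have : v = n := by omega
      subst this
      refine wp_loop_end (by simp [logTest, h0, h10])
        ⟨by simpa using hb, by simp, rfl, rfl, by simp, ?_⟩
      simp [logTest]; omega

/-- The configuration without arcs. -/
def emptyConf (n : ℕ) : Conf n where
  lab _ := none
  lev _ := 0

/-- `P`, `Q`, `H` are a priori bounds for the running time; `l`, `q`, `L` are the values that the
loops actually find. -/
theorem wp_initProgram {P Q H : ℕ} (hn : 2 ≤ n) (hw : ∀ v, 1 ≤ w v) (hP : ∀ v, n * w v ≤ 2 ^ P)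
    (hQ : 1 ≤ Q * ε * ε) (hH : ∀ k, 2 ≤ k → k ≤ 300 * (P * Q) → 4 * T ≤ theta k H)
    (hB : n * (H + 3) * (n * n) + 300 * (P * Q) + P + Q + 1000 < B) :
    WP B initProgram (inputState w ε T) fun t s' => ∃ l q L : ℕ, l ≤ P ∧ q ≤ Q ∧ L ≤ H ∧ 1 ≤ l ∧
      1 ≤ q ∧ (∀ u, n * w u ≤ 2 ^ l) ∧ 1 ≤ q * ε * ε ∧
      4 * T ≤ theta (300 * (l * q)) L ∧ Stored (300 * (l * q)) L ε w s' (emptyConf n) ∧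
      t ≤ 100 * (n + P + Q + H + 2) := by
  have hsm := small_bound (n := n) (L := H) (k := 0) (B := n * (H + 3) * (n * n) + 101) (by omega)
  have hHn : H + 3 ≤ n * (H + 3) * (n * n) := by
    calc H + 3 = 1 * (H + 3) * 1 := by ring
      _ ≤ n * (H + 3) * (n * n) := by
        gcongr
        · omega
        · nlinarith
  simp only [initProgram, wp_seq, wp_rset, wp_iset]
  have e1 : 1 % B = 1 := Nat.mod_eq_of_lt (by omega)
  have e3 : 3 % B = 3 := Nat.mod_eq_of_lt (by omega)
  have e300 : 300 % B = 300 := Nat.mod_eq_of_lt (by omega)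
  refine (wp_logLoop (w := w) hP (by omega) (n + P) _ 0 0 (by simp [inputState])
    (by intro u; simp [inputState]) (by simp [inputState]) (by simp [inputState]) (by simp [e1])
    (by omega) (by omega) (by simp) (by omega)).mono ?_
  rintro t₁ s₁ ⟨l, hl, hl₁, hlw, hi₁, hr₁, hm₁, hrm₁, ht₁⟩
  refine (wp_sqLoop hQ (by omega) Q _ 0 (by simp [hr₁, inputState])
    (by simp [hi₁, inputState]) (by omega) (by omega)).mono ?_
  rintro t₂ s₂ ⟨q, hq, hq₂, hqε, hi₂, hr₂, hm₂, hrm₂, ht₂⟩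
  have hlpos : 1 ≤ l := by
    by_contra hcon
    have h0 : l = 0 := by omega
    have h1 := hlw ⟨0, by omega⟩
    have h2 := hw ⟨0, by omega⟩
    have h3 : (2 : ℝ) ≤ n := by exact_mod_cast hn
    rw [h0, pow_zero] at h1
    nlinarith
  have hqpos : 1 ≤ q := by
    by_contra hcon
    have h0 : q = 0 := by omega
    rw [h0] at hqε
    norm_num at hqε
  have hlq : l * q ≤ P * Q := Nat.mul_le_mul hl hq
  have hlq1 : 1 ≤ l * q := Nat.one_le_iff_ne_zero.2 (by positivity)
  have e5 : (l * q) % B = l * q := Nat.mod_eq_of_lt (by omega)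
  have e6 : (300 * (l * q)) % B = 300 * (l * q) := Nat.mod_eq_of_lt (by omega)
  have hl₂ : s₂.ireg 11 = l := by rw [hi₂ _ (by omega), hl₁]
  refine (wp_thetaLoop (T := T) (k := 300 * (l * q)) (hH _ (by omega) (by omega)) (by omega) H _ 0
    (by simp [hr₂, hr₁, inputState]) (by simp [hl₂, hq₂, e300, e5, e6])
    (by simp [hi₂, hi₁, inputState]) (by omega)
    (by intro j hj; obtain rfl : j = 0 := by omega
        simp [hrm₂, hrm₁, inputState, theta]) (by omega)).mono ?_
  rintro t₃ s₃ ⟨L, hL, h5, hLT, hthr, hi₃, hr₃, hm₃, hrm₃, ht₃⟩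
  have h0 : s₃.ireg 0 = n := by simp [hi₃, hi₂, hi₁, inputState]
  have himem : ∀ a r, s₃.imem a r = 0 := by
    intro a r
    simp [hm₃, hm₂, hm₁, inputState]
  have e7 : (L + 3) % B = L + 3 := Nat.mod_eq_of_lt (by omega)
  have e8 : (n * n) % B = n * n := Nat.mod_eq_of_lt (by omega)
  have hbk : ∀ {ι : Type} (N : ℕ) (code : ι → ℕ) (a b c : ℕ),
      Bucketed N code (s₃.imem a) (s₃.imem b) (s₃.imem c) (fun _ : ι => none) := by
    intro ι N code a b c
    refine ⟨by simp, ?_⟩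
    intro c r hr
    simp [himem] at hr
  refine (wp_fillLoop (n := n) (by omega) n _ 0 (by simp [h0]) (by simp [h0, e8]) (by simp) (by simp)
    (by omega) (by omega) (by simpa using hbk (n * n) Fin.val 9 10 11)).mono ?_
  rintro t₄ s₄ ⟨hb₄, hi₄, hr₄, hrm₄, hm₄, ht₄⟩
  refine ⟨l, q, L, hl, hq, hL, hlpos, hqpos, hlw, hqε, hLT,
    ⟨?_, ?_, ?_, ?_, ?_, ?_, ?_, ?_, ?_, ?_, ?_, ?_, ?_, ?_, ?_, ?_, ?_⟩, ?_⟩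
  · simp [hi₄, h0]
  · simp [hi₄, hi₃, hl₂, hq₂, e300, e5, e6]
  · simp [hi₄, h5]
  · simp [hi₄, h5, e3, e7]
  · simp [hi₄, h0, e8]
  · simp [hr₄, hr₃, hr₂, hr₁, inputState]
  · intro v; simp [hrm₄, hrm₃, hrm₂, hrm₁, inputState]
  · simpa [hrm₄] using hthr
  · intro p; simp [hm₄, himem, emptyConf]
  · intro p j hj; simp [emptyConf] at hj
  · have : (emptyConf n).inKey L = fun _ => none := rfl
    simpa [hm₄, this] using hbk (n * n) (pairCode (n := n)) 3 4 5
  · have : (emptyConf n).outKey L = fun _ => none := rfl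
    simpa [hm₄, this] using hbk (n * n) (pairCode (n := n)) 6 7 8
  · exact hb₄
  · intro v; simp [hm₄, himem, emptyConf]
  · intro v; simp [hm₄, himem, emptyConf, Conf.deg]
  · intro v; simp [emptyConf]
  · exact ⟨⟨0, by omega⟩, by simp [emptyConf, hi₄, hi₃, hi₂, hi₁, inputState]⟩
  · simp; omega

end VWDSG
-- Approximation quality and the amortized invariant.
namespace VWDSG
open RealRAM Conf

variable {n : ℕ} {G : SimpleGraph (Fin n)} {k L M i : ℕ} {ε T W : ℝ} {w : Fin n → ℝ} {A : Conf n}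

theorem half_le_log_one_add {x : ℝ} (h0 : 0 ≤ x) (h1 : x ≤ 1) : x / 2 ≤ Real.log (1 + x) := by
  refine le_trans ?_ (Real.one_sub_inv_le_log_of_pos (by linarith))
  have : 1 - (1 + x)⁻¹ = x / (1 + x) := by field_simp; ring
  rw [this]
  exact div_le_div_of_nonneg_left h0 (by linarith) (by linarith)

theorem density_nonneg (hw : ∀ v, 1 ≤ w v) (S : Finset (Fin n)) : 0 ≤ density G w S :=
  div_nonneg (Nat.cast_nonneg _) (Finset.sum_nonneg fun v _ => by linarith [hw v])

theorem IsCut.sub_le (h : IsCut ε w A M i) (hw : ∀ v, 1 ≤ w v) (hε : 0 < ε) (hε1 : ε ≤ 1)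
    (hW : ∀ v, w v ≤ W) (hlog : 2 ≤ Real.log (n * W) / ε) :
    ((M - i : ℕ) : ℝ) ≤ 18 * (Real.log (n * W) / ε) := by
  rcases Nat.lt_or_ge i M with hi | hi
  -- The largest `d` for which `IsCut.pow_le` applies; it is at most 8 times `log (n * W) / ε`, and
  -- rounding adds 2 levels.
  · obtain ⟨d, hd, hd'⟩ : ∃ d, i + 2 * d < M ∧ M - i ≤ 2 * d + 2 := ⟨(M - i - 1) / 2, by omega, by omega⟩
    have h1 := Real.log_le_log (by positivity) (h.pow_le hw hε hW d hd)
    rw [Real.log_pow] at h1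
    have h2 := half_le_log_one_add (x := ε / 4) (by linarith) (by linarith)
    have h3 : (d : ℝ) * (ε / 8) ≤ Real.log (n * W) := by
      refine le_trans ?_ h1
      exact mul_le_mul_of_nonneg_left (by linarith) (by positivity)
    have h4 : (d : ℝ) ≤ 8 * (Real.log (n * W) / ε) := by
      rw [mul_div_assoc', le_div_iff₀ hε]
      linarith
    have h5 : ((M - i : ℕ) : ℝ) ≤ 2 * d + 2 := by exact_mod_cast hd'
    linarith
  · have : M - i = 0 := by omega
    rw [this]
    push_cast
    linarith

theorem Valid.theta_top_le (h : Valid G k L w A) (hc : IsCut ε w A M i) (hk : 2 ≤ k)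
    (hw : ∀ v, 1 ≤ w v) (hε : 0 < ε) (hε1 : ε ≤ 1) (hW : ∀ v, w v ≤ W)
    (hlog : 2 ≤ Real.log (n * W) / ε) (hkW : 300 * (Real.log (n * W) / ε ^ 2) ≤ k) :
    theta k (M + 1) ≤ (1 + ε / 4) * ((1 + ε / 4) * density G w (upSet A i) +
      38 * (Real.log (n * W) / ε)) := by
  have hD := hc.sub_le hw hε hε1 hW hlog
  set b := Real.log (n * W) / ε with hb
  have hρ := density_nonneg (G := G) hw (upSet A i)
  set ρ := density G w (upSet A i) with hρ'
  have hk0 : (0 : ℝ) < k := by positivity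
  -- The summand 2 covers a cut at level 0, where `theta k 1 = 2`.
  have h1 : theta k (i + 1) ≤ (1 + ε / 4) * ρ + 2 := by
    rcases hc.halts with hi | hi
    · subst hi
      have : theta k (0 + 1) = 2 := by simp [theta]
      rw [this]
      have : 0 ≤ (1 + ε / 4) * ρ := by positivity
      linarith
    · have hpos : 0 < upWeight w A i :=
        Finset.sum_pos (fun v _ => by linarith [hw v]) hc.nonempty
      have h2 := h.density_ge hk hw i
      have h3 : 0 < upWeight w A (i + 2) := by
        by_contra hcon
        push Not at hcon
        nlinarith
      have h4 : theta k (i + 1) * upWeight w A (i + 2) ≤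
          ((1 + ε / 4) * ρ) * upWeight w A (i + 2) := by
        refine h2.trans ?_
        have := mul_le_mul_of_nonneg_left hi hρ
        linarith
      have := le_of_mul_le_mul_right h4 h3
      linarith
  have h2 : (1 + 2 / k : ℝ) ^ (M - i) ≤ 1 + ε / 4 := by
    have e1 : (1 + 2 / k : ℝ) ^ (M - i) ≤ Real.exp (2 / k) ^ (M - i) := by
      refine pow_le_pow_left₀ (by positivity) ?_ _
      have := Real.add_one_le_exp (2 / k : ℝ)
      linarith
    rw [← Real.exp_nat_mul] at e1
    -- From the depth 18 and the constant 300: `36 / 300 < 1 / 8`.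
    have e2 : ((M - i : ℕ) : ℝ) * (2 / k) ≤ ε / 8 := by
      have h5 : 300 * b ≤ k * ε := by
        have : 300 * (Real.log (n * W) / ε ^ 2) * ε = 300 * b := by
          rw [hb]; field_simp
        rw [← this]
        exact mul_le_mul_of_nonneg_right hkW hε.le
      rw [mul_div_assoc', div_le_iff₀ hk0]
      linarith
    refine e1.trans ((Real.exp_le_exp.2 e2).trans ?_)
    refine (Real.exp_bound_div_one_sub_of_interval (by linarith) (by linarith)).trans ?_
    rw [div_le_iff₀ (by linarith)]
    nlinarith
  have h3 : M + 1 = (i + 1) + (M - i) := by have := hc.le; omega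
  rw [h3]
  refine (theta_add_le k (i + 1) (M - i)).trans ?_
  have h4 := theta_nonneg k (i + 1)
  refine mul_le_mul h2 (by linarith) (by positivity) (by positivity)

theorem Valid.quality (h : Valid G k L w A) (hc : IsCut ε w A M i) (hk : 2 ≤ k)
    (hw : ∀ v, 1 ≤ w v) (hε : 0 < ε) (hε1 : ε ≤ 1 / 10) (hW : ∀ v, w v ≤ W)
    (hlog : 2 ≤ Real.log (n * W) / ε) (hkW : 300 * (Real.log (n * W) / ε ^ 2) ≤ k)
    (hL : 4 * T ≤ theta k L) (hT : 100 * (Real.log (n * W) / ε) ≤ T) (hopt : optLP G w ≤ T) :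
    (∀ v, A.deg v ≤ w v * ((1 + ε) * optLP G w + 50 * (Real.log (n * W) / ε))) ∧
      (1 - ε) * optLP G w - 50 * (Real.log (n * W) / ε) ≤ density G w (upSet A i) := by
  have h1 := h.theta_top_le hc hk hw hε (by linarith) hW hlog hkW
  have h2 := density_le_optLP h.orients hw hc.nonempty
  have hρ := density_nonneg (G := G) hw (upSet A i)
  set b := Real.log (n * W) / ε with hb
  set ρ := density G w (upSet A i) with hρ'
  set X := theta k (M + 1) with hX
  have hX0 : 0 ≤ X := theta_nonneg _ _
  have e1 : (1 + ε / 4) * (1 + ε / 4) ≤ 1 + ε := by nlinarith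
  have h3 : X ≤ (1 + ε) * ρ + 50 * b := by nlinarith
  -- That the maximal level is not reached is a consequence: the bound on `X` rests on lower bounds
  -- for loads only, and it gives `X < 4 * T`. Only now do upper bounds for the loads become
  -- available.
  have hML : M < L := by
    by_contra hcon
    have h4 : theta k L ≤ X := theta_mono k (by omega)
    nlinarith
  have hdeg : ∀ v, A.deg v ≤ w v * X := by
    intro v
    have h5 := hc.le_top v
    refine (h.deg_le hk (by omega)).trans ?_
    exact mul_le_mul_of_nonneg_left (theta_mono k (by omega)) (by linarith [hw v])
  have h4 : optLP G w ≤ X := optLP_le h.orients hdeg hX0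
  refine ⟨fun v => (hdeg v).trans ?_, ?_⟩
  · refine mul_le_mul_of_nonneg_left ?_ (by linarith [hw v])
    nlinarith
  · have h5 : (1 - ε) * optLP G w ≤ (1 - ε) * ((1 + ε) * ρ + 50 * b) :=
      mul_le_mul_of_nonneg_left (by linarith) (by linarith)
    nlinarith

theorem Stored.storedArc_iff {s : State} (h : Stored k L ε w s A) (u v : Fin n) :
    storedArc s u v ↔ (A.lab (u, v)).isSome := by
  have := h.arc (u, v)
  rw [storedArc]
  change s.imem 0 (u * n + v) = _ at this
  rw [this]
  split_ifs with h <;> simp [h]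

theorem Stored.isOrientation {s : State} (h : Stored k L ε w s A) (hv : Valid G k L w A) :
    IsOrientation G (storedArc s) := by
  refine ⟨fun u v huv => ?_, fun u v huv => ?_⟩
  · rw [h.storedArc_iff] at huv
    exact (hv.orients.adj u v).2 (.inl huv)
  · rw [h.storedArc_iff, h.storedArc_iff]
    rcases (hv.orients.adj u v).1 huv with h1 | h1
    · exact .inl ⟨h1, by simp [hv.orients.asymm _ _ h1]⟩
    · exact .inr ⟨h1, by simp [hv.orients.asymm _ _ h1]⟩

theorem Stored.load_eq {s : State} (h : Stored k L ε w s A) (v : Fin n) :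
    load w (storedArc s) v = A.deg v / w v := by
  have : {u | storedArc s u v} =
      ((Finset.univ.filter fun u => (A.lab (u, v)).isSome : Finset (Fin n)) : Set (Fin n)) := by
    ext u
    simp [h.storedArc_iff]
  rw [load, this, Set.ncard_coe_finset]
  rfl

theorem valid_emptyConf (hk : 2 ≤ k) (hw : ∀ v, 1 ≤ w v) : Valid ⊥ k L w (emptyConf n) := by
  have hk' : (2 : ℝ) ≤ k := by exact_mod_cast hk
  refine ⟨⟨by simp [emptyConf], by simp [emptyConf]⟩, ⟨by simp [emptyConf], by simp [emptyConf],
    by simp [emptyConf], by simp [emptyConf]⟩, fun v => ⟨fun _ _ => ?_, fun h => ?_⟩⟩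
  · simp only [lo, hi, num, emptyConf, reduceCtorEq, Finset.filter_false, Finset.card_empty, theta]
    have := mul_nonneg (by linarith : (0 : ℝ) ≤ k - 1) (by linarith [hw v] : 0 ≤ w v)
    norm_num
    linarith
  · simp [emptyConf] at h

/-- By Bernoulli, `(1 + 2 / k) ^ k ≥ 3 > e`, so `k` levels gain a factor `e`; this bounds the number
of levels for every admissible `k` at once. -/
theorem le_theta_of_exp_le {j N : ℕ} {x : ℝ} (hk : 2 ≤ k) (hkN : k ≤ N)
    (hx : x + 1 ≤ Real.exp j) (hx0 : 0 ≤ x) : x ≤ theta k (N * j) := by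
  have hk' : (2 : ℝ) ≤ k := by exact_mod_cast hk
  rw [theta_eq (by omega)]
  have h1 : Real.exp 1 ≤ (1 + 2 / k : ℝ) ^ k := by
    have h2 := one_add_mul_le_pow (a := (2 / k : ℝ)) (by
      have : (0 : ℝ) ≤ 2 / k := by positivity
      linarith) k
    have h3 : (1 : ℝ) + k * (2 / k) = 3 := by field_simp; norm_num
    have := Real.exp_one_lt_d9
    linarith
  have h0 : (1 : ℝ) ≤ (1 + 2 / k : ℝ) := by
    have : (0 : ℝ) ≤ 2 / k := by positivity
    linarith
  have h2 : Real.exp j ≤ (1 + 2 / k : ℝ) ^ (N * j) := by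
    calc Real.exp j = Real.exp 1 ^ j := by rw [← Real.exp_nat_mul, mul_one]
      _ ≤ ((1 + 2 / k : ℝ) ^ k) ^ j := pow_le_pow_left₀ (Real.exp_pos _).le h1 j
      _ = (1 + 2 / k : ℝ) ^ (k * j) := (pow_mul _ _ _).symm
      _ ≤ _ := pow_le_pow_right₀ h0 (Nat.mul_le_mul_right _ hkN)
  nlinarith

/-- The data structure. -/
def levelStructure : DataStructure where
  init := initProgram
  insert := insertProgram
  delete := deleteProgram
  query := queryProgram

/-- The steps spent plus 400 times the potential grow by at most `400 * (2 * L + 4)` in an insertion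
and by `400 * (L + k + 4) + 400 * (2 * L + k)` in a deletion; the rate is the latter. -/
theorem reach_invariant {B : ℕ} {s₀ : State} (hB : n * (L + 3) * (n * n) + k + 100 < B)
    (hk : 2 ≤ k) (hw : ∀ v, 1 ≤ w v) (hε : 0 < ε) (h₀ : Stored k L ε w s₀ (emptyConf n))
    {m τ : ℕ} {s : State} (h : Reach levelStructure B s₀ m τ G s) :
    ∃ A, Stored k L ε w s A ∧ Valid G k L w A ∧
      τ + 400 * A.phi L ≤ m * (400 * (3 * L + 2 * k + 4)) := by
  induction h with
  | start => exact ⟨_, h₀, valid_emptyConf hk hw, by simp [phi, emptyConf]⟩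
  | insert _ hne hadj he ih =>
    obtain ⟨A, hs, hv, ht⟩ := ih
    obtain ⟨A', hs', hv', ht', -⟩ := (wp_insertProgram hB hk hw
      ((hs.setI (by omega) _).setI (by omega) _) hv hne hadj (by simp) (by simp)).of_exec he
    refine ⟨A', hs', hv', ?_⟩
    rw [Nat.add_mul]
    omega
  | delete _ hadj he ih =>
    obtain ⟨A, hs, hv, ht⟩ := ih
    obtain ⟨A', hs', hv', ht', ht''⟩ := (wp_deleteProgram hB hk hw
      ((hs.setI (by omega) _).setI (by omega) _) hv hadj (by simp) (by simp)).of_exec he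
    refine ⟨A', hs', hv', ?_⟩
    rw [Nat.add_mul]
    omega
  | query _ he ih =>
    obtain ⟨A, hs, hv, ht⟩ := ih
    obtain ⟨M, i, hs', -⟩ := (wp_queryProgram hB hs hv.fair.lev_le hw hε).of_exec he
    exact ⟨A, hs', hv, ht⟩

/-- Elementary estimates for the parameters of the theorem. -/
theorem parameter_bounds (hn : 2 ≤ n) (hW1 : 1 ≤ W) (hε : 0 < ε) (hε1 : ε < 1 / 10)
    (hT : 1000 * (Real.log (n * W) / ε ^ 2) ≤ T) :
    1 / 2 ≤ Real.log (n * W) ∧ 2 ≤ Real.log T ∧ 0 < T ∧ 2 ≤ Real.log (n * W) / ε ∧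
      100 * (Real.log (n * W) / ε) ≤ T ∧ 10 ≤ Real.log T * Real.log (n * W) / ε ∧
      1 ≤ Real.log (Real.log T * Real.log (n * W) / ε) := by
  have hn' : (2 : ℝ) ≤ n := by exact_mod_cast hn
  have h2 : (2 : ℝ) ≤ n * W := by nlinarith
  have hlg : 1 / 2 ≤ Real.log (n * W) := by
    have h3 := Real.log_le_log (by norm_num) h2
    have h4 := Real.log_two_gt_d9
    linarith
  set lg := Real.log (n * W) with hlg'
  have hdiv : 5 ≤ lg / ε := by
    rw [le_div_iff₀ hε]
    linarith
  have hdiv2 : lg / ε ^ 2 = (lg / ε) / ε := by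
    field_simp
  have hdiv3 : 10 * (lg / ε) ≤ lg / ε ^ 2 := by
    rw [hdiv2, le_div_iff₀ hε]
    nlinarith
  have hT2 : Real.exp 2 ≤ T := by
    have h5 : Real.exp 2 = Real.exp 1 * Real.exp 1 := by rw [← Real.exp_add]; norm_num
    have h6 := Real.exp_one_lt_d9
    have h7 := Real.exp_pos 1
    have : Real.exp 2 ≤ 9 := by rw [h5]; nlinarith
    linarith
  have hT0 : 0 < T := (Real.exp_pos 2).trans_le hT2
  have hlT : 2 ≤ Real.log T := (Real.le_log_iff_exp_le hT0).2 hT2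
  have h10 : 10 ≤ Real.log T * lg / ε := by
    rw [mul_div_assoc]
    nlinarith
  refine ⟨hlg, hlT, hT0, by linarith, by linarith, h10, ?_⟩
  rw [Real.le_log_iff_exp_le (by linarith)]
  have := Real.exp_one_lt_d9
  linarith

end VWDSG

/-! ### Numerical estimates for the parameters. -/

namespace VWDSG

open RealRAM Conf

variable {n : ℕ} {w : Fin n → ℝ} {W ε T : ℝ}

/-- The parameters of the preprocessing: exponents bounding `n w` and `1 / ε²`, and the number of
levels. -/
theorem exists_parameters (hn : 2 ≤ n) (hW1 : 1 ≤ W) (hW : ∀ v, w v ≤ W) (hε : 0 < ε)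
    (hε1 : ε < 1 / 10) (hT : 1000 * (Real.log (n * W) / ε ^ 2) ≤ T) :
    ∃ P Q H : ℕ, (∀ v, n * w v ≤ 2 ^ P) ∧ 1 ≤ Q * ε * ε ∧
      (∀ k, 2 ≤ k → k ≤ 300 * (P * Q) → 4 * T ≤ theta k H) ∧
      (P : ℝ) ≤ 4 * Real.log (n * W) ∧ (Q : ℝ) ≤ 2 / ε ^ 2 ∧
      (H : ℝ) ≤ 7200 * (Real.log T * Real.log (n * W) / ε ^ 2) := by
  obtain ⟨ha, hb, hT0, -, hTb, -, -⟩ := parameter_bounds hn hW1 hε hε1 hT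
  have hn' : (2 : ℝ) ≤ n := by exact_mod_cast hn
  have hnW : (0 : ℝ) < n * W := by nlinarith
  set a := Real.log (n * W) with ha'
  have hl2 := Real.log_two_gt_d9
  have hP1 := Nat.le_ceil (a / Real.log 2)
  have hP2 : ((⌈a / Real.log 2⌉₊ : ℕ) : ℝ) ≤ 4 * a := by
    have h1 := (Nat.ceil_lt_add_one (a := a / Real.log 2) (by positivity)).le
    have h2 : a / Real.log 2 ≤ 2 * a := by
      rw [div_le_iff₀ (by linarith)]
      nlinarith
    linarith
  have hQ1 := Nat.le_ceil (1 / ε ^ 2)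
  have hε2 : 1 ≤ 1 / ε ^ 2 := by
    rw [le_div_iff₀ (by positivity)]
    nlinarith
  have hQ2 : ((⌈1 / ε ^ 2⌉₊ : ℕ) : ℝ) ≤ 2 / ε ^ 2 := by
    have h1 := (Nat.ceil_lt_add_one (a := 1 / ε ^ 2) (by positivity)).le
    have h2 : 2 / ε ^ 2 = 1 / ε ^ 2 + 1 / ε ^ 2 := by ring
    linarith
  have hJ1 := Nat.le_ceil (Real.log (4 * T + 1))
  have hT5 : 5 ≤ T := by
    have := (Real.le_log_iff_exp_le hT0).1 hb
    have h5 : Real.exp 2 = Real.exp 1 * Real.exp 1 := by rw [← Real.exp_add]; norm_num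
    have := Real.exp_one_gt_d9
    nlinarith
  have hJ2 : ((⌈Real.log (4 * T + 1)⌉₊ : ℕ) : ℝ) ≤ 3 * Real.log T := by
    have h1 := (Nat.ceil_lt_add_one (a := Real.log (4 * T + 1))
      (Real.log_nonneg (by linarith))).le
    have h2 : Real.log (4 * T + 1) ≤ Real.log (T ^ 2) :=
      Real.log_le_log (by linarith) (by nlinarith)
    rw [Real.log_pow] at h2
    push_cast at h2
    linarith
  -- The third witness allows the largest possible `k`, namely `300 * (P * Q)`, levels for each
  -- factor `e` in `4 * T + 1`.
  refine ⟨⌈a / Real.log 2⌉₊, ⌈1 / ε ^ 2⌉₊,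
    300 * (⌈a / Real.log 2⌉₊ * ⌈1 / ε ^ 2⌉₊) * ⌈Real.log (4 * T + 1)⌉₊, fun v => ?_, ?_,
    fun k hk hkN => ?_, hP2, hQ2, ?_⟩
  · have h1 : n * w v ≤ n * W := by gcongr; exact hW v
    refine h1.trans ?_
    rw [div_le_iff₀ (by linarith), ← Real.log_pow] at hP1
    exact (Real.log_le_log_iff hnW (by positivity)).1 hP1
  · rw [div_le_iff₀ (by positivity)] at hQ1
    linarith [hQ1, sq ε, mul_assoc ((⌈1 / ε ^ 2⌉₊ : ℕ) : ℝ) ε ε]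
  · refine le_theta_of_exp_le hk hkN ?_ (by linarith)
    exact (Real.log_le_iff_le_exp (by linarith)).1 hJ1
  · push_cast
    calc (300 * ((⌈a / Real.log 2⌉₊ : ℕ) * (⌈1 / ε ^ 2⌉₊ : ℕ)) * (⌈Real.log (4 * T + 1)⌉₊ : ℕ) : ℝ)
        ≤ 300 * ((4 * a) * (2 / ε ^ 2)) * (3 * Real.log T) := by gcongr
      _ = _ := by ring

/-- A word bound that is polynomial in the parameters is large enough for all addresses. -/
theorem word_bound {B P Q H : ℕ} {a b : ℝ} (hn : 2 ≤ n) (ha : 1 / 2 ≤ a) (hb : 2 ≤ b) (hε : 0 < ε)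
    (hε1 : ε < 1 / 10) (hP : (P : ℝ) ≤ 4 * a) (hQ : (Q : ℝ) ≤ 2 / ε ^ 2)
    (hH : (H : ℝ) ≤ 7200 * (b * a / ε ^ 2)) (hB : (n * b * a / ε) ^ 9 ≤ (B : ℝ)) :
    n * (H + 3) * (n * n) + 300 * (P * Q) + P + Q + 1000 < B := by
  have hn' : (2 : ℝ) ≤ n := by exact_mod_cast hn
  obtain ⟨e, he⟩ : ∃ e, e = 1 / ε := ⟨_, rfl⟩
  have he10 : 10 ≤ e := by
    rw [he, le_div_iff₀ hε]
    linarith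
  have hX : n * b * a / ε = n * b * a * e := by rw [he]; ring
  have h2 : 2 / ε ^ 2 = 2 * e ^ 2 := by rw [he]; field_simp
  have h3 : b * a / ε ^ 2 = b * a * e ^ 2 := by rw [he]; field_simp
  rw [hX] at hB
  rw [h2] at hQ
  rw [h3] at hH
  set X := n * b * a * e with hX'
  have hba : 1 ≤ b * a := by nlinarith
  have hnX : n ≤ X := by
    have : 1 ≤ b * a * e := by nlinarith
    calc (n : ℝ) = n * 1 := by ring
      _ ≤ n * (b * a * e) := by gcongr
      _ = X := by rw [hX']; ring
  have hX20 : 20 ≤ X := by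
    have : 10 ≤ b * a * e := by nlinarith
    calc (20 : ℝ) = 2 * 10 := by norm_num
      _ ≤ n * (b * a * e) := by gcongr
      _ = X := by rw [hX']; ring
  have hR : b * a * e ^ 2 ≤ X ^ 2 := by
    have : 1 ≤ n ^ 2 * (b * a) := by nlinarith
    calc b * a * e ^ 2 = 1 * (b * a * e ^ 2) := by ring
      _ ≤ (n ^ 2 * (b * a)) * (b * a * e ^ 2) := by gcongr
      _ = X ^ 2 := by rw [hX']; ring
  have hPQ : (P * Q : ℝ) ≤ 4 * X ^ 2 := by
    calc (P * Q : ℝ) ≤ (4 * a) * (2 * e ^ 2) := by gcongr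
      _ = 4 * (2 * a * e ^ 2) := by ring
      _ ≤ 4 * (b * a * e ^ 2) := by gcongr
      _ ≤ 4 * X ^ 2 := by gcongr
  have hP' : (P : ℝ) ≤ 4 * X ^ 2 := by
    have : a ≤ b * a * e ^ 2 := by
      have : 1 ≤ b * e ^ 2 := by nlinarith
      nlinarith
    linarith
  have hQ' : (Q : ℝ) ≤ 2 * X ^ 2 := by
    have : e ^ 2 ≤ b * a * e ^ 2 := by nlinarith [sq_nonneg e]
    linarith
  have hH' : (H : ℝ) ≤ 7200 * X ^ 2 := by linarith
  have hmain : (n * (H + 3) * (n * n) + 300 * (P * Q) + P + Q + 1000 : ℝ) < B := by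
    have h4 : (n * (H + 3) * (n * n) : ℝ) ≤ X * (7200 * X ^ 2 + 3) * (X * X) := by gcongr
    have h5 : (400 : ℝ) ≤ X ^ 2 := by nlinarith
    have h6 : 20 * X ^ 2 ≤ X ^ 3 := by nlinarith
    have h7 : 400 * X ^ 3 ≤ X ^ 5 := by
      calc 400 * X ^ 3 ≤ X ^ 2 * X ^ 3 := by gcongr
        _ = X ^ 5 := by ring
    have h8 : 160000 * X ^ 5 ≤ X ^ 9 := by
      calc 160000 * X ^ 5 = (20 ^ 4) * X ^ 5 := by norm_num
        _ ≤ X ^ 4 * X ^ 5 := by gcongr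
        _ = X ^ 9 := by ring
    have h9 : X * (7200 * X ^ 2 + 3) * (X * X) = 7200 * X ^ 5 + 3 * X ^ 3 := by ring
    linarith
  exact_mod_cast hmain

end VWDSG

namespace VWDSG

open RealRAM Conf

variable {n : ℕ} {w : Fin n → ℝ} {W ε T : ℝ}

theorem initial_bound_le {P Q H t n : ℕ} {a b σ : ℝ} (ha : 1 / 2 ≤ a) (hb : 2 ≤ b) (hσ : 1 ≤ σ)
    (hε : 0 < ε) (hε1 : ε < 1 / 10) (hP : (P : ℝ) ≤ 4 * a) (hQ : (Q : ℝ) ≤ 2 / ε ^ 2)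
    (hH : (H : ℝ) ≤ 7200 * (b * a / ε ^ 2)) (ht : t ≤ 100 * (n + P + Q + H + 2)) :
    (t : ℝ) ≤ 10 ^ 8 * (n + b * a / ε ^ 2 * σ) := by
  have ht' : (t : ℝ) ≤ 100 * (n + P + Q + H + 2) := by exact_mod_cast ht
  obtain ⟨e, he⟩ : ∃ e, e = 1 / ε ^ 2 := ⟨_, rfl⟩
  have he1 : 1 ≤ e := by
    rw [he, le_div_iff₀ (by positivity)]
    nlinarith
  have h1 : 2 / ε ^ 2 = 2 * e := by rw [he]; ring
  have h2 : b * a / ε ^ 2 = b * a * e := by rw [he]; ring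
  rw [h1] at hQ
  rw [h2] at hH ⊢
  have hba : 1 ≤ b * a := by nlinarith
  have h3 : e ≤ b * a * e := by nlinarith
  have h4 : a ≤ b * a * e := by nlinarith
  have h5 : b * a * e ≤ b * a * e * σ := by nlinarith
  have h6 : (0 : ℝ) ≤ n := by positivity
  nlinarith

theorem amortized_bound_le {k L : ℕ} {a b σ : ℝ} (ha : 1 / 2 ≤ a) (hb : 2 ≤ b) (hσ : 1 ≤ σ)
    (hε : 0 < ε) (hε1 : ε < 1 / 10) (hk : (k : ℝ) ≤ 2400 * (a / ε ^ 2))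
    (hL : (L : ℝ) ≤ 7200 * (b * a / ε ^ 2)) :
    (400 * (3 * L + 2 * k + 4) : ℝ) ≤ 10 ^ 8 * (b * a / ε ^ 2 * σ) := by
  obtain ⟨e, he⟩ : ∃ e, e = 1 / ε ^ 2 := ⟨_, rfl⟩
  have he1 : 1 ≤ e := by
    rw [he, le_div_iff₀ (by positivity)]
    nlinarith
  have h1 : a / ε ^ 2 = a * e := by rw [he]; ring
  have h2 : b * a / ε ^ 2 = b * a * e := by rw [he]; ring
  rw [h1] at hk
  rw [h2] at hL ⊢
  have hba : 1 ≤ b * a := by nlinarith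
  have h3 : 1 ≤ b * a * e := by nlinarith
  have h4 : a * e ≤ b * a * e := by
    have : 0 ≤ a * e := by positivity
    nlinarith
  have h5 : b * a * e ≤ b * a * e * σ := by nlinarith
  nlinarith

theorem worst_bound_le {k L : ℕ} {a b σ : ℝ} (ha : 1 / 2 ≤ a) (hb : 2 ≤ b) (hσ : 1 ≤ σ)
    (hε : 0 < ε) (hε1 : ε < 1 / 10) (hk : (k : ℝ) ≤ 2400 * (a / ε ^ 2))
    (hL : (L : ℝ) ≤ 7200 * (b * a / ε ^ 2)) :
    (400 * (L * (k + 1) + k + 4) : ℝ) ≤ 10 ^ 11 * (b * a ^ 2 / ε ^ 4 * σ) := by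
  obtain ⟨e, he⟩ : ∃ e, e = 1 / ε ^ 2 := ⟨_, rfl⟩
  have he1 : 2 ≤ e := by
    rw [he, le_div_iff₀ (by positivity)]
    nlinarith
  have h1 : a / ε ^ 2 = a * e := by rw [he]; ring
  have h2 : b * a / ε ^ 2 = b * a * e := by rw [he]; ring
  have h3 : b * a ^ 2 / ε ^ 4 = b * a * e * (a * e) := by rw [he]; field_simp
  rw [h1] at hk
  rw [h2] at hL
  rw [h3]
  have hae : 1 ≤ a * e := by nlinarith
  have hk1 : (k + 1 : ℝ) ≤ 2401 * (a * e) := by linarith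
  have h4 : (L * (k + 1) : ℝ) ≤ (7200 * (b * a * e)) * (2401 * (a * e)) := by gcongr
  have hbae : 1 ≤ b * a * e := by nlinarith
  have h5 : a * e ≤ b * a * e * (a * e) := by nlinarith
  have h6 : b * a * e * (a * e) ≤ b * a * e * (a * e) * σ := by
    have : 0 ≤ b * a * e * (a * e) := by positivity
    nlinarith
  nlinarith

end VWDSG

/-! ### The main theorem. -/

open VWDSG RealRAM

theorem mainTheorem3 :
    ∃ (D : VWDSG.DataStructure) (ε₀ C₀ C : ℝ) (κ : ℕ), 0 < ε₀ ∧ 0 < C₀ ∧ 0 < C ∧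
      ∀ (n : ℕ) (w : Fin n → ℝ) (W ε T : ℝ) (B : ℕ),
        2 ≤ n → (∀ v, 1 ≤ w v) → IsGreatest (Set.range w) W →
        0 < ε → ε < ε₀ → C₀ * (Real.log (n * W) / ε ^ 2) ≤ T →
        -- the word length is a large enough multiple of `log (n log T log (nW) / ε)`
        (n * Real.log T * Real.log (n * W) / ε) ^ κ ≤ (B : ℝ) →
        ∃ (t₀ : ℕ) (s₀ : RealRAM.State),
          -- preprocessing of the edgeless graph
          RealRAM.Exec B D.init (VWDSG.inputState w ε T) t₀ s₀ ∧
          (t₀ : ℝ) ≤ C * (n + VWDSG.amortizedRate n W ε T) ∧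
          -- after every sequence of updates and queries
          ∀ (m τ : ℕ) (G : SimpleGraph (Fin n)) (s : RealRAM.State),
            VWDSG.Reach D B s₀ m τ G s →
            -- the orientation
            VWDSG.IsOrientation G (VWDSG.storedArc s) ∧
            (VWDSG.optLP G w ≤ T → ∀ v, VWDSG.load w (VWDSG.storedArc s) v ≤
              (1 + ε) * VWDSG.optLP G w + C * (Real.log (n * W) / ε)) ∧
            -- the subgraph, listed in constant time per vertex
            (∃ (t : ℕ) (s' : RealRAM.State) (S : Finset (Fin n)),
              RealRAM.Exec B D.query s t s' ∧ VWDSG.ListsVertices s' S ∧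
              (t : ℝ) ≤ C * (1 + S.card) ∧
              (VWDSG.optLP G w ≤ T → S.Nonempty ∧
                (1 - ε) * VWDSG.optLP G w - C * (Real.log (n * W) / ε) ≤ VWDSG.density G w S)) ∧
            -- amortized update time
            (τ : ℝ) ≤ m * (C * VWDSG.amortizedRate n W ε T) ∧
            -- worst-case update time
            (∀ u v, u ≠ v → ¬ G.Adj u v → ∃ (t : ℕ) (s' : RealRAM.State),
              RealRAM.Exec B D.insert (VWDSG.withArgs s u v) t s' ∧
              (t : ℝ) ≤ C * VWDSG.worstCaseRate n W ε T) ∧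
            (∀ u v, G.Adj u v → ∃ (t : ℕ) (s' : RealRAM.State),
              RealRAM.Exec B D.delete (VWDSG.withArgs s u v) t s' ∧
              (t : ℝ) ≤ C * VWDSG.worstCaseRate n W ε T) := by
  -- The exponent 9 comes from `word_bound`, and `10 ^ 11` from `worst_bound_le`, the most demanding
  -- of the estimates.
  refine ⟨levelStructure, 1 / 10, 1000, 10 ^ 11, 9, by norm_num, by norm_num, by norm_num, ?_⟩
  intro n w W ε T B hn hw hWg hε hε1 hT hB
  obtain ⟨v₀, hv₀⟩ := hWg.1
  have hW : ∀ v, w v ≤ W := fun v => hWg.2 ⟨v, rfl⟩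
  have hW1 : 1 ≤ W := hv₀ ▸ hw v₀
  obtain ⟨ha, hb, hT0, h2, hT100, -, hσ⟩ := parameter_bounds hn hW1 hε hε1 hT
  obtain ⟨P, Q, H, hPw, hQε, hHT, hP, hQ, hH⟩ := exists_parameters hn hW1 hW hε hε1 hT
  have hBH := word_bound hn ha hb hε hε1 hP hQ hH hB
  obtain ⟨t₀, s₀, hx₀, l, q, L, hlP, hqQ, hLH, hl, hq, hlw, hqε, hLT, h₀, ht₀⟩ :=
    wp_initProgram hn hw hPw hQε hHT hBH
  set k := 300 * (l * q) with hk'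
  have hn' : (2 : ℝ) ≤ n := by exact_mod_cast hn
  have hk2 : 2 ≤ k := by
    have := Nat.mul_le_mul hl hq
    omega
  have hkPQ : k ≤ 300 * (P * Q) := by
    have := Nat.mul_le_mul hlP hqQ
    omega
  have hBL : n * (L + 3) * (n * n) + k + 100 < B := by
    have : n * (L + 3) * (n * n) ≤ n * (H + 3) * (n * n) := by gcongr
    omega
  have hL : (L : ℝ) ≤ 7200 * (Real.log T * Real.log (n * W) / ε ^ 2) :=
    le_trans (by exact_mod_cast hLH) hH
  have hk : (k : ℝ) ≤ 2400 * (Real.log (n * W) / ε ^ 2) := by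
    calc (k : ℝ) ≤ 300 * (P * Q) := by exact_mod_cast hkPQ
      _ ≤ 300 * ((4 * Real.log (n * W)) * (2 / ε ^ 2)) := by gcongr
      _ = _ := by ring
  -- The computed `l` and `q` overestimate `log (n * W)` and `1 / ε²`, because `2 ^ l ≥ n * W` with
  -- `log 2 < 1`, and `q * ε² ≥ 1`.
  have hkW : 300 * (Real.log (n * W) / ε ^ 2) ≤ k := by
    have h3 : Real.log (n * W) ≤ l := by
      have h4 := Real.log_le_log (by positivity) (hv₀ ▸ hlw v₀)
      rw [Real.log_pow] at h4
      have h5 := Real.log_two_lt_d9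
      nlinarith
    have h6 : 1 / ε ^ 2 ≤ q := by
      rw [div_le_iff₀ (by positivity)]
      linarith [mul_assoc (q : ℝ) ε ε, sq ε]
    calc (300 : ℝ) * (Real.log (n * W) / ε ^ 2) = 300 * (Real.log (n * W) * (1 / ε ^ 2)) := by ring
      _ ≤ 300 * (l * q : ℝ) := by gcongr
      _ = k := by rw [hk']; push_cast; ring
  have hlog0 : 0 ≤ Real.log (n * W) / ε := by linarith
  have hpos : 0 ≤ amortizedRate n W ε T := by
    unfold amortizedRate
    positivity
  refine ⟨t₀, s₀, hx₀, ?_, fun m τ G s hr => ?_⟩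
  · refine (initial_bound_le ha hb hσ hε hε1 hP hQ hH ht₀).trans ?_
    change 10 ^ 8 * (n + amortizedRate n W ε T) ≤ _
    gcongr <;> norm_num
  obtain ⟨A, hs, hv, hτ⟩ := reach_invariant hBL hk2 hw hε h₀ hr
  obtain ⟨t, s', hx, M, i, -, hc, hlist, ht⟩ := wp_queryProgram hBL hs hv.fair.lev_le hw hε
  have hqual := hv.quality hc hk2 hw hε hε1.le hW h2 hkW hLT hT100
  have hworst : (400 * (L * (k + 1) + k + 4) : ℝ) ≤ 10 ^ 11 * worstCaseRate n W ε T :=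
    worst_bound_le ha hb hσ hε hε1 hk hL
  refine ⟨hs.isOrientation hv, fun hopt v => ?_, ⟨t, s', upSet A i, hx, hlist, ?_, fun hopt =>
    ⟨hc.nonempty, ?_⟩⟩, ?_, fun u v hne hadj => ?_, fun u v hadj => ?_⟩
  · have hwv : 0 < w v := zero_lt_one.trans_le (hw v)
    rw [hs.load_eq, div_le_iff₀ hwv, mul_comm]
    refine ((hqual hopt).1 v).trans ?_
    gcongr
    norm_num
  · have : (t : ℝ) ≤ 1000 * (1 + (upSet A i).card) := by exact_mod_cast ht
    refine this.trans ?_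
    gcongr
    norm_num
  · refine le_trans ?_ (hqual hopt).2
    gcongr
    norm_num
  · have h3 : (τ : ℝ) ≤ m * (400 * (3 * L + 2 * k + 4)) := by
      have : τ ≤ m * (400 * (3 * L + 2 * k + 4)) := by omega
      exact_mod_cast this
    refine h3.trans ?_
    have h4 : (400 * (3 * L + 2 * k + 4) : ℝ) ≤ 10 ^ 8 * amortizedRate n W ε T :=
      amortized_bound_le ha hb hσ hε hε1 hk hL
    exact mul_le_mul_of_nonneg_left (by linarith) (Nat.cast_nonneg m)
  · obtain ⟨t, s', hx, -, -, -, -, ht⟩ := wp_insertProgram hBL hk2 hw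
      (s := withArgs s u v) ((hs.setI (by omega) u).setI (by omega) v) hv hne
      hadj (by simp [withArgs])
      (by simp [withArgs])
    refine ⟨t, s', hx, le_trans ?_ hworst⟩
    have : t ≤ 400 * (L * (k + 1) + k + 4) := by omega
    exact_mod_cast this
  · obtain ⟨t, s', hx, -, -, -, -, ht⟩ := wp_deleteProgram hBL hk2 hw
      (s := withArgs s u v) ((hs.setI (by omega) u).setI (by omega) v) hv hadj (by simp [withArgs])
      (by simp [withArgs])
    refine ⟨t, s', hx, le_trans ?_ hworst⟩
    have : t ≤ 400 * (L * (k + 1) + k + 4) := by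
      have : L ≤ L * (k + 1) := Nat.le_mul_of_pos_right _ (by omega)
      omega
    exact_mod_cast this
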